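/- Let $(\mathcal V,\otimes,I)$ be a complete and cocomplete symmetric monoidal closed category, let $U=\mathcal V(I,-):\mathcal V\to\mathrm{Set}$, and let $F:\mathrm{Set}\to\mathcal V$, $F(A)=\coprod_{A}I$, be its left adjoint. For a set $S$, let $\mathcal V\mathrm{Quiv}_S$ be the category of families $Q=(Q(a,b))_{a,b\in S}$ of objects of $\mathcal V$, monoidal with $(Q\otimes_S P)(a,b)=\coprod_{c\in S}Q(a,c)\otimes P(c,b)$ and with unit $I_S$, where $I_S(a,a)=I$ and $I_S(a,b)=0$ for $a\neq b$. Let $\Delta_f$ be the category of the posets $[n]=\{0,\dots,n\}$ ($n\ge 0$) and the order-preserving maps that preserve both endpoints, monoidal with $[m]+[n]=[m+n]$ (glueing the top of $[m]$ to the bottom of $[n]$) and unit $[0]$. A *templicial object* of $\mathcal V$ is a pair $(X,S)$ of a set $S$ and a colax monoidal functor $X:\Delta_f^{op}\to\mathcal V\mathrm{Quiv}_S$, with comultiplications $\mu_{k,l}:X_{k+l}\to X_k\otimes_S X_l$, whose counit $X_0\to I_S$ is an isomorphism. A morphism $(X,S)\to(Y,T)$ consists of a map $f:S\to T$ and a monoidal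 natural transformation $f_!X\to Y$, where $f_!$ is left adjoint to the lax monoidal functor $f^*:\mathcal V\mathrm{Quiv}_T\to\mathcal V\mathrm{Quiv}_S$, $f^*(Q)(a,b)=Q(f(a),f(b))$. A small $\mathcal V$-category is a set $\mathrm{Ob}(\mathcal C)$ together with a monoid $\mathcal C$ in $\mathcal V\mathrm{Quiv}_{\mathrm{Ob}(\mathcal C)}$. Its *templicial nerve* $N_{\mathcal V}(\mathcal C)$ is the templicial object with vertex set $\mathrm{Ob}(\mathcal C)$ and $N_{\mathcal V}(\mathcal C)_n=\mathcal C^{\otimes n}$, on which inner faces act by multiplication and degeneracies by insertion of units, and whose comultiplications are the canonical isomorphisms. For a simplicial set $K$, let $\tilde F(K)$ be the templicial object with vertex set $K_0$ and $\tilde F(K)_n(a,b)=F(\{\sigma\in K_n:\sigma\text{ has first vertex }a\text{ and last vertex }b\})$, whose comultiplications are induced by the maps sending $\sigma$ to the pair of its front $k$-face and its back $l$-face. Let $\mathrm{Nec}$ be the category of necklaces: its objects are pairs $(T,p)$ with $p\geq 0$ and $\{0,p\}\subseteq T\subseteq[p]$, and its morphisms $(T,p)\to(T',q)$ are the morphisms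 $f:[p]\to[q]$ of $\Delta_f$ with $T'\subseteq f(T)$. For a templicial object $(X,S)$ and $a,b\in S$ let $X_\bullet(a,b):\mathrm{Nec}^{op}\to\mathcal V$ be the functor that sends $T=\{0=t_0<t_1<\dots<t_k=p\}$ to $(X_{t_1-t_0}\otimes_S\cdots\otimes_S X_{t_k-t_{k-1}})(a,b)$ and that is induced on morphisms by the functoriality of $X$, the comultiplications and the isomorphism $X_0\cong I_S$. A functor $Y:\mathrm{Nec}^{op}\to\mathcal V$ *lifts inner horns uniquely* if for all integers $0<j<n$, every morphism $\tilde F(\Lambda^n_j)_\bullet(0,n)\to Y$ extends uniquely along the morphism $\tilde F(\Lambda^n_j)_\bullet(0,n)\to\tilde F(\Delta^n)_\bullet(0,n)$ induced by the horn inclusion $\Lambda^n_j\subseteq\Delta^n$. **Proposition.** Let $(X,S)$ be a templicial object of $\mathcal V$. Consider the following statements. 1. $(X,S)$ is isomorphic, as a templicial object, to the templicial nerve $N_{\mathcal V}(\mathcal C)$ of a small $\mathcal V$-category $\mathcal C$. 2. For all $a,b\in S$, the functor $X_\bullet(a,b)$ lifts inner horns uniquely. Then (1) implies (2). Moreover,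 if the functor $U$ is conservative, then (1) and (2) are equivalent. -/

import Mathlib

set_option linter.unusedSectionVars false
open CategoryTheory MonoidalCategory Limits Opposite

universe v u

/-- An object of the category of finite intervals: the poset `[n] = {0, ..., n}`. -/
structure FInt where
  len : ℕ

namespace FInt

/-- Morphisms `[m] ⟶ [n]` of finite intervals: monotone maps preserving both endpoints. -/
@[ext]
structure Hom (m n : ℕ) where
  toOrderHom : Fin (m + 1) →o Fin (n + 1)
  map_zero : toOrderHom 0 = 0
  map_last : toOrderHom (Fin.last m) = Fin.last n

namespace Hom

/-- The values of `f : [m] ⟶ [n]` as natural numbers, continued by the value `n` beyond `m`. -/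
def raw {m n : ℕ} (f : Hom m n) (i : ℕ) : ℕ :=
  f.toOrderHom ⟨min i m, by omega⟩

/-- The morphism `[m] ⟶ [n]` with values `f 0, ..., f m`. -/
def ofRaw (m n : ℕ) (f : ℕ → ℕ) (hf : Monotone f) (h0 : f 0 = 0) (hn : f m = n) : Hom m n where
  toOrderHom :=
    { toFun := fun i => ⟨f i, by have := hf (Nat.lt_succ_iff.mp i.2); omega⟩
      monotone' := fun i j hij => hf hij }
  map_zero := Fin.ext h0
  map_last := Fin.ext hn

lemma raw_mono {m n : ℕ} (f : Hom m n) : Monotone f.raw := by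
  intro i j hij
  exact f.toOrderHom.monotone (by simp only [Fin.mk_le_mk]; omega)

lemma raw_zero {m n : ℕ} (f : Hom m n) : f.raw 0 = 0 := by
  have := congrArg Fin.val f.map_zero
  simpa [raw] using this

lemma raw_of_le {m n : ℕ} (f : Hom m n) {i : ℕ} (h : m ≤ i) : f.raw i = n := by
  have := congrArg Fin.val f.map_last
  simpa [raw, h, Fin.last] using this

lemma raw_le {m n : ℕ} (f : Hom m n) (i : ℕ) : f.raw i ≤ n :=
  Nat.lt_succ_iff.mp (f.toOrderHom ⟨min i m, by omega⟩).2

lemma raw_ofRaw {m n : ℕ} {f : ℕ → ℕ} (hf : Monotone f) (h0 : f 0 = 0) (hn : f m = n) (i : ℕ) :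
    (ofRaw m n f hf h0 hn).raw i = f (min i m) := rfl

lemma ext_raw {m n : ℕ} {f g : Hom m n} (h : ∀ i ≤ m, f.raw i = g.raw i) : f = g := by
  ext i
  have h' := h i (Nat.lt_succ_iff.mp i.2)
  have hi : min (i : ℕ) m = i := by omega
  simpa [raw, hi] using h'

/-- The identity of `[m]`. -/
def id (m : ℕ) : Hom m m := ⟨OrderHom.id, rfl, rfl⟩

/-- Composition of morphisms of finite intervals. -/
def comp {m n p : ℕ} (f : Hom m n) (g : Hom n p) : Hom m p :=
  ⟨g.toOrderHom.comp f.toOrderHom, by simp [f.map_zero, g.map_zero],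
    by simp [f.map_last, g.map_last]⟩

lemma raw_id (m i : ℕ) : (id m).raw i = min i m := rfl

lemma raw_comp {m n p : ℕ} (f : Hom m n) (g : Hom n p) (i : ℕ) :
    (f.comp g).raw i = g.raw (f.raw i) := by
  have h : min (f.raw i) n = f.raw i := min_eq_left (f.raw_le i)
  simp only [raw, comp, OrderHom.comp_coe, Function.comp_apply] at h ⊢
  congr 3
  ext
  exact h.symm

/-- The sum `f + g : [m + n] ⟶ [m' + n']`. Its value at `i` is `f i` if `i ≤ m` and `m' + g (i - m)`
if `i ≥ m`; both are `f.raw i + g.raw (i - m)`. -/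
def add {m m' n n' : ℕ} (f : Hom m m') (g : Hom n n') : Hom (m + n) (m' + n') :=
  ofRaw (m + n) (m' + n') (fun i => f.raw i + g.raw (i - m))
    (by intro i j hij; exact add_le_add (f.raw_mono hij) (g.raw_mono (by omega)))
    (by simp [raw_zero])
    (by rw [f.raw_of_le (by omega), g.raw_of_le (by omega)])

lemma raw_add {m m' n n' : ℕ} (f : Hom m m') (g : Hom n n') (i : ℕ) :
    (f.add g).raw i = f.raw i + g.raw (i - m) := by
  change f.raw (min i (m + n)) + g.raw (min i (m + n) - m) = _
  rcases le_total i (m + n) with h | h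
  · rw [min_eq_left h]
  · rw [min_eq_right h, f.raw_of_le (by omega), f.raw_of_le (by omega), g.raw_of_le (by omega),
      g.raw_of_le (by omega)]

/-- The identity `[m] ⟶ [n]` for `m = n`. -/
def cast {m n : ℕ} (h : m = n) : Hom m n :=
  ofRaw m n (fun i => i) monotone_id rfl h

lemma raw_cast {m n : ℕ} (h : m = n) (i : ℕ) : (cast h).raw i = min i m := rfl

end Hom

instance : Category FInt where
  Hom X Y := Hom X.len Y.len
  id X := Hom.id X.len
  comp f g := Hom.comp f g

/-- The values of a morphism. -/
abbrev raw {X Y : FInt} (f : X ⟶ Y) : ℕ → ℕ := Hom.raw f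

lemma hom_ext {X Y : FInt} {f g : X ⟶ Y} (h : ∀ i ≤ X.len, raw f i = raw g i) : f = g :=
  Hom.ext_raw h

lemma raw_id (X : FInt) (i : ℕ) : raw (𝟙 X) i = min i X.len := rfl

lemma raw_comp {X Y Z : FInt} (f : X ⟶ Y) (g : Y ⟶ Z) (i : ℕ) :
    raw (f ≫ g) i = raw g (raw f i) := Hom.raw_comp f g i

/-- The isomorphism `[m] ≅ [n]` for `m = n`. -/
def castIso {X Y : FInt} (h : X.len = Y.len) : X ≅ Y where
  hom := Hom.cast h
  inv := Hom.cast h.symm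
  hom_inv_id := hom_ext fun i hi => by
    rw [raw_comp, raw_id]; simp only [raw, Hom.raw_cast]; omega
  inv_hom_id := hom_ext fun i hi => by
    rw [raw_comp, raw_id]; simp only [raw, Hom.raw_cast]; omega

lemma raw_castIso_hom {X Y : FInt} (h : X.len = Y.len) (i : ℕ) :
    raw (castIso h).hom i = min i X.len := rfl

lemma raw_castIso_inv {X Y : FInt} (h : X.len = Y.len) (i : ℕ) :
    raw (castIso h).inv i = min i Y.len := rfl

instance : MonoidalCategoryStruct FInt where
  tensorObj X Y := ⟨X.len + Y.len⟩
  tensorUnit := ⟨0⟩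
  tensorHom f g := Hom.add f g
  whiskerLeft X _ _ f := Hom.add (Hom.id X.len) f
  whiskerRight f Y := Hom.add f (Hom.id Y.len)
  associator X Y Z := castIso (Nat.add_assoc X.len Y.len Z.len)
  leftUnitor X := castIso (Nat.zero_add X.len)
  rightUnitor X := castIso (Nat.add_zero X.len)

@[simp] lemma tensorObj_len (X Y : FInt) : (X ⊗ Y).len = X.len + Y.len := rfl
@[simp] lemma tensorUnit_len : (𝟙_ FInt).len = 0 := rfl

lemma raw_tensorHom {X X' Y Y' : FInt} (f : X ⟶ X') (g : Y ⟶ Y') (i : ℕ) :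
    raw (f ⊗ₘ g) i = raw f i + raw g (i - X.len) := Hom.raw_add f g i

lemma raw_whiskerLeft (X : FInt) {Y Y' : FInt} (g : Y ⟶ Y') (i : ℕ) :
    raw (X ◁ g) i = min i X.len + raw g (i - X.len) := Hom.raw_add (Hom.id X.len) g i

lemma raw_whiskerRight {X X' : FInt} (f : X ⟶ X') (Y : FInt) (i : ℕ) :
    raw (f ▷ Y) i = raw f i + min (i - X.len) Y.len := Hom.raw_add f (Hom.id Y.len) i

lemma raw_associator_hom (X Y Z : FInt) (i : ℕ) :
    raw (α_ X Y Z).hom i = min i (X.len + Y.len + Z.len) := rfl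

lemma raw_leftUnitor_hom (X : FInt) (i : ℕ) : raw (λ_ X).hom i = min i (0 + X.len) := rfl

lemma raw_rightUnitor_hom (X : FInt) (i : ℕ) : raw (ρ_ X).hom i = min i X.len := rfl

lemma raw_min {X Y : FInt} (f : X ⟶ Y) (i : ℕ) : raw f (min i X.len) = raw f i := by
  rcases le_total i X.len with h | h
  · rw [min_eq_left h]
  · rw [min_eq_right h, raw, Hom.raw_of_le _ le_rfl, Hom.raw_of_le _ h]

lemma raw_le {X Y : FInt} (f : X ⟶ Y) (i : ℕ) : raw f i ≤ Y.len := Hom.raw_le f i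
lemma raw_zero {X Y : FInt} (f : X ⟶ Y) : raw f 0 = 0 := Hom.raw_zero f
lemma raw_of_le {X Y : FInt} (f : X ⟶ Y) {i : ℕ} (h : X.len ≤ i) : raw f i = Y.len :=
  Hom.raw_of_le f h

/-- The monoidal structure on finite intervals: `[m] + [n] = [m + n]`, glueing the top of the first
interval to the bottom of the second one. -/
instance : MonoidalCategory FInt where
  tensorHom_def {X X' Y Y'} f g := hom_ext fun i hi => by
    have h1 := raw_le f i
    simp only [raw_comp, raw_tensorHom, raw_whiskerRight, raw_whiskerLeft, tensorObj_len] at hi ⊢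
    rcases le_total i X.len with h | h
    · have e : i - X.len = 0 := by omega
      simp [e, raw_zero, h1]
    · rw [raw_of_le f h, min_eq_right (by omega), Nat.add_sub_cancel_left, raw_min]
  id_tensorHom_id X Y := hom_ext fun i hi => by
    simp only [raw_tensorHom, raw_id, tensorObj_len] at hi ⊢
    omega
  tensorHom_comp_tensorHom {X Y Z X' Y' Z'} f g h k := hom_ext fun i hi => by
    simp only [raw_comp, raw_tensorHom, tensorObj_len] at hi ⊢
    have h1 := raw_le f i
    rcases le_total i X.len with h | h
    · have e : i - X.len = 0 := by omega
      have e' : raw f i - Y.len = 0 := by omega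
      simp [e, e', raw_zero]
    · rw [raw_of_le f h, raw_of_le _ (show Y.len ≤ Y.len + _ by omega), raw_of_le _ le_rfl]
      simp
  whiskerLeft_id X Y := hom_ext fun i hi => by
    simp only [raw_whiskerLeft, raw_id, tensorObj_len] at hi ⊢
    omega
  id_whiskerRight X Y := hom_ext fun i hi => by
    simp only [raw_whiskerRight, raw_id, tensorObj_len] at hi ⊢
    omega
  associator_naturality {X Y Z X' Y' Z'} f g h := hom_ext fun i hi => by
    have h1 := raw_le f i
    have h2 := raw_le g (i - X.len)
    have h3 := raw_le h (i - (X.len + Y.len))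
    simp only [raw_comp, raw_tensorHom, raw_associator_hom, tensorObj_len] at hi ⊢
    rw [min_eq_left hi, min_eq_left (by omega), Nat.sub_sub, Nat.add_assoc]
  leftUnitor_naturality {X Y} f := hom_ext fun i hi => by
    simp only [raw_comp, raw_whiskerLeft, raw_leftUnitor_hom, tensorObj_len, tensorUnit_len] at hi ⊢
    have h1 := raw_le f i
    simp only [Nat.sub_zero, Nat.min_zero, Nat.zero_add] at hi ⊢
    rw [raw_min, min_eq_left h1]
  rightUnitor_naturality {X Y} f := hom_ext fun i hi => by
    simp only [raw_comp, raw_whiskerRight, raw_rightUnitor_hom, tensorObj_len, tensorUnit_len,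
      Nat.min_zero, Nat.add_zero] at hi ⊢
    rw [raw_min, min_eq_left (raw_le f i)]
  pentagon W X Y Z := hom_ext fun i hi => by
    simp only [raw_comp, raw_whiskerRight, raw_whiskerLeft, raw_associator_hom, tensorObj_len]
      at hi ⊢
    omega
  triangle X Y := hom_ext fun i hi => by
    simp only [raw_comp, raw_whiskerRight, raw_whiskerLeft, raw_associator_hom, raw_leftUnitor_hom,
      raw_rightUnitor_hom, tensorObj_len, tensorUnit_len] at hi ⊢
    omega

end FInt


section Distributivity

variable {V : Type u} [Category.{v} V] [MonoidalCategory V] [BraidedCategory V] [MonoidalClosed V]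

/-- A morphism out of `A ⊗ ∐ Z`, given on the summands `A ⊗ Z i`. -/
noncomputable def tensorSigmaDesc {J : Type*} (A : V) {Z : J → V} [HasCoproduct Z] {W : V}
    (f : ∀ i, A ⊗ Z i ⟶ W) : A ⊗ (∐ Z) ⟶ W :=
  MonoidalClosed.uncurry (Sigma.desc fun i => MonoidalClosed.curry (f i))

lemma whiskerLeft_ι_tensorSigmaDesc {J : Type*} (A : V) {Z : J → V} [HasCoproduct Z] {W : V}
    (f : ∀ i, A ⊗ Z i ⟶ W) (i : J) : A ◁ Sigma.ι Z i ≫ tensorSigmaDesc A f = f i := by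
  rw [tensorSigmaDesc, ← MonoidalClosed.uncurry_natural_left, Sigma.ι_desc,
    MonoidalClosed.uncurry_curry]

lemma whiskerLeft_ι_tensorSigmaDesc_assoc {J : Type*} (A : V) {Z : J → V} [HasCoproduct Z]
    {W W' : V} (f : ∀ i, A ⊗ Z i ⟶ W) (i : J) (g : W ⟶ W') :
    A ◁ Sigma.ι Z i ≫ tensorSigmaDesc A f ≫ g = f i ≫ g := by
  rw [← Category.assoc, whiskerLeft_ι_tensorSigmaDesc]

lemma tensorSigma_hom_ext {J : Type*} {A : V} {Z : J → V} [HasCoproduct Z] {W : V}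
    {f g : A ⊗ (∐ Z) ⟶ W} (h : ∀ i, A ◁ Sigma.ι Z i ≫ f = A ◁ Sigma.ι Z i ≫ g) : f = g := by
  apply MonoidalClosed.curry_injective
  refine Sigma.hom_ext _ _ fun i => ?_
  rw [← MonoidalClosed.curry_natural_left, ← MonoidalClosed.curry_natural_left, h]

/-- A morphism out of `(∐ Z) ⊗ A`, given on the summands `Z i ⊗ A`. -/
noncomputable def sigmaTensorDesc {J : Type*} (A : V) {Z : J → V} [HasCoproduct Z] {W : V}
    (f : ∀ i, Z i ⊗ A ⟶ W) : (∐ Z) ⊗ A ⟶ W :=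
  (β_ (∐ Z) A).hom ≫ tensorSigmaDesc A fun i => (β_ (Z i) A).inv ≫ f i

lemma ι_whiskerRight_sigmaTensorDesc {J : Type*} (A : V) {Z : J → V} [HasCoproduct Z] {W : V}
    (f : ∀ i, Z i ⊗ A ⟶ W) (i : J) : Sigma.ι Z i ▷ A ≫ sigmaTensorDesc A f = f i := by
  rw [sigmaTensorDesc, BraidedCategory.braiding_naturality_left_assoc,
    whiskerLeft_ι_tensorSigmaDesc, Iso.hom_inv_id_assoc]

lemma ι_whiskerRight_sigmaTensorDesc_assoc {J : Type*} (A : V) {Z : J → V} [HasCoproduct Z]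
    {W W' : V} (f : ∀ i, Z i ⊗ A ⟶ W) (i : J) (g : W ⟶ W') :
    Sigma.ι Z i ▷ A ≫ sigmaTensorDesc A f ≫ g = f i ≫ g := by
  rw [← Category.assoc, ι_whiskerRight_sigmaTensorDesc]

lemma sigmaTensor_hom_ext {J : Type*} {A : V} {Z : J → V} [HasCoproduct Z] {W : V}
    {f g : (∐ Z) ⊗ A ⟶ W} (h : ∀ i, Sigma.ι Z i ▷ A ≫ f = Sigma.ι Z i ▷ A ≫ g) : f = g := by
  rw [← cancel_epi (β_ A (∐ Z)).hom]
  refine tensorSigma_hom_ext fun i => ?_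
  rw [BraidedCategory.braiding_naturality_right_assoc,
    BraidedCategory.braiding_naturality_right_assoc, h]

end Distributivity

/-- `V`-enriched quivers with vertex set `S`. -/
structure VQuiver (V : Type u) (S : Type v) where
  obj : S → S → V

namespace VQuiver

section Category

variable {V : Type u} [Category.{v} V] {S : Type v}

/-- Morphisms of quivers are families of morphisms of `V`. -/
@[ext]
structure Hom (Q P : VQuiver V S) where
  app : ∀ a b, Q.obj a b ⟶ P.obj a b

instance : Category (VQuiver V S) where
  Hom Q P := Hom Q P
  id Q := ⟨fun a b => 𝟙 (Q.obj a b)⟩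
  comp f g := ⟨fun a b => f.app a b ≫ g.app a b⟩

@[ext]
lemma hom_ext {Q P : VQuiver V S} {f g : Q ⟶ P} (h : ∀ a b, f.app a b = g.app a b) : f = g :=
  Hom.ext (funext fun a => funext fun b => h a b)

@[simp] lemma id_app (Q : VQuiver V S) (a b : S) : (𝟙 Q : Q ⟶ Q).app a b = 𝟙 (Q.obj a b) := rfl

@[simp] lemma comp_app {Q P R : VQuiver V S} (f : Q ⟶ P) (g : P ⟶ R) (a b : S) :
    (f ≫ g).app a b = f.app a b ≫ g.app a b := rfl

/-- Evaluation of quivers at a pair of vertices. -/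
def eval (a b : S) : VQuiver V S ⥤ V where
  obj Q := Q.obj a b
  map f := f.app a b

end Category

section Monoidal

variable {V : Type u} [Category.{v} V] [MonoidalCategory V] [BraidedCategory V] [MonoidalClosed V]
  [HasColimits V] {S : Type v}

/-- `(Q ⊗ P)(a, b) = ∐ c, Q(a, c) ⊗ P(c, b)`. -/
noncomputable def tensor (Q P : VQuiver V S) : VQuiver V S :=
  ⟨fun a b => ∐ fun c : S => Q.obj a c ⊗ P.obj c b⟩

/-- The unit quiver is the monoidal unit at `(a, a)`, and the initial object at `(a, b)` for
`a ≠ b`: it is the coproduct of copies of the unit over the subsingleton of proofs of `a = b`. -/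
noncomputable def unit (V : Type u) [Category.{v} V] [MonoidalCategory V] [HasColimits V]
    (S : Type v) : VQuiver V S :=
  ⟨fun a b => ∐ fun _ : PLift (a = b) => 𝟙_ V⟩

/-- The inclusion of a summand of the tensor product of quivers. -/
noncomputable def ι (Q P : VQuiver V S) (a c b : S) : Q.obj a c ⊗ P.obj c b ⟶ (tensor Q P).obj a b :=
  Sigma.ι (fun c : S => Q.obj a c ⊗ P.obj c b) c

/-- The inclusion of the summand of the unit quiver. -/
noncomputable def ιUnit {a b : S} (h : a = b) : 𝟙_ V ⟶ (unit V S).obj a b :=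
  Sigma.ι (fun _ : PLift (a = b) => 𝟙_ V) ⟨h⟩

/-- A morphism out of a tensor product, given on the summands. -/
noncomputable def desc {Q P : VQuiver V S} {a b : S} {W : V} (f : ∀ c, Q.obj a c ⊗ P.obj c b ⟶ W) :
    (tensor Q P).obj a b ⟶ W := Sigma.desc f

@[simp] lemma ι_desc {Q P : VQuiver V S} {a b : S} {W : V} (f : ∀ c, Q.obj a c ⊗ P.obj c b ⟶ W) (c : S) :
    ι Q P a c b ≫ desc f = f c := Sigma.ι_desc _ _

@[simp] lemma ι_desc_assoc {Q P : VQuiver V S} {a b : S} {W W' : V}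
    (f : ∀ c, Q.obj a c ⊗ P.obj c b ⟶ W) (c : S) (g : W ⟶ W') :
    ι Q P a c b ≫ desc f ≫ g = f c ≫ g := by
  rw [← Category.assoc, ι_desc]

lemma tensor_ext {Q P : VQuiver V S} {a b : S} {W : V} {f g : (tensor Q P).obj a b ⟶ W}
    (h : ∀ c, ι Q P a c b ≫ f = ι Q P a c b ≫ g) : f = g := Sigma.hom_ext _ _ h

/-- A morphism out of `(Q ⊗ P)(a, c) ⊗ A`, given on the summands. -/
noncomputable def descR {Q P : VQuiver V S} {a c : S} {A W : V}
    (f : ∀ d, (Q.obj a d ⊗ P.obj d c) ⊗ A ⟶ W) : (tensor Q P).obj a c ⊗ A ⟶ W := sigmaTensorDesc A f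

@[simp] lemma ι_descR {Q P : VQuiver V S} {a c : S} {A W : V}
    (f : ∀ d, (Q.obj a d ⊗ P.obj d c) ⊗ A ⟶ W) (d : S) :
    ι Q P a d c ▷ A ≫ descR f = f d := ι_whiskerRight_sigmaTensorDesc A f d

@[simp] lemma ι_descR_assoc {Q P : VQuiver V S} {a c : S} {A W W' : V}
    (f : ∀ d, (Q.obj a d ⊗ P.obj d c) ⊗ A ⟶ W) (d : S) (g : W ⟶ W') :
    ι Q P a d c ▷ A ≫ descR f ≫ g = f d ≫ g := by
  rw [← Category.assoc, ι_descR]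

lemma tensorR_ext {Q P : VQuiver V S} {a c : S} {A W : V} {f g : (tensor Q P).obj a c ⊗ A ⟶ W}
    (h : ∀ d, ι Q P a d c ▷ A ≫ f = ι Q P a d c ▷ A ≫ g) : f = g := sigmaTensor_hom_ext h

/-- A morphism out of `A ⊗ (Q ⊗ P)(c, b)`, given on the summands. -/
noncomputable def descL {Q P : VQuiver V S} {c b : S} {A W : V}
    (f : ∀ d, A ⊗ (Q.obj c d ⊗ P.obj d b) ⟶ W) : A ⊗ (tensor Q P).obj c b ⟶ W := tensorSigmaDesc A f

@[simp] lemma ι_descL {Q P : VQuiver V S} {c b : S} {A W : V}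
    (f : ∀ d, A ⊗ (Q.obj c d ⊗ P.obj d b) ⟶ W) (d : S) :
    A ◁ ι Q P c d b ≫ descL f = f d := whiskerLeft_ι_tensorSigmaDesc A f d

@[simp] lemma ι_descL_assoc {Q P : VQuiver V S} {c b : S} {A W W' : V}
    (f : ∀ d, A ⊗ (Q.obj c d ⊗ P.obj d b) ⟶ W) (d : S) (g : W ⟶ W') :
    A ◁ ι Q P c d b ≫ descL f ≫ g = f d ≫ g := by
  rw [← Category.assoc, ι_descL]

lemma tensorL_ext {Q P : VQuiver V S} {c b : S} {A W : V} {f g : A ⊗ (tensor Q P).obj c b ⟶ W}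
    (h : ∀ d, A ◁ ι Q P c d b ≫ f = A ◁ ι Q P c d b ≫ g) : f = g := tensorSigma_hom_ext h

/-- The tensor product of quiver morphisms. -/
noncomputable def tmap {Q Q' P P' : VQuiver V S} (f : Q ⟶ Q') (g : P ⟶ P') :
    tensor Q P ⟶ tensor Q' P' :=
  ⟨fun a b => desc fun c => (f.app a c ⊗ₘ g.app c b) ≫ ι Q' P' a c b⟩

@[simp] lemma ι_tmap {Q Q' P P' : VQuiver V S} (f : Q ⟶ Q') (g : P ⟶ P') (a c b : S) :
    ι Q P a c b ≫ (tmap f g).app a b = (f.app a c ⊗ₘ g.app c b) ≫ ι Q' P' a c b := ι_desc _ _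

@[simp] lemma ι_tmap_assoc {Q Q' P P' : VQuiver V S} (f : Q ⟶ Q') (g : P ⟶ P') (a c b : S)
    {W : V} (h : (tensor Q' P').obj a b ⟶ W) :
    ι Q P a c b ≫ (tmap f g).app a b ≫ h = (f.app a c ⊗ₘ g.app c b) ≫ ι Q' P' a c b ≫ h := by
  rw [← Category.assoc, ι_tmap, Category.assoc]

/-- The associator of the tensor product of quivers. -/
noncomputable def assocHom (Q P R : VQuiver V S) :
    tensor (tensor Q P) R ⟶ tensor Q (tensor P R) :=
  ⟨fun a b => desc fun c => descR fun d =>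
    (α_ (Q.obj a d) (P.obj d c) (R.obj c b)).hom ≫ Q.obj a d ◁ ι P R d c b ≫ ι Q (tensor P R) a d b⟩

/-- The inverse associator of the tensor product of quivers. -/
noncomputable def assocInv (Q P R : VQuiver V S) :
    tensor Q (tensor P R) ⟶ tensor (tensor Q P) R :=
  ⟨fun a b => desc fun d => descL fun c =>
    (α_ (Q.obj a d) (P.obj d c) (R.obj c b)).inv ≫ ι Q P a d c ▷ R.obj c b ≫ ι (tensor Q P) R a c b⟩

@[simp] lemma ι_assocHom (Q P R : VQuiver V S) (a d c b : S) :
    ι Q P a d c ▷ R.obj c b ≫ ι (tensor Q P) R a c b ≫ (assocHom Q P R).app a b =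
      (α_ (Q.obj a d) (P.obj d c) (R.obj c b)).hom ≫ Q.obj a d ◁ ι P R d c b ≫ ι Q (tensor P R) a d b := by
  simp [assocHom]

@[simp] lemma ι_assocHom_assoc (Q P R : VQuiver V S) (a d c b : S) {W : V}
    (h : (tensor Q (tensor P R)).obj a b ⟶ W) :
    ι Q P a d c ▷ R.obj c b ≫ ι (tensor Q P) R a c b ≫ (assocHom Q P R).app a b ≫ h =
      (α_ (Q.obj a d) (P.obj d c) (R.obj c b)).hom ≫ Q.obj a d ◁ ι P R d c b ≫ ι Q (tensor P R) a d b ≫ h := by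
  simp [assocHom]

@[simp] lemma ι_assocInv (Q P R : VQuiver V S) (a d c b : S) :
    Q.obj a d ◁ ι P R d c b ≫ ι Q (tensor P R) a d b ≫ (assocInv Q P R).app a b =
      (α_ (Q.obj a d) (P.obj d c) (R.obj c b)).inv ≫ ι Q P a d c ▷ R.obj c b ≫ ι (tensor Q P) R a c b := by
  simp [assocInv]

@[simp] lemma ι_assocInv_assoc (Q P R : VQuiver V S) (a d c b : S) {W : V}
    (h : (tensor (tensor Q P) R).obj a b ⟶ W) :
    Q.obj a d ◁ ι P R d c b ≫ ι Q (tensor P R) a d b ≫ (assocInv Q P R).app a b ≫ h =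
      (α_ (Q.obj a d) (P.obj d c) (R.obj c b)).inv ≫ ι Q P a d c ▷ R.obj c b ≫ ι (tensor Q P) R a c b ≫ h := by
  simp [assocInv]

lemma unitR_ext {a b : S} {A W : V} {f g : (unit V S).obj a b ⊗ A ⟶ W}
    (h : ∀ e : a = b, ιUnit e ▷ A ≫ f = ιUnit e ▷ A ≫ g) : f = g :=
  sigmaTensor_hom_ext fun i => h i.down

lemma unitL_ext {a b : S} {A W : V} {f g : A ⊗ (unit V S).obj a b ⟶ W}
    (h : ∀ e : a = b, A ◁ ιUnit e ≫ f = A ◁ ιUnit e ≫ g) : f = g :=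
  tensorSigma_hom_ext fun i => h i.down

/-- A morphism out of `I(a, b) ⊗ A`. -/
noncomputable def unitDescR {a b : S} {A W : V} (f : a = b → (𝟙_ V ⊗ A ⟶ W)) :
    (unit V S).obj a b ⊗ A ⟶ W := sigmaTensorDesc A fun e => f e.down

@[simp] lemma ι_unitDescR {a b : S} {A W : V} (f : a = b → (𝟙_ V ⊗ A ⟶ W)) (e : a = b) :
    ιUnit e ▷ A ≫ unitDescR f = f e :=
  ι_whiskerRight_sigmaTensorDesc A (fun e : PLift (a = b) => f e.down) ⟨e⟩

/-- A morphism out of `A ⊗ I(a, b)`. -/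
noncomputable def unitDescL {a b : S} {A W : V} (f : a = b → (A ⊗ 𝟙_ V ⟶ W)) :
    A ⊗ (unit V S).obj a b ⟶ W := tensorSigmaDesc A fun e => f e.down

@[simp] lemma ι_unitDescL {a b : S} {A W : V} (f : a = b → (A ⊗ 𝟙_ V ⟶ W)) (e : a = b) :
    A ◁ ιUnit e ≫ unitDescL f = f e :=
  whiskerLeft_ι_tensorSigmaDesc A (fun e : PLift (a = b) => f e.down) ⟨e⟩

/-- The left unitor of the tensor product of quivers. -/
noncomputable def leftUnitHom (Q : VQuiver V S) : tensor (unit V S) Q ⟶ Q :=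
  ⟨fun a b => desc fun c => unitDescR fun e => (λ_ (Q.obj c b)).hom ≫ eqToHom (by rw [e])⟩

/-- The right unitor of the tensor product of quivers. -/
noncomputable def rightUnitHom (Q : VQuiver V S) : tensor Q (unit V S) ⟶ Q :=
  ⟨fun a b => desc fun c => unitDescL fun e => (ρ_ (Q.obj a c)).hom ≫ eqToHom (by rw [e])⟩

@[simp] lemma ι_leftUnitHom (Q : VQuiver V S) (a b : S) :
    ιUnit (rfl : a = a) ▷ Q.obj a b ≫ ι (unit V S) Q a a b ≫ (leftUnitHom Q).app a b =
      (λ_ (Q.obj a b)).hom := by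
  simp [leftUnitHom]

@[simp] lemma ι_leftUnitHom_assoc (Q : VQuiver V S) (a b : S) {W : V} (h : Q.obj a b ⟶ W) :
    ιUnit (rfl : a = a) ▷ Q.obj a b ≫ ι (unit V S) Q a a b ≫ (leftUnitHom Q).app a b ≫ h =
      (λ_ (Q.obj a b)).hom ≫ h := by
  rw [← ι_leftUnitHom]; simp only [Category.assoc]

@[simp] lemma ι_rightUnitHom (Q : VQuiver V S) (a b : S) :
    Q.obj a b ◁ ιUnit (rfl : b = b) ≫ ι Q (unit V S) a b b ≫ (rightUnitHom Q).app a b =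
      (ρ_ (Q.obj a b)).hom := by
  simp [rightUnitHom]

@[simp] lemma ι_rightUnitHom_assoc (Q : VQuiver V S) (a b : S) {W : V} (h : Q.obj a b ⟶ W) :
    Q.obj a b ◁ ιUnit (rfl : b = b) ≫ ι Q (unit V S) a b b ≫ (rightUnitHom Q).app a b ≫ h =
      (ρ_ (Q.obj a b)).hom ≫ h := by
  rw [← ι_rightUnitHom]; simp only [Category.assoc]

lemma tmap_comp {Q Q' Q'' P P' P'' : VQuiver V S} (f : Q ⟶ Q') (g : P ⟶ P')
    (f' : Q' ⟶ Q'') (g' : P' ⟶ P'') : tmap f g ≫ tmap f' g' = tmap (f ≫ f') (g ≫ g') := by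
  ext a b
  refine tensor_ext fun c => ?_
  simp

lemma tmap_id (Q P : VQuiver V S) : tmap (𝟙 Q) (𝟙 P) = 𝟙 (tensor Q P) := by
  ext a b
  refine tensor_ext fun c => ?_
  simp

lemma ι_tmapR {Q Q' P P' : VQuiver V S} (f : Q ⟶ Q') (g : P ⟶ P') (a d c : S) {A A' : V}
    (h : A ⟶ A') : ι Q P a d c ▷ A ≫ ((tmap f g).app a c ⊗ₘ h) =
      ((f.app a d ⊗ₘ g.app d c) ⊗ₘ h) ≫ ι Q' P' a d c ▷ A' := by
  rw [← tensorHom_id, ← tensorHom_id, tensorHom_comp_tensorHom, tensorHom_comp_tensorHom, ι_tmap,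
    Category.id_comp, Category.comp_id]

lemma ι_tmapR_assoc {Q Q' P P' : VQuiver V S} (f : Q ⟶ Q') (g : P ⟶ P') (a d c : S) {A A' W : V}
    (h : A ⟶ A') (k : (tensor Q' P').obj a c ⊗ A' ⟶ W) :
    ι Q P a d c ▷ A ≫ ((tmap f g).app a c ⊗ₘ h) ≫ k =
      ((f.app a d ⊗ₘ g.app d c) ⊗ₘ h) ≫ ι Q' P' a d c ▷ A' ≫ k := by
  rw [← Category.assoc, ι_tmapR, Category.assoc]

lemma ι_tmapL {Q Q' P P' : VQuiver V S} (f : Q ⟶ Q') (g : P ⟶ P') (c d b : S) {A A' : V}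
    (h : A ⟶ A') : A ◁ ι Q P c d b ≫ (h ⊗ₘ (tmap f g).app c b) =
      (h ⊗ₘ (f.app c d ⊗ₘ g.app d b)) ≫ A' ◁ ι Q' P' c d b := by
  rw [← id_tensorHom, ← id_tensorHom, tensorHom_comp_tensorHom, tensorHom_comp_tensorHom, ι_tmap,
    Category.id_comp, Category.comp_id]

lemma ι_tmapL_assoc {Q Q' P P' : VQuiver V S} (f : Q ⟶ Q') (g : P ⟶ P') (c d b : S) {A A' W : V}
    (h : A ⟶ A') (k : A' ⊗ (tensor Q' P').obj c b ⟶ W) :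
    A ◁ ι Q P c d b ≫ (h ⊗ₘ (tmap f g).app c b) ≫ k =
      (h ⊗ₘ (f.app c d ⊗ₘ g.app d b)) ≫ A' ◁ ι Q' P' c d b ≫ k := by
  rw [← Category.assoc, ι_tmapL, Category.assoc]

lemma assocHom_naturality {Q Q' P P' R R' : VQuiver V S} (f : Q ⟶ Q') (g : P ⟶ P') (h : R ⟶ R') :
    tmap (tmap f g) h ≫ assocHom Q' P' R' = assocHom Q P R ≫ tmap f (tmap g h) := by
  ext a b
  refine tensor_ext fun c => tensorR_ext fun d => ?_
  simp only [comp_app, ι_tmap_assoc, ι_tmapR_assoc, ι_assocHom, ι_assocHom_assoc, ι_tmap,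
    ι_tmapL_assoc, associator_naturality_assoc]

lemma leftUnitHom_naturality {Q P : VQuiver V S} (f : Q ⟶ P) :
    tmap (𝟙 (unit V S)) f ≫ leftUnitHom P = leftUnitHom Q ≫ f := by
  ext a b
  refine tensor_ext fun c => unitR_ext fun e => ?_
  subst e
  simp only [comp_app, ι_tmap_assoc, ι_leftUnitHom_assoc, id_app, id_tensorHom,
    ← whisker_exchange_assoc, ι_leftUnitHom, leftUnitor_naturality]

lemma rightUnitHom_naturality {Q P : VQuiver V S} (f : Q ⟶ P) :
    tmap f (𝟙 (unit V S)) ≫ rightUnitHom P = rightUnitHom Q ≫ f := by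
  ext a b
  refine tensor_ext fun c => unitL_ext fun e => ?_
  subst e
  simp only [comp_app, ι_tmap_assoc, ι_rightUnitHom_assoc, id_app, tensorHom_id,
    whisker_exchange_assoc, ι_rightUnitHom, rightUnitor_naturality]

lemma unitM_ext {a b : S} {A B W : V} {f g : (A ⊗ (unit V S).obj a b) ⊗ B ⟶ W}
    (h : ∀ e : a = b, (A ◁ ιUnit e) ▷ B ≫ f = (A ◁ ιUnit e) ▷ B ≫ g) : f = g := by
  rw [← cancel_epi (α_ _ _ _).inv]
  apply MonoidalClosed.curry_injective
  refine unitR_ext fun e => ?_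
  rw [← MonoidalClosed.curry_natural_left, ← MonoidalClosed.curry_natural_left,
    associator_inv_naturality_middle_assoc, associator_inv_naturality_middle_assoc, h]

lemma tensorRR_ext {Q P : VQuiver V S} {a c : S} {A B W : V}
    {f g : ((tensor Q P).obj a c ⊗ A) ⊗ B ⟶ W}
    (h : ∀ d, (ι Q P a d c ▷ A) ▷ B ≫ f = (ι Q P a d c ▷ A) ▷ B ≫ g) : f = g := by
  rw [← cancel_epi (α_ _ _ _).inv]
  refine tensorR_ext fun d => ?_
  rw [associator_inv_naturality_left_assoc, associator_inv_naturality_left_assoc, h]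

lemma assocHom_triangle (Q P : VQuiver V S) :
    assocHom Q (unit V S) P ≫ tmap (𝟙 Q) (leftUnitHom P) = tmap (rightUnitHom Q) (𝟙 P) := by
  ext a b
  refine tensor_ext fun c => tensorR_ext fun d => unitM_ext fun e => ?_
  subst e
  simp only [comp_app, ι_assocHom_assoc, ι_tmap, id_app, id_tensorHom, tensorHom_id,
    associator_naturality_middle_assoc, ← comp_whiskerRight_assoc, ← whiskerLeft_comp_assoc,
    ι_leftUnitHom, ι_rightUnitHom, triangle_assoc]

lemma assocHom_pentagon (Q P R T : VQuiver V S) :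
    tmap (assocHom Q P R) (𝟙 T) ≫ assocHom Q (tensor P R) T ≫ tmap (𝟙 Q) (assocHom P R T) =
      assocHom (tensor Q P) R T ≫ assocHom Q P (tensor R T) := by
  ext a b
  refine tensor_ext fun c => tensorR_ext fun d => tensorRR_ext fun e => ?_
  simp only [comp_app, ι_tmap_assoc, id_app, tensorHom_id, ι_assocHom, ι_assocHom_assoc,
    ← comp_whiskerRight_assoc]
  simp only [comp_whiskerRight, Category.assoc, ι_assocHom_assoc,
    associator_naturality_middle_assoc, ι_tmap, id_app, id_tensorHom]
  rw [associator_naturality_left_assoc, ← whisker_exchange_assoc, ι_assocHom]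
  rw [← whiskerLeft_comp_assoc, ← whiskerLeft_comp_assoc, Category.assoc, ι_assocHom]
  simp

/-- The data of the monoidal structure on quivers. -/
noncomputable instance : MonoidalCategoryStruct (VQuiver V S) where
  tensorObj := tensor
  tensorUnit := unit V S
  tensorHom f g := tmap f g
  whiskerLeft Q _ _ g := tmap (𝟙 Q) g
  whiskerRight f P := tmap f (𝟙 P)
  associator Q P R :=
    { hom := assocHom Q P R
      inv := assocInv Q P R
      hom_inv_id := by
        ext a b
        refine tensor_ext fun c => tensorR_ext fun d => ?_
        simp
      inv_hom_id := by
        ext a b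
        refine tensor_ext fun c => tensorL_ext fun d => ?_
        simp }
  leftUnitor Q :=
    { hom := leftUnitHom Q
      inv := ⟨fun a b => (λ_ (Q.obj a b)).inv ≫ ιUnit rfl ▷ Q.obj a b ≫ ι (unit V S) Q a a b⟩
      hom_inv_id := by
        ext a b
        refine tensor_ext fun c => unitR_ext fun e => ?_
        subst e
        simp
      inv_hom_id := by
        ext a b
        simp }
  rightUnitor Q :=
    { hom := rightUnitHom Q
      inv := ⟨fun a b => (ρ_ (Q.obj a b)).inv ≫ Q.obj a b ◁ ιUnit rfl ≫ ι Q (unit V S) a b b⟩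
      hom_inv_id := by
        ext a b
        refine tensor_ext fun c => unitL_ext fun e => ?_
        subst e
        simp
      inv_hom_id := by
        ext a b
        simp }

/-- The monoidal category of `V`-enriched quivers with vertex set `S`. -/
noncomputable instance : MonoidalCategory (VQuiver V S) where
  tensorHom_def f g := ((tmap_comp _ _ _ _).trans (by rw [Category.id_comp, Category.comp_id]; rfl)).symm
  id_tensorHom_id Q P := tmap_id Q P
  tensorHom_comp_tensorHom f g h k := tmap_comp f g h k
  whiskerLeft_id Q P := tmap_id Q P
  id_whiskerRight Q P := tmap_id Q P
  associator_naturality f g h := assocHom_naturality f g h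
  leftUnitor_naturality f := leftUnitHom_naturality f
  rightUnitor_naturality f := rightUnitHom_naturality f
  pentagon Q P R T := assocHom_pentagon Q P R T
  triangle Q P := assocHom_triangle Q P

end Monoidal

end VQuiver

/-- `f` restricts to a monotone map `[m] ⟶ [n]` that preserves the endpoints. -/
structure IsIntMap (m n : ℕ) (f : ℕ → ℕ) : Prop where
  mono : Monotone f
  zero : f 0 = 0
  last : f m = n

/-- The part of `f` after `k`, translated back to the origin. -/
def shiftMap (f : ℕ → ℕ) (k i : ℕ) : ℕ := f (k + i) - f k

namespace IsIntMap

lemma shift {m n p k l q : ℕ} {f : ℕ → ℕ} (h : IsIntMap p n f) (hp : k + m = p) (hk : f k = q)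
    (hl : q + l = n) : IsIntMap m l (shiftMap f k) where
  mono := by intro i j hij; exact Nat.sub_le_sub_right (h.mono (by omega)) _
  zero := by simp [shiftMap]
  last := by
    have := h.last
    subst hp
    simp only [shiftMap]; omega

lemma take {k q p n : ℕ} {f : ℕ → ℕ} (h : IsIntMap p n f) (hk : f k = q) : IsIntMap k q f :=
  ⟨h.mono, h.zero, hk⟩

lemma comp {m n p : ℕ} {f g : ℕ → ℕ} (hf : IsIntMap m n f) (hg : IsIntMap n p g) :
    IsIntMap m p (fun i => g (f i)) where
  mono := by intro i j hij; exact hg.mono (hf.mono hij)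
  zero := by rw [hf.zero, hg.zero]
  last := by rw [hf.last, hg.last]

lemma raw {X Y : FInt} (f : X ⟶ Y) : IsIntMap X.len Y.len (FInt.raw f) :=
  ⟨FInt.Hom.raw_mono f, FInt.raw_zero f, FInt.raw_of_le f le_rfl⟩

lemma le {m n k q : ℕ} {f : ℕ → ℕ} (h : IsIntMap m n f) (hk : k ≤ m) (hq : f k = q) : q ≤ n := by
  have := h.mono hk; have := h.last; omega

end IsIntMap

lemma shiftMap_zero {f : ℕ → ℕ} (h : f 0 = 0) : shiftMap f 0 = f := by
  funext i; simp [shiftMap, h]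

lemma shiftMap_shiftMap {f : ℕ → ℕ} (hf : Monotone f) (k l : ℕ) :
    shiftMap (shiftMap f k) l = shiftMap f (k + l) := by
  funext i
  have h1 := hf (show k ≤ k + l by omega)
  have h2 := hf (show k ≤ k + (l + i) by omega)
  simp only [shiftMap, ← Nat.add_assoc] at h2 ⊢
  omega

lemma shiftMap_comp {f g : ℕ → ℕ} (hf : Monotone f) {k q : ℕ} (hq : f k = q) :
    shiftMap (fun i => g (f i)) k = fun i => shiftMap g q (shiftMap f k i) := by
  funext i
  have h1 := hf (show k ≤ k + i by omega)
  simp only [shiftMap, ← hq]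
  rw [Nat.add_sub_cancel' h1]

section Nerve

variable {W : Type*} [Category W] [MonoidalCategory W] (C : W)

/-- The tensor powers of `C`. -/
@[reducible]
def tpow : ℕ → W
  | 0 => 𝟙_ W
  | n + 1 => C ⊗ tpow n

/-- The canonical isomorphism from the `n`-th tensor power to the tensor product of the `k`-th and
the `l`-th, for `k + l = n`. -/
def tsplit : ∀ (k l n : ℕ), k + l = n → (tpow C n ⟶ tpow C k ⊗ tpow C l)
  | 0, l, n, h => eqToHom (by rw [← h, Nat.zero_add]) ≫ (λ_ (tpow C l)).inv
  | k + 1, l, 0, h => absurd h (by omega)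
  | k + 1, l, n + 1, h => C ◁ tsplit k l n (by omega) ≫ (α_ C (tpow C k) (tpow C l)).inv

lemma tsplit_zero (l : ℕ) (h : 0 + l = l) : tsplit C 0 l l h = (λ_ (tpow C l)).inv := by
  simp [tsplit]

lemma tsplit_succ (k l n : ℕ) (h : k + 1 + l = n + 1) :
    tsplit C (k + 1) l (n + 1) h =
      C ◁ tsplit C k l n (by omega) ≫ (α_ C (tpow C k) (tpow C l)).inv := rfl

lemma tsplit_assoc (a b c ab bc n : ℕ) (h1 : ab + c = n) (h2 : a + b = ab) (h3 : a + bc = n)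
    (h4 : b + c = bc) :
    tsplit C ab c n h1 ≫ tsplit C a b ab h2 ▷ tpow C c =
      tsplit C a bc n h3 ≫ tpow C a ◁ tsplit C b c bc h4 ≫ (α_ _ _ _).inv := by
  induction a generalizing ab n with
  | zero =>
    obtain rfl : b = ab := by omega
    obtain rfl : bc = n := by omega
    simp only [tsplit_zero]
    rw [← leftUnitor_inv_naturality_assoc]
    simp
  | succ a ih =>
    obtain ⟨ab, rfl⟩ : ∃ k, ab = k + 1 := ⟨ab - 1, by omega⟩
    obtain ⟨n, rfl⟩ : ∃ k, n = k + 1 := ⟨n - 1, by omega⟩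
    simp only [tsplit_succ]
    have := ih ab n (by omega) (by omega) (by omega)
    simp only [comp_whiskerRight, Category.assoc]
    rw [← associator_inv_naturality_middle_assoc, ← whiskerLeft_comp_assoc, this]
    simp only [tpow]
    monoidal

lemma tsplit_right (k n : ℕ) (h : k + 0 = n) :
    tsplit C k 0 n h = eqToHom (by rw [← h]; rfl) ≫ (ρ_ (tpow C k)).inv := by
  obtain rfl : k = n := by omega
  induction k with
  | zero => rw [tsplit_zero]; simp only [eqToHom_refl, Category.id_comp]; exact unitors_inv_equal
  | succ k ih =>
    rw [tsplit_succ, ih]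
    simp only [tpow]
    simp

variable [MonObj C]

/-- The `n`-fold multiplication. -/
def tmul : ∀ n : ℕ, tpow C n ⟶ C
  | 0 => MonObj.one
  | n + 1 => C ◁ tmul n ≫ MonObj.mul

lemma tsplit_tmul (k l n : ℕ) (h : k + l = n) :
    tsplit C k l n h ≫ (tmul C k ⊗ₘ tmul C l) ≫ MonObj.mul = tmul C n := by
  induction k generalizing n with
  | zero =>
    obtain rfl : l = n := by omega
    rw [tsplit_zero, tmul, MonoidalCategory.tensorHom_def'_assoc, MonObj.one_mul, leftUnitor_naturality]
    simp [tpow]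
  | succ k ih =>
    obtain ⟨n, rfl⟩ : ∃ k, n = k + 1 := ⟨n - 1, by omega⟩
    rw [tsplit_succ, tmul, tmul, ← ih n (by omega)]
    simp only [whiskerLeft_comp, Category.assoc, MonoidalCategory.tensorHom_def, comp_whiskerRight]
    rw [← associator_inv_naturality_middle_assoc, ← whisker_exchange_assoc, MonObj.mul_assoc]
    simp

/-- The action of a morphism `[m] ⟶ [n]` of finite intervals on the tensor powers of a monoid: the
factors with indices in `(f (i - 1), f i]` are multiplied, for each `i`. -/
def powMap : ∀ (m n : ℕ) (f : ℕ → ℕ), IsIntMap m n f → (tpow C n ⟶ tpow C m)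
  | 0, n, f, h => eqToHom (by rw [← h.last, h.zero])
  | m + 1, n, f, h =>
    tsplit C (f 1) (n - f 1) n (Nat.add_sub_cancel' (h.le (by omega) rfl)) ≫
      (tmul C (f 1) ⊗ₘ powMap m (n - f 1) (shiftMap f 1)
        (h.shift (Nat.add_comm 1 m) rfl (Nat.add_sub_cancel' (h.le (by omega) rfl))))

lemma powMap_zero (f : ℕ → ℕ) (h : IsIntMap 0 0 f) : powMap C 0 0 f h = 𝟙 _ := by
  simp [powMap]

lemma powMap_succ (m n q l : ℕ) (f : ℕ → ℕ) (h : IsIntMap (m + 1) n f) (hq : f 1 = q)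
    (hl : q + l = n) :
    powMap C (m + 1) n f h = tsplit C q l n hl ≫
      (tmul C q ⊗ₘ powMap C m l (shiftMap f 1) (h.shift (Nat.add_comm 1 m) hq hl)) := by
  subst hq
  obtain rfl : l = n - f 1 := by omega
  rfl

lemma powMap_congr (m n : ℕ) (f g : ℕ → ℕ) (hf : IsIntMap m n f) (hg : IsIntMap m n g)
    (h : ∀ i ≤ m, f i = g i) : powMap C m n f hf = powMap C m n g hg := by
  induction m generalizing n f g with
  | zero => rfl
  | succ m ih =>
    have hq := h 1 (by omega)
    rw [powMap_succ C m n (g 1) (n - g 1) f hf hq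
      (Nat.add_sub_cancel' (hg.le (by omega) rfl)), powMap_succ C m n (g 1) (n - g 1) g hg rfl
      (Nat.add_sub_cancel' (hg.le (by omega) rfl))]
    rw [ih]
    intro i hi
    simp only [shiftMap]
    rw [hq, h _ (by omega)]

lemma powMap_tmul (m n : ℕ) (f : ℕ → ℕ) (hf : IsIntMap m n f) :
    powMap C m n f hf ≫ tmul C m = tmul C n := by
  induction m generalizing n f with
  | zero =>
    obtain rfl : 0 = n := by rw [← hf.last, hf.zero]
    simp [powMap]
  | succ m ih =>
    have hl : f 1 + (n - f 1) = n := Nat.add_sub_cancel' (hf.le (by omega) rfl)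
    rw [powMap_succ C m n _ _ f hf rfl hl, tmul, Category.assoc, MonoidalCategory.tensorHom_def_assoc,
      ← whiskerLeft_comp_assoc, ih, ← MonoidalCategory.tensorHom_def_assoc, tsplit_tmul]

lemma powMap_tsplit (k m p n l q : ℕ) (f : ℕ → ℕ) (hf : IsIntMap p n f) (hp : k + m = p)
    (hk : f k = q) (hl : q + l = n) :
    powMap C p n f hf ≫ tsplit C k m p hp = tsplit C q l n hl ≫
      (powMap C k q f (hf.take hk) ⊗ₘ powMap C m l (shiftMap f k) (hf.shift hp hk hl)) := by
  induction k generalizing p n q f with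
  | zero =>
    obtain rfl : m = p := by omega
    obtain rfl : 0 = q := by rw [← hk, hf.zero]
    obtain rfl : l = n := by omega
    have e : shiftMap f 0 = f := shiftMap_zero hf.zero
    have e2 : powMap C m l (shiftMap f 0) (hf.shift hp hk hl) = powMap C m l f hf :=
      powMap_congr _ _ _ _ _ _ _ fun i _ => by rw [e]
    rw [e2, tsplit_zero, tsplit_zero, powMap_zero, id_tensorHom]
    simp [tpow]
  | succ k ih =>
    obtain ⟨p, rfl⟩ : ∃ k, p = k + 1 := ⟨p - 1, by omega⟩
    have h1 : f 1 ≤ q := by rw [← hk]; exact hf.mono (by omega)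
    obtain ⟨q', hq'⟩ : ∃ r, f 1 + r = q := ⟨q - f 1, by omega⟩
    obtain ⟨r, hr⟩ : ∃ r, f 1 + r = n := ⟨n - f 1, by omega⟩
    have hk' : shiftMap f 1 k = q' := by
      simp only [shiftMap]; rw [Nat.add_comm 1 k, hk]; omega
    have hk1 : f (1 + k) = q := by rw [Nat.add_comm, hk]
    rw [powMap_succ C p n _ r f hf rfl hr, powMap_succ C k q _ q' f _ rfl hq', tsplit_succ,
      Category.assoc, MonoidalCategory.tensorHom_def_assoc, ← whiskerLeft_comp_assoc,
      ih p r q' (shiftMap f 1) _ (by omega) hk' (by omega)]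
    have e2 : powMap C m l (shiftMap (shiftMap f 1) k)
          ((hf.shift (Nat.add_comm 1 p) rfl hr).shift (by omega) hk' (by omega)) =
        powMap C m l (shiftMap f (k + 1)) (hf.shift hp hk hl) :=
      powMap_congr _ _ _ _ _ _ _ fun i _ => by
        rw [shiftMap_shiftMap hf.mono, Nat.add_comm 1 k]
    rw [e2, ← MonoidalCategory.whiskerRight_comp_tensorHom, ← Category.assoc,
      ← Category.assoc (tsplit C q l n hl),
      tsplit_assoc C (f 1) q' l q r n hl hq' hr (by omega)]
    simp only [Category.assoc]
    rw [← associator_inv_naturality, whiskerLeft_comp_assoc, MonoidalCategory.tensorHom_def_assoc,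
      whisker_exchange_assoc]

lemma powMap_comp (m n p : ℕ) (f g : ℕ → ℕ) (hf : IsIntMap m n f) (hg : IsIntMap n p g) :
    powMap C m p (fun i => g (f i)) (hf.comp hg) = powMap C n p g hg ≫ powMap C m n f hf := by
  induction m generalizing n p f g with
  | zero =>
    obtain rfl : 0 = n := by rw [← hf.last, hf.zero]
    obtain rfl : 0 = p := by rw [← hg.last, hg.zero]
    simp [powMap]
  | succ m ih =>
    obtain ⟨r, hr⟩ : ∃ r, f 1 + r = n := ⟨n - f 1, Nat.add_sub_cancel' (hf.le (by omega) rfl)⟩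
    obtain ⟨s, hs⟩ : ∃ s, g (f 1) + s = p :=
      ⟨p - g (f 1), Nat.add_sub_cancel' (hg.le (by omega) rfl)⟩
    rw [powMap_succ C m p _ s (fun i => g (f i)) _ rfl hs, powMap_succ C m n _ r f hf rfl hr,
      ← Category.assoc, powMap_tsplit C _ _ _ _ s _ g hg hr rfl hs, Category.assoc,
      tensorHom_comp_tensorHom, powMap_tmul, ← ih]
    congr 2
    exact powMap_congr _ _ _ _ _ _ _ fun i _ => by rw [shiftMap_comp hf.mono rfl]

lemma powMap_id (m : ℕ) (f : ℕ → ℕ) (hf : IsIntMap m m f) (h : ∀ i ≤ m, f i = i) :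
    powMap C m m f hf = 𝟙 _ := by
  induction m generalizing f with
  | zero => simp [powMap]
  | succ m ih =>
    rw [powMap_succ C m (m + 1) 1 m f hf (h 1 (by omega)) (Nat.add_comm 1 m), ih]
    · rw [tsplit_succ, tsplit_zero]
      simp only [tmul, tpow, MonObj.mul_one, tensorHom_id, Category.assoc]
      simp
    · intro i hi
      simp only [shiftMap]
      rw [h _ (by omega), h _ (by omega)]
      omega

/-- The functor on finite intervals associated to a monoid `C`: it sends `[n]` to the `n`-th tensor
power of `C`, inner faces act by multiplication and degeneracies by insertion of the unit. -/
def monNerve : FIntᵒᵖ ⥤ W where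
  obj n := tpow C n.unop.len
  map f := powMap C _ _ (FInt.raw f.unop) (IsIntMap.raw f.unop)
  map_id n := powMap_id C _ _ _ fun i hi => by
    simp only [unop_id, FInt.raw_id]; omega
  map_comp f g := by
    rw [← powMap_comp]
    exact powMap_congr _ _ _ _ _ _ _ fun i _ => by rw [unop_comp, FInt.raw_comp]

lemma powMap_tensorHom {X X' Y Y' : FInt} (f : X ⟶ X') (g : Y ⟶ Y') :
    tsplit C X'.len Y'.len _ rfl ≫ (powMap C _ _ (FInt.raw f) (IsIntMap.raw f) ⊗ₘ
        powMap C _ _ (FInt.raw g) (IsIntMap.raw g)) =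
      powMap C _ _ (FInt.raw (f ⊗ₘ g)) (IsIntMap.raw (f ⊗ₘ g)) ≫
        tsplit C X.len Y.len _ rfl := by
  have hX : FInt.raw (f ⊗ₘ g) X.len = X'.len := by
    rw [FInt.raw_tensorHom, FInt.raw_of_le f le_rfl, Nat.sub_self, FInt.raw_zero, Nat.add_zero]
  refine Eq.trans ?_
    (powMap_tsplit C X.len Y.len _ _ Y'.len X'.len _ (IsIntMap.raw (f ⊗ₘ g)) rfl hX rfl).symm
  congr 2
  · refine powMap_congr _ _ _ _ _ _ _ fun i hi => ?_
    rw [FInt.raw_tensorHom, show i - X.len = 0 by omega, FInt.raw_zero, Nat.add_zero]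
  · refine powMap_congr _ _ _ _ _ _ _ fun i hi => ?_
    rw [shiftMap, hX, FInt.raw_tensorHom, FInt.raw_of_le f (by omega), Nat.add_sub_cancel_left,
      Nat.add_sub_cancel_left]

lemma powMap_raw_id (X : FInt) :
    powMap C _ _ (FInt.raw (𝟙 X)) (IsIntMap.raw (𝟙 X)) = 𝟙 (tpow C X.len) :=
  powMap_id C _ _ _ fun i hi => by rw [FInt.raw_id]; omega

lemma powMap_cast_tsplit (m n k l : ℕ) (f : ℕ → ℕ) (hf : IsIntMap m n f) (h : ∀ i ≤ m, f i = i)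
    (hm : k + l = m) (hn : k + l = n) :
    powMap C m n f hf ≫ tsplit C k l m hm = tsplit C k l n hn := by
  subst hm
  subst hn
  rw [powMap_id C _ f hf h, Category.id_comp]

lemma powMap_associativity (k l m : ℕ) (f : ℕ → ℕ) (hf : IsIntMap (k + (l + m)) (k + l + m) f)
    (h : ∀ i ≤ k + (l + m), f i = i) :
    tsplit C (k + l) m _ rfl ≫ tsplit C k l _ rfl ▷ tpow C m ≫ (α_ _ _ _).hom =
      powMap C _ _ f hf ≫ tsplit C k (l + m) _ rfl ≫ tpow C k ◁ tsplit C l m _ rfl := by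
  rw [← Category.assoc, tsplit_assoc C k l m _ _ _ rfl rfl (Nat.add_assoc _ _ _).symm rfl,
    ← powMap_cast_tsplit C _ _ k (l + m) f hf h rfl (Nat.add_assoc _ _ _).symm]
  simp only [Category.assoc, Iso.inv_hom_id, Category.comp_id]

lemma powMap_left_unitality (k : ℕ) (f : ℕ → ℕ) (hf : IsIntMap (0 + k) k f)
    (h : ∀ i ≤ 0 + k, f i = i) :
    (λ_ (tpow C k)).inv = powMap C _ _ f hf ≫ tsplit C 0 k _ rfl ≫ 𝟙 (𝟙_ W) ▷ tpow C k := by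
  rw [id_whiskerRight, Category.comp_id, powMap_cast_tsplit C _ _ 0 k f hf h rfl (Nat.zero_add k),
    tsplit_zero]

lemma powMap_right_unitality (k : ℕ) (f : ℕ → ℕ) (hf : IsIntMap (k + 0) k f)
    (h : ∀ i ≤ k + 0, f i = i) :
    (ρ_ (tpow C k)).inv = powMap C _ _ f hf ≫ tsplit C k 0 _ rfl ≫ tpow C k ◁ 𝟙 (𝟙_ W) := by
  rw [whiskerLeft_id, Category.comp_id, powMap_cast_tsplit C _ _ k 0 f hf h rfl (Nat.add_zero k),
    tsplit_right, eqToHom_refl, Category.id_comp]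

/-- The comultiplications of the nerve are the canonical isomorphisms. -/
instance : (monNerve C).OplaxMonoidal where
  η := 𝟙 _
  δ k l := tsplit C k.unop.len l.unop.len _ rfl
  δ_natural_left {k k'} f l := by
    have := powMap_tensorHom C f.unop (𝟙 l.unop)
    rw [powMap_raw_id, tensorHom_id, tensorHom_id] at this
    exact this
  δ_natural_right {k k'} l f := by
    have := powMap_tensorHom C (𝟙 l.unop) f.unop
    rw [powMap_raw_id, id_tensorHom, id_tensorHom] at this
    exact this
  oplax_associativity k l m :=
    powMap_associativity C k.unop.len l.unop.len m.unop.len _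
      (IsIntMap.raw (α_ k.unop l.unop m.unop).inv) fun _ hi => min_eq_left hi
  oplax_left_unitality k :=
    powMap_left_unitality C k.unop.len _ (IsIntMap.raw (λ_ k.unop).hom) fun _ hi => min_eq_left hi
  oplax_right_unitality k :=
    powMap_right_unitality C k.unop.len _ (IsIntMap.raw (ρ_ k.unop).hom) fun _ hi => min_eq_left hi

instance : IsIso (Functor.OplaxMonoidal.η (monNerve C)) :=
  inferInstanceAs (IsIso (𝟙 _))

end Nerve

section Necklaces

/-- A necklace `Δ^{n₁} ∨ ... ∨ Δ^{nₖ}`, given by the list of the positive dimensions of its beads. Its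
vertices are `0, ..., p` with `p` the sum of the list, and its joints are the partial sums. -/
structure Nec where
  beads : List ℕ
  pos : ∀ n ∈ beads, 0 < n

namespace Nec

/-- The number `p` such that `0, ..., p` are the vertices of the necklace. -/
def dim (T : Nec) : ℕ := T.beads.sum

/-- The set of joints, as a subset of the vertices. -/
def joints (T : Nec) : Set (Fin (T.dim + 1)) := {t | ∃ i, (t : ℕ) = (T.beads.take i).sum}

/-- A map of necklaces `(T, p) ⟶ (U, q)` is a monotone endpoint-preserving map `[p] ⟶ [q]` such that
the joints of `U` are images of joints of `T`. -/
@[ext]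
structure Hom (T U : Nec) where
  toHom : FInt.Hom T.dim U.dim
  joints_subset : U.joints ⊆ toHom.toOrderHom '' T.joints

instance : Category Nec where
  Hom := Hom
  id T := ⟨FInt.Hom.id T.dim, fun t ht => ⟨t, ht, rfl⟩⟩
  comp f g := ⟨f.toHom.comp g.toHom, fun u hu => by
    obtain ⟨t, ht, rfl⟩ := g.joints_subset hu
    obtain ⟨s, hs, rfl⟩ := f.joints_subset ht
    exact ⟨s, hs, rfl⟩⟩

/-- The simplex `Δ^n` as a necklace with one bead, for `n > 0`. -/
def simplex (n : ℕ) (hn : 0 < n) : Nec := ⟨[n], by simpa using hn⟩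

end Nec

/-- `f` restricts to a monotone endpoint-preserving map between the vertices of the necklaces with
beads `L` and `M`, such that the joints of `M` are images of joints of `L`. -/
structure NecCond (L M : List ℕ) (f : ℕ → ℕ) : Prop where
  int : IsIntMap L.sum M.sum f
  joint : ∀ j, ∃ i, f (L.take i).sum = (M.take j).sum

lemma Nec.Hom.necCond {T U : Nec} (f : Nec.Hom T U) : NecCond T.beads U.beads f.toHom.raw where
  int := IsIntMap.raw (X := ⟨T.dim⟩) (Y := ⟨U.dim⟩) f.toHom
  joint j := by
    have hj : (U.beads.take j).sum < U.dim + 1 := Nat.lt_succ_of_le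
      ((List.take_sublist j U.beads).sum_le_sum (by simp))
    obtain ⟨t, ⟨i, hi⟩, ht⟩ := f.joints_subset (a := ⟨_, hj⟩) ⟨j, rfl⟩
    refine ⟨i, ?_⟩
    have h2 : min (t : ℕ) T.dim = t := by omega
    have := congrArg Fin.val ht
    simp only [FInt.Hom.raw, ← hi, h2]
    exact this

namespace NecCond

lemma comp {L M N : List ℕ} {f g : ℕ → ℕ} (hf : NecCond L M f) (hg : NecCond M N g) :
    NecCond L N (fun i => g (f i)) where
  int := hf.int.comp hg.int
  joint j := by
    obtain ⟨i, hi⟩ := hg.joint j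
    obtain ⟨k, hk⟩ := hf.joint i
    exact ⟨k, by rw [hk, hi]⟩

lemma right {A B L M N P : List ℕ} {f : ℕ → ℕ} (h : NecCond L P f) (hL : A ++ B = L)
    (hP : M ++ N = P) (hA : f A.sum = M.sum) : NecCond B N (shiftMap f A.sum) where
  int := h.int.shift (by rw [← hL, List.sum_append]) hA (by rw [← hP, List.sum_append])
  joint j := by
    obtain ⟨i, hi⟩ := h.joint (M.length + j)
    subst hL hP
    rw [List.take_length_add_append, List.sum_append] at hi
    rcases le_total i A.length with hle | hle
    · refine ⟨0, ?_⟩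
      have h1 := h.int.mono (show ((A ++ B).take i).sum ≤ A.sum by
        rw [List.take_append_of_le_length hle]
        exact (List.take_sublist i A).sum_le_sum (by simp))
      simp only [shiftMap, List.take_zero, List.sum_nil, Nat.add_zero, Nat.sub_self]
      omega
    · refine ⟨i - A.length, ?_⟩
      obtain ⟨i, rfl⟩ := Nat.exists_eq_add_of_le hle
      rw [List.take_length_add_append, List.sum_append] at hi
      simp only [shiftMap, Nat.add_sub_cancel_left]
      omega

lemma left {A B L M N P : List ℕ} {f : ℕ → ℕ} (h : NecCond L P f) (hL : A ++ B = L)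
    (hP : M ++ N = P) (hA : f A.sum = M.sum) : NecCond A M f where
  int := h.int.take hA
  joint j := by
    rcases le_total j M.length with hj | hj
    · obtain ⟨i, hi⟩ := h.joint j
      subst hL hP
      rw [List.take_append_of_le_length hj] at hi
      rcases le_total i A.length with hle | hle
      · exact ⟨i, by rwa [List.take_append_of_le_length hle] at hi⟩
      · refine ⟨A.length, ?_⟩
        obtain ⟨i, rfl⟩ := Nat.exists_eq_add_of_le hle
        rw [List.take_length_add_append, List.sum_append] at hi
        have h1 := h.int.mono (show A.sum ≤ A.sum + (B.take i).sum by omega)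
        have h2 : (M.take j).sum ≤ M.sum := (List.take_sublist j M).sum_le_sum (by simp)
        rw [List.take_length]
        omega
    · exact ⟨A.length, by rw [List.take_length, List.take_of_length_le hj, hA]⟩

lemma exists_append {L M N P : List ℕ} {f : ℕ → ℕ} (h : NecCond L P f) (hP : M ++ N = P) :
    ∃ A B, A ++ B = L ∧ f A.sum = M.sum := by
  obtain ⟨i, hi⟩ := h.joint M.length
  subst hP
  exact ⟨L.take i, L.drop i, List.take_append_drop i L, by rw [hi, List.take_left']; rfl⟩

lemma exists_head {L M : List ℕ} {u : ℕ} {f : ℕ → ℕ} (h : NecCond L (u :: M) f) :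
    ∃ i, f (L.take i).sum = u := by
  obtain ⟨i, hi⟩ := h.joint 1
  exact ⟨i, by simpa using hi⟩

lemma tail {A B L M : List ℕ} {u : ℕ} {f : ℕ → ℕ} (h : NecCond L (u :: M) f) (hL : A ++ B = L)
    (hA : f A.sum = u) : NecCond B M (shiftMap f A.sum) :=
  h.right hL (M := [u]) rfl (by simpa using hA)

lemma drop {A B L M : List ℕ} {f : ℕ → ℕ} (h : NecCond L M f) (hL : A ++ B = L)
    (hA : f A.sum = 0) : NecCond B M (shiftMap f A.sum) :=
  h.right hL (M := []) rfl (by simpa using hA)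

end NecCond

end Necklaces

section NecFunctor

variable {W : Type*} [Category W] [MonoidalCategory W] (X : FIntᵒᵖ ⥤ W)

/-- The object `X_n`. -/
abbrev cell (n : ℕ) : W := X.obj (op ⟨n⟩)

/-- The action of a map `[m] ⟶ [n]` on `X`. -/
def cellMap (m n : ℕ) (f : ℕ → ℕ) (h : IsIntMap m n f) : cell X n ⟶ cell X m :=
  X.map (Quiver.Hom.op (X := (⟨m⟩ : FInt)) (Y := (⟨n⟩ : FInt))
    (FInt.Hom.ofRaw m n f h.mono h.zero h.last))

lemma cellMap_congr {m n : ℕ} {f g : ℕ → ℕ} (hf : IsIntMap m n f) (hg : IsIntMap m n g)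
    (h : ∀ i ≤ m, f i = g i) : cellMap X m n f hf = cellMap X m n g hg := by
  have : FInt.Hom.ofRaw m n f hf.mono hf.zero hf.last =
      FInt.Hom.ofRaw m n g hg.mono hg.zero hg.last :=
    FInt.Hom.ext_raw fun i hi => by
      rw [FInt.Hom.raw_ofRaw, FInt.Hom.raw_ofRaw, min_eq_left hi, h i hi]
  unfold cellMap
  rw [this]

lemma map_eq_cellMap {m n : FInt} (f : m ⟶ n) :
    X.map f.op = cellMap X m.len n.len (FInt.raw f) (IsIntMap.raw f) := by
  have : f = FInt.Hom.ofRaw m.len n.len (FInt.raw f) (IsIntMap.raw f).mono (IsIntMap.raw f).zero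
      (IsIntMap.raw f).last :=
    FInt.Hom.ext_raw fun i hi => by rw [FInt.Hom.raw_ofRaw, min_eq_left hi]
  unfold cellMap
  conv_lhs => rw [this]

lemma cellMap_id {m : ℕ} {f : ℕ → ℕ} (hf : IsIntMap m m f) (h : ∀ i ≤ m, f i = i) :
    cellMap X m m f hf = 𝟙 _ := by
  rw [cellMap_congr X hf (IsIntMap.raw (𝟙 (⟨m⟩ : FInt)))
    (fun i hi => by rw [h i hi, FInt.raw_id]; exact (min_eq_left hi).symm)]
  exact (map_eq_cellMap X (𝟙 (⟨m⟩ : FInt))).symm.trans (X.map_id _)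

lemma cellMap_comp {m n p : ℕ} {f g : ℕ → ℕ} (hf : IsIntMap m n f) (hg : IsIntMap n p g) :
    cellMap X n p g hg ≫ cellMap X m n f hf = cellMap X m p (fun i => g (f i)) (hf.comp hg) := by
  unfold cellMap
  rw [← X.map_comp]
  congr 1

variable [X.OplaxMonoidal]

/-- The counit of `X`. -/
def cellη : cell X 0 ⟶ 𝟙_ W := Functor.OplaxMonoidal.η X

/-- The comultiplication `X_n ⟶ X_k ⊗ X_l` for `k + l = n`. -/
def cellδ (k l n : ℕ) (h : k + l = n) : cell X n ⟶ cell X k ⊗ cell X l :=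
  X.map (Quiver.Hom.op (X := (⟨k⟩ ⊗ ⟨l⟩ : FInt)) (Y := (⟨n⟩ : FInt)) (FInt.castIso h).hom) ≫
    Functor.OplaxMonoidal.δ X (op ⟨k⟩) (op ⟨l⟩)

lemma cellδ_natural {k m p n l q : ℕ} {f : ℕ → ℕ} (hf : IsIntMap p n f) (hp : k + m = p)
    (hk : f k = q) (hl : q + l = n) :
    cellMap X p n f hf ≫ cellδ X k m p hp = cellδ X q l n hl ≫
      (cellMap X k q f (hf.take hk) ⊗ₘ cellMap X m l (shiftMap f k) (hf.shift hp hk hl)) := by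
  unfold cellδ cellMap
  rw [Category.assoc, Functor.OplaxMonoidal.δ_natural, ← X.map_comp_assoc, ← X.map_comp_assoc]
  congr 2
  apply Quiver.Hom.unop_inj
  refine FInt.hom_ext fun i hi => ?_
  have hi' : i ≤ k + m := hi
  refine (FInt.raw_comp _ _ i).trans (Eq.trans ?_ (FInt.raw_comp _ _ i).symm)
  change f (min (min i (k + m)) p) = min (FInt.Hom.raw (FInt.Hom.add _ _) i) (q + l)
  rw [FInt.Hom.raw_add]
  change f (min (min i (k + m)) p) = min (f (min i k) + shiftMap f k (min (i - k) m)) (q + l)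
  rw [min_eq_left hi', min_eq_left (by omega), min_eq_left (show i - k ≤ m by omega), shiftMap, hk]
  have hn : f i ≤ n := hf.last ▸ hf.mono (by omega : i ≤ p)
  rcases le_total i k with h | h
  · have h1 : f i ≤ q := hk ▸ hf.mono h
    rw [min_eq_left h, show i - k = 0 by omega, Nat.add_zero, hk, Nat.sub_self]
    omega
  · have h1 : q ≤ f i := hk ▸ hf.mono h
    rw [min_eq_right h, hk, Nat.add_sub_cancel' h]
    omega

lemma cellδ_rfl (k l : ℕ) :
    cellδ X k l (k + l) rfl = Functor.OplaxMonoidal.δ X (op ⟨k⟩) (op ⟨l⟩) := by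
  have : (FInt.castIso (X := ⟨k⟩ ⊗ ⟨l⟩) (Y := ⟨k + l⟩) rfl).hom = 𝟙 (⟨k + l⟩ : FInt) := rfl
  unfold cellδ
  refine Eq.trans ?_ (Category.id_comp _)
  refine congrArg (· ≫ Functor.OplaxMonoidal.δ X (op ⟨k⟩) (op ⟨l⟩)) ?_
  exact X.map_id (op (⟨k + l⟩ : FInt))

lemma cellδ_assoc (a b c ab bc n : ℕ) (h1 : ab + c = n) (h2 : a + b = ab) (h3 : a + bc = n)
    (h4 : b + c = bc) :
    cellδ X ab c n h1 ≫ cellδ X a b ab h2 ▷ cell X c =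
      cellδ X a bc n h3 ≫ cell X a ◁ cellδ X b c bc h4 ≫ (α_ _ _ _).inv := by
  subst h2 h4 h1
  rw [cellδ_rfl, cellδ_rfl, cellδ_rfl]
  have h := Functor.OplaxMonoidal.associativity_inv X (op ⟨a⟩) (op ⟨b⟩) (op ⟨c⟩)
  unfold cellδ
  rw [Category.assoc]
  refine Eq.trans ?_ (congrArg (X.map (Quiver.Hom.op (X := (⟨a⟩ ⊗ ⟨b + c⟩ : FInt))
    (Y := (⟨a + b + c⟩ : FInt)) (FInt.castIso h3).hom) ≫ ·) h.symm)
  refine Eq.trans (Category.id_comp _).symm (Eq.trans ?_ (Category.assoc _ _ _))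
  refine congrArg (· ≫ Functor.OplaxMonoidal.δ X (op ⟨a + b⟩) (op ⟨c⟩) ≫
    Functor.OplaxMonoidal.δ X (op ⟨a⟩) (op ⟨b⟩) ▷ cell X c) ?_
  refine Eq.trans (X.map_id _).symm (Eq.trans (congrArg X.map ?_) (X.map_comp _ _))
  apply Quiver.Hom.unop_inj
  refine FInt.hom_ext fun i hi => ?_
  refine Eq.trans ?_ (FInt.raw_comp _ _ i).symm
  change min i (a + b + c) = min (min i (a + b + c)) (a + (b + c))
  omega

lemma cellδ_left (n : ℕ) (h : 0 + n = n) :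
    cellδ X 0 n n h ≫ cellη X ▷ cell X n = (λ_ (cell X n)).inv := by
  rw [Functor.OplaxMonoidal.left_unitality X]
  unfold cellδ cellη
  rw [Category.assoc]
  rfl

lemma cellδ_right (n : ℕ) (h : n + 0 = n) :
    cellδ X n 0 n h ≫ cell X n ◁ cellη X = (ρ_ (cell X n)).inv := by
  rw [Functor.OplaxMonoidal.right_unitality X]
  unfold cellδ cellη
  rw [Category.assoc]
  rfl

end NecFunctor

lemma NecCond.int_nil {L : List ℕ} {f : ℕ → ℕ} (h : NecCond L [] f) : IsIntMap L.sum 0 f := h.int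

section BeadTensor

variable {W : Type*} [Category W] [MonoidalCategory W]

lemma tensor_glue {A B C AB BC L P Q R : W} (c₁ : A ⊗ B ⟶ AB) (c₂ : AB ⊗ C ⟶ L) (c₃ : B ⊗ C ⟶ BC)
    (c₄ : A ⊗ BC ⟶ L) (key : c₁ ▷ C ≫ c₂ = (α_ A B C).hom ≫ A ◁ c₃ ≫ c₄) (x : P ⟶ A) (z : Q ⟶ B)
    (y : R ⟶ C) :
    (((x ⊗ₘ z) ≫ c₁) ⊗ₘ y) ≫ c₂ = (α_ P Q R).hom ≫ (x ⊗ₘ ((z ⊗ₘ y) ≫ c₃)) ≫ c₄ := by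
  have e1 : ((x ⊗ₘ z) ≫ c₁) ⊗ₘ y = ((x ⊗ₘ z) ⊗ₘ y) ≫ c₁ ▷ C := by
    rw [← tensorHom_id, tensorHom_comp_tensorHom, Category.comp_id]
  have e2 : x ⊗ₘ ((z ⊗ₘ y) ≫ c₃) = (x ⊗ₘ (z ⊗ₘ y)) ≫ A ◁ c₃ := by
    rw [← id_tensorHom, tensorHom_comp_tensorHom, Category.comp_id]
  rw [e1, e2, Category.assoc, key, associator_naturality_assoc, Category.assoc]

lemma tensor_glue_right {A B C AB BC L P R : W} (c₁ : A ⊗ B ⟶ AB) (c₂ : AB ⊗ C ⟶ L)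
    (c₃ : B ⊗ C ⟶ BC) (c₄ : A ⊗ BC ⟶ L) (key : c₁ ▷ C ≫ c₂ = (α_ A B C).hom ≫ A ◁ c₃ ≫ c₄)
    (x : P ⟶ A) (z : 𝟙_ W ⟶ B) (y : R ⟶ C) :
    (((ρ_ P).inv ≫ (x ⊗ₘ z) ≫ c₁) ⊗ₘ y) ≫ c₂ = (x ⊗ₘ ((λ_ R).inv ≫ (z ⊗ₘ y) ≫ c₃)) ≫ c₄ := by
  rw [← MonoidalCategory.whiskerRight_comp_tensorHom, Category.assoc, tensor_glue c₁ c₂ c₃ c₄ key,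
    triangle_assoc_comp_right_inv_assoc, MonoidalCategory.whiskerLeft_comp_tensorHom_assoc]

lemma tensor_glue_left {A B C AB BC L Q R : W} (c₁ : A ⊗ B ⟶ AB) (c₂ : AB ⊗ C ⟶ L)
    (c₃ : B ⊗ C ⟶ BC) (c₄ : A ⊗ BC ⟶ L) (key : c₁ ▷ C ≫ c₂ = (α_ A B C).hom ≫ A ◁ c₃ ≫ c₄)
    (x : 𝟙_ W ⟶ A) (z : Q ⟶ B) (y : R ⟶ C) :
    (((λ_ Q).inv ≫ (x ⊗ₘ z) ≫ c₁) ⊗ₘ y) ≫ c₂ = (λ_ (Q ⊗ R)).inv ≫ (x ⊗ₘ ((z ⊗ₘ y) ≫ c₃)) ≫ c₄ := by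
  rw [← MonoidalCategory.whiskerRight_comp_tensorHom, Category.assoc, tensor_glue c₁ c₂ c₃ c₄ key,
    ← leftUnitor_tensor_inv_assoc]

lemma tensor_unit_glue (P L : W) :
    ((ρ_ P).inv ⊗ₘ 𝟙 L) ≫ (α_ P (𝟙_ W) L).hom ≫ P ◁ (λ_ L).hom = 𝟙 (P ⊗ L) := by
  simp

variable (X : FIntᵒᵖ ⥤ W)

/-- The tensor product `X_{n₁} ⊗ ... ⊗ X_{nₖ}` for a list of dimensions. -/
@[reducible]
def beadTensor : List ℕ → W
  | [] => 𝟙_ W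
  | n :: L => cell X n ⊗ beadTensor L

/-- The canonical isomorphism for the concatenation of two lists. -/
def catp : ∀ (A B L : List ℕ), A ++ B = L → (beadTensor X A ⊗ beadTensor X B ⟶ beadTensor X L)
  | [], B, L, h => (λ_ (beadTensor X B)).hom ≫ eqToHom (by rw [← h]; rfl)
  | a :: A, B, [], h => absurd h (by simp)
  | a :: A, B, l :: L, h => (α_ (cell X a) (beadTensor X A) (beadTensor X B)).hom ≫
      (eqToHom (by rw [(List.cons.inj h).1]) ⊗ₘ catp A B L (List.cons.inj h).2)

lemma catp_nil (B : List ℕ) (h : [] ++ B = B) :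
    catp X [] B B h = (λ_ (beadTensor X B)).hom := by
  simp [catp]

lemma catp_cons (a : ℕ) (A B L : List ℕ) (h : a :: A ++ B = a :: L) :
    catp X (a :: A) B (a :: L) h = (α_ (cell X a) (beadTensor X A) (beadTensor X B)).hom ≫
      cell X a ◁ catp X A B L (List.cons.inj h).2 := by
  simp [catp]

lemma catp_assoc (A B C AB BC L : List ℕ) (h1 : A ++ B = AB) (h2 : B ++ C = BC)
    (h3 : AB ++ C = L) (h4 : A ++ BC = L) :
    catp X A B AB h1 ▷ beadTensor X C ≫ catp X AB C L h3 =
      (α_ (beadTensor X A) (beadTensor X B) (beadTensor X C)).hom ≫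
        beadTensor X A ◁ catp X B C BC h2 ≫ catp X A BC L h4 := by
  induction A generalizing AB L with
  | nil =>
    obtain rfl : B = AB := h1
    obtain rfl : BC = L := h4
    rw [catp_nil, catp_nil, leftUnitor_naturality]
    simp
  | cons a A ih =>
    subst h1 h2 h3
    have h := ih (A ++ B) (A ++ B ++ C) rfl rfl (by simp)
    simp only [List.cons_append]
    rw [catp_cons, catp_cons, catp_cons, comp_whiskerRight, Category.assoc,
      associator_naturality_middle_assoc, ← whiskerLeft_comp, h, whiskerLeft_comp, whiskerLeft_comp,
      associator_naturality_right_assoc, pentagon_assoc]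

variable [X.OplaxMonoidal]

/-- The iterated comultiplication `X_n ⟶ X_{n₁} ⊗ ... ⊗ X_{nₖ}` for a list with sum `n`. -/
def mup : ∀ (L : List ℕ) (n : ℕ), L.sum = n → (cell X n ⟶ beadTensor X L)
  | [], n, h => eqToHom (by rw [← h]; rfl) ≫ cellη X
  | a :: L, n, h => cellδ X a L.sum n h ≫ cell X a ◁ mup L L.sum rfl

lemma mup_nil (h : [].sum = 0) : mup X [] 0 h = cellη X := by
  simp [mup]

lemma mup_cons (a : ℕ) (L : List ℕ) (n m : ℕ) (h : (a :: L).sum = n) (hm : L.sum = m)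
    (hn : a + m = n) :
    mup X (a :: L) n h = cellδ X a m n hn ≫ cell X a ◁ mup X L m hm := by
  subst hm; rfl

lemma mup_append (A B L : List ℕ) (p q n : ℕ) (hA : A.sum = p) (hB : B.sum = q) (hL : L.sum = n)
    (h : A ++ B = L) (hn : p + q = n) :
    mup X L n hL = cellδ X p q n hn ≫ (mup X A p hA ⊗ₘ mup X B q hB) ≫ catp X A B L h := by
  induction A generalizing L p n with
  | nil =>
    obtain rfl : B = L := h
    obtain rfl : 0 = p := by simpa using hA
    obtain rfl : q = n := by omega
    rw [mup_nil, catp_nil, MonoidalCategory.tensorHom_def_assoc, ← Category.assoc, cellδ_left,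
      leftUnitor_naturality]
    simp
  | cons a A ih =>
    subst h
    simp only [List.cons_append]
    have hA' : a + A.sum = p := by simpa using hA
    have hL' : (A ++ B).sum = A.sum + q := by rw [List.sum_append, hB]
    rw [mup_cons X a (A ++ B) n (A.sum + q) hL hL' (by omega), mup_cons X a A p A.sum _ rfl hA',
      ih (A ++ B) A.sum (A.sum + q) rfl hL' rfl rfl, catp_cons]
    rw [← MonoidalCategory.whiskerRight_comp_tensorHom, Category.assoc, ← Category.assoc (cellδ X p q n hn),
      cellδ_assoc X a A.sum q p (A.sum + q) n hn hA' (by omega) rfl]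
    simp only [Category.assoc, whiskerLeft_comp]
    simp only [MonoidalCategory.tensorHom_def, whiskerLeft_comp, Category.assoc]
    simp

/-- The composite of the action of a map `f` with the iterated comultiplication. -/
def bmap (L : List ℕ) (u : ℕ) (f : ℕ → ℕ) (h : IsIntMap L.sum u f) : cell X u ⟶ beadTensor X L :=
  cellMap X L.sum u f h ≫ mup X L L.sum rfl

lemma bmap_append (A B L : List ℕ) (p q n : ℕ) (f : ℕ → ℕ) (hf : IsIntMap L.sum n f)
    (h : A ++ B = L) (hA : f A.sum = p) (hn : p + q = n) :
    bmap X L n f hf = cellδ X p q n hn ≫ (bmap X A p f (hf.take hA) ⊗ₘ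
      bmap X B q (shiftMap f A.sum) (hf.shift (by rw [← h, List.sum_append]) hA hn)) ≫
        catp X A B L h := by
  have hs : A.sum + B.sum = L.sum := by rw [← h, List.sum_append]
  unfold bmap
  rw [mup_append X A B L A.sum B.sum L.sum rfl rfl rfl h hs, ← Category.assoc,
    cellδ_natural X hf hs hA hn]
  simp

lemma bmap_congr {L : List ℕ} {u : ℕ} {f g : ℕ → ℕ} (hf : IsIntMap L.sum u f)
    (hg : IsIntMap L.sum u g) (h : f = g) : bmap X L u f hf = bmap X L u g hg := by
  subst h; rfl

variable [IsIso (cellη X)]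

/-- The map `I ⟶ X_{n₁} ⊗ ... ⊗ X_{nₖ}` coming from totally degenerate simplices. -/
noncomputable def zeta (L : List ℕ) (f : ℕ → ℕ) (h : IsIntMap L.sum 0 f) : 𝟙_ W ⟶ beadTensor X L :=
  inv (cellη X) ≫ bmap X L 0 f h

lemma bmap_left (A B L : List ℕ) (n : ℕ) (f : ℕ → ℕ) (hf : IsIntMap L.sum n f)
    (h : A ++ B = L) (hA : f A.sum = 0) :
    bmap X L n f hf = (λ_ _).inv ≫ (zeta X A f (hf.take hA) ⊗ₘ
      bmap X B n (shiftMap f A.sum) (hf.shift (by rw [← h, List.sum_append]) hA (Nat.zero_add n))) ≫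
        catp X A B L h := by
  rw [bmap_append X A B L 0 n n f hf h hA (Nat.zero_add n), ← cellδ_left X n (Nat.zero_add n),
    Category.assoc, MonoidalCategory.whiskerRight_comp_tensorHom_assoc, zeta, IsIso.hom_inv_id_assoc]

lemma bmap_right (A B L : List ℕ) (n : ℕ) (f : ℕ → ℕ) (hf : IsIntMap L.sum n f)
    (h : A ++ B = L) (hA : f A.sum = n) :
    bmap X L n f hf = (ρ_ _).inv ≫ (bmap X A n f (hf.take hA) ⊗ₘ
      zeta X B (shiftMap f A.sum) (hf.shift (by rw [← h, List.sum_append]) hA (Nat.add_zero n))) ≫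
        catp X A B L h := by
  rw [bmap_append X A B L n 0 n f hf h hA (Nat.add_zero n), ← cellδ_right X n (Nat.add_zero n),
    Category.assoc, MonoidalCategory.whiskerLeft_comp_tensorHom_assoc, zeta, IsIso.hom_inv_id_assoc]

open Classical in
/-- The action of a map of necklaces `L ⟶ M` with underlying map `f`: for the first bead `u` of `M`
one chooses an initial segment of `L` whose last vertex is mapped to the last vertex of `u`, applies
the restriction of `f` to the segment and comultiplies; then one continues with the rest. The result
does not depend on the chosen segments, see `nmap_cons`. -/
noncomputable def nmap : ∀ (M L : List ℕ) (f : ℕ → ℕ), NecCond L M f →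
    (beadTensor X M ⟶ beadTensor X L)
  | [], L, f, h => zeta X L f h.int_nil
  | u :: M, L, f, h =>
    (bmap X (L.take (Nat.find h.exists_head)) u f (h.int.take (Nat.find_spec h.exists_head)) ⊗ₘ
      nmap M (L.drop (Nat.find h.exists_head)) (shiftMap f (L.take (Nat.find h.exists_head)).sum)
        (h.tail (List.take_append_drop _ _) (Nat.find_spec h.exists_head))) ≫
      catp X _ _ L (List.take_append_drop _ _)

lemma nmap_congr {M L : List ℕ} {f g : ℕ → ℕ} (hf : NecCond L M f) (hg : NecCond L M g)
    (h : f = g) : nmap X M L f hf = nmap X M L g hg := by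
  subst h; rfl

/-- Vertices of `L` that are mapped to `0` can be split off. -/
def NmapDrop (M : List ℕ) : Prop :=
  ∀ (A B L : List ℕ) (f : ℕ → ℕ) (hf : NecCond L M f) (h : A ++ B = L) (hA : f A.sum = 0),
    nmap X M L f hf = (λ_ _).inv ≫ (zeta X A f (hf.int.take hA) ⊗ₘ
      nmap X M B (shiftMap f A.sum) (hf.drop h hA)) ≫ catp X A B L h

lemma nmapDrop_nil : NmapDrop X [] := by
  intro A B L f hf h hA
  change inv (cellη X) ≫ bmap X L 0 f _ = (λ_ (𝟙_ W)).inv ≫ (_ ⊗ₘ (inv (cellη X) ≫ bmap X B 0 _ _)) ≫ _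
  rw [bmap_left X A B L 0 f hf.int h hA, leftUnitor_inv_naturality_assoc,
    MonoidalCategory.whiskerLeft_comp_tensorHom_assoc]

lemma nmap_cons_swap (M : List ℕ) (hM : NmapDrop X M) (u : ℕ) (A₀ Z A B D L : List ℕ) (f : ℕ → ℕ)
    (hf : NecCond L (u :: M) f) (h : A ++ B = L) (hA : f A.sum = u) (h₀ : A₀ ++ D = L)
    (hA₀ : f A₀.sum = u) (hZ : A₀ ++ Z = A) (hD : Z ++ B = D) :
    (bmap X A₀ u f (hf.int.take hA₀) ⊗ₘ nmap X M D (shiftMap f A₀.sum) (hf.tail h₀ hA₀)) ≫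
        catp X A₀ D L h₀ = (bmap X A u f (hf.int.take hA) ⊗ₘ
      nmap X M B (shiftMap f A.sum) (hf.tail h hA)) ≫ catp X A B L h := by
  have hAs : A.sum = A₀.sum + Z.sum := by rw [← hZ, List.sum_append]
  have hZ0 : shiftMap f A₀.sum Z.sum = 0 := by
    simp only [shiftMap]; rw [← hAs, hA, hA₀, Nat.sub_self]
  rw [hM Z B D (shiftMap f A₀.sum) _ hD hZ0, bmap_right X A₀ Z A u f _ hZ hA₀,
    nmap_congr X (f := shiftMap (shiftMap f A₀.sum) Z.sum) (g := shiftMap f A.sum) _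
    (hf.tail h hA) (by rw [shiftMap_shiftMap hf.int.mono, hAs])]
  exact (tensor_glue_right _ _ _ _ (catp_assoc X A₀ Z B A D L hZ hD h h₀) _ _ _).symm

lemma nmap_cons_aux (M : List ℕ) (hM : NmapDrop X M) (u : ℕ) (A B L : List ℕ) (f : ℕ → ℕ)
    (hf : NecCond L (u :: M) f) (h : A ++ B = L) (hA : f A.sum = u) :
    nmap X (u :: M) L f hf = (bmap X A u f (hf.int.take hA) ⊗ₘ
      nmap X M B (shiftMap f A.sum) (hf.tail h hA)) ≫ catp X A B L h := by
  classical
  have hle : Nat.find hf.exists_head ≤ A.length := Nat.find_min' hf.exists_head (by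
    rw [← h, List.take_left']
    · exact hA
    · rfl)
  refine nmap_cons_swap X M hM u _ (A.drop (Nat.find hf.exists_head)) A B _ L f hf h hA
    (List.take_append_drop _ _) (Nat.find_spec hf.exists_head) ?_ ?_
  · generalize Nat.find hf.exists_head = i at hle
    rw [← h, List.take_append_of_le_length hle, List.take_append_drop]
  · generalize Nat.find hf.exists_head = i at hle
    rw [← h, List.drop_append_of_le_length hle]

lemma nmapDrop_cons (M : List ℕ) (hM : NmapDrop X M) (u : ℕ) : NmapDrop X (u :: M) := by
  intro Z K L f hf h hZ
  obtain ⟨A, B, hK, hA⟩ := (hf.drop h hZ).exists_append (M := [u]) (N := M) rfl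
  have hA' : shiftMap f Z.sum A.sum = u := by simpa using hA
  have hs : (Z ++ A).sum = Z.sum + A.sum := List.sum_append
  have hAu : f (Z ++ A).sum = u := by
    have h1 := hf.int.mono (show Z.sum ≤ Z.sum + A.sum by omega)
    simp only [shiftMap] at hA'
    rw [hs]; omega
  have hL : (Z ++ A) ++ B = L := by rw [List.append_assoc, hK, h]
  rw [nmap_cons_aux X M hM u (Z ++ A) B L f hf hL hAu,
    nmap_cons_aux X M hM u A B K _ _ hK hA', bmap_left X Z A (Z ++ A) u f _ rfl hZ]
  rw [nmap_congr X (f := shiftMap (shiftMap f Z.sum) A.sum) (g := shiftMap f (Z ++ A).sum) _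
    (hf.tail hL hAu) (by rw [shiftMap_shiftMap hf.int.mono, hs])]
  exact tensor_glue_left _ _ _ _ (catp_assoc X Z A B (Z ++ A) K L rfl hK hL h) _ _ _

lemma nmapDrop (M : List ℕ) : NmapDrop X M := by
  induction M with
  | nil => exact nmapDrop_nil X
  | cons u M ih => exact nmapDrop_cons X M ih u

lemma nmap_cons (M : List ℕ) (u : ℕ) (A B L : List ℕ) (f : ℕ → ℕ)
    (hf : NecCond L (u :: M) f) (h : A ++ B = L) (hA : f A.sum = u) :
    nmap X (u :: M) L f hf = (bmap X A u f (hf.int.take hA) ⊗ₘ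
      nmap X M B (shiftMap f A.sum) (hf.tail h hA)) ≫ catp X A B L h :=
  nmap_cons_aux X M (nmapDrop X M) u A B L f hf h hA

lemma mup_nmap (M L : List ℕ) (q : ℕ) (f : ℕ → ℕ) (hf : NecCond L M f) (hq : M.sum = q)
    (hf' : IsIntMap L.sum q f) :
    mup X M q hq ≫ nmap X M L f hf = bmap X L q f hf' := by
  induction M generalizing L q f with
  | nil =>
    obtain rfl : 0 = q := by simpa using hq
    simp only [nmap, zeta]
    rw [mup_nil, IsIso.hom_inv_id_assoc]
  | cons u M ih =>
    obtain ⟨A, B, h, hA⟩ := hf.exists_append (M := [u]) (N := M) rfl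
    have hA' : f A.sum = u := by simpa using hA
    have hq' : u + M.sum = q := by simpa using hq
    rw [nmap_cons X M u A B L f hf h hA', bmap_append X A B L u M.sum q f _ h hA' hq',
      ← ih B M.sum _ (hf.tail h hA') rfl, mup_cons X u M q M.sum _ rfl hq', Category.assoc,
      MonoidalCategory.whiskerLeft_comp_tensorHom_assoc]

lemma catp_nmap (M N P A B L : List ℕ) (f : ℕ → ℕ) (hf : NecCond L P f) (hP : M ++ N = P)
    (hL : A ++ B = L) (hA : f A.sum = M.sum) :
    catp X M N P hP ≫ nmap X P L f hf = (nmap X M A f (hf.left hL hP hA) ⊗ₘ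
      nmap X N B (shiftMap f A.sum) (hf.right hL hP hA)) ≫ catp X A B L hL := by
  induction M generalizing P A L f with
  | nil =>
    obtain rfl : N = P := hP
    rw [catp_nil, nmapDrop X N A B L f hf hL hA, Iso.hom_inv_id_assoc]
    rfl
  | cons u M ih =>
    subst hP
    simp only [List.cons_append] at hf ⊢
    obtain ⟨A₁, A₂, h, hA₁⟩ := (hf.left (M := u :: M) hL rfl hA).exists_append (M := [u]) (N := M) rfl
    have hu : f A₁.sum = u := by simpa using hA₁
    have hs : A.sum = A₁.sum + A₂.sum := by rw [← h, List.sum_append]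
    have h2 : A₁ ++ (A₂ ++ B) = L := by rw [← List.append_assoc, h, hL]
    have hA₂ : shiftMap f A₁.sum A₂.sum = M.sum := by
      simp only [shiftMap]; rw [← hs, hA, hu]; simp
    rw [nmap_cons X M u A₁ A₂ A f _ h hu, nmap_cons X (M ++ N) u A₁ (A₂ ++ B) L f hf h2 hu,
      catp_cons, Category.assoc, MonoidalCategory.whiskerLeft_comp_tensorHom_assoc,
      ih (M ++ N) A₂ (A₂ ++ B) _ _ rfl rfl hA₂]
    rw [nmap_congr X (f := shiftMap (shiftMap f A₁.sum) A₂.sum) (g := shiftMap f A.sum) _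
      (hf.right (M := u :: M) hL rfl hA) (by rw [shiftMap_shiftMap hf.int.mono, hs])]
    exact (tensor_glue _ _ _ _ (catp_assoc X A₁ A₂ B A (A₂ ++ B) L h rfl hL h2) _ _ _).symm

lemma bmap_nmap (M L : List ℕ) (u : ℕ) (f g : ℕ → ℕ) (hf : NecCond L M f)
    (hg : IsIntMap M.sum u g) :
    bmap X M u g hg ≫ nmap X M L f hf = bmap X L u (fun i => g (f i)) (hf.int.comp hg) := by
  rw [bmap, Category.assoc, mup_nmap X M L M.sum f hf rfl hf.int, bmap, ← Category.assoc, cellMap_comp]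
  rfl

lemma nmap_comp (M N L : List ℕ) (f g : ℕ → ℕ) (hf : NecCond L M f) (hg : NecCond M N g) :
    nmap X N M g hg ≫ nmap X M L f hf = nmap X N L (fun i => g (f i)) (hf.comp hg) := by
  induction N generalizing M L f g with
  | nil =>
    simp only [nmap, zeta, Category.assoc]
    rw [bmap_nmap]
  | cons u N ih =>
    obtain ⟨A, B, h, hA⟩ := hg.exists_append (M := [u]) (N := N) rfl
    have hA' : g A.sum = u := by simpa using hA
    obtain ⟨A₁, B₁, h₁, hA₁⟩ := hf.exists_append h
    rw [nmap_cons X N u A B M g hg h hA', Category.assoc,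
      catp_nmap X A B M A₁ B₁ L f hf h h₁ hA₁, tensorHom_comp_tensorHom_assoc, ih, bmap_nmap,
      nmap_cons X N u A₁ B₁ L _ _ h₁ (by rw [hA₁, hA'])]
    congr 2
    exact nmap_congr X _ _ (shiftMap_comp hf.int.mono hA₁).symm

lemma bmap_singleton (u : ℕ) (f : ℕ → ℕ) (hf : IsIntMap [u].sum u f) (h : ∀ i ≤ u, f i = i) :
    bmap X [u] u f hf = (ρ_ (cell X u)).inv := by
  refine Eq.trans ?_ (Category.id_comp _)
  refine congrArg₂ (· ≫ ·) (cellMap_id X (m := u) hf h) ?_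
  refine Eq.trans ?_ (cellδ_right X u rfl)
  exact congrArg (cellδ X u 0 u rfl ≫ cell X u ◁ ·) (mup_nil X rfl)

lemma zeta_nil (f : ℕ → ℕ) (hf : IsIntMap ([] : List ℕ).sum 0 f) : zeta X [] f hf = 𝟙 _ := by
  refine Eq.trans ?_ (IsIso.inv_hom_id (cellη X))
  refine congrArg (inv (cellη X) ≫ ·) (Eq.trans ?_ (Category.id_comp _))
  refine congrArg₂ (· ≫ ·) (cellMap_id X (m := 0) hf ?_) (mup_nil X rfl)
  intro i hi
  obtain rfl : i = 0 := by omega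
  exact hf.zero

lemma nmap_id (L : List ℕ) (f : ℕ → ℕ) (hf : NecCond L L f) (h : ∀ i ≤ L.sum, f i = i) :
    nmap X L L f hf = 𝟙 _ := by
  induction L generalizing f with
  | nil => exact zeta_nil X f _
  | cons u L ih =>
    have hu : f u = u := h u (by simp)
    have hu' : f [u].sum = u := by simpa using hu
    rw [nmap_cons X L u [u] L (u :: L) f hf rfl hu', ih,
      bmap_singleton X u f _ (fun i hi => h i (by simp; omega)), catp_cons, catp_nil]
    · exact tensor_unit_glue _ _
    · intro i hi
      simp only [shiftMap, List.sum_singleton]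
      rw [h (u + i) (by simp; omega), hu, Nat.add_sub_cancel_left]

/-- The extension `X_•` of a strongly unital oplax monoidal functor `X` to necklaces: it sends the
necklace with beads `n₁, ..., nₖ` to `X_{n₁} ⊗ ... ⊗ X_{nₖ}`. -/
noncomputable def necFunctor : Necᵒᵖ ⥤ W where
  obj T := beadTensor X T.unop.beads
  map f := nmap X _ _ f.unop.toHom.raw f.unop.necCond
  map_id T := nmap_id X _ _ _ fun i hi => min_eq_left hi
  map_comp f g := by
    rw [nmap_comp]
    exact nmap_congr X _ _ (funext fun i => FInt.Hom.raw_comp _ _ i)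

end BeadTensor

section NecMap

variable {W W' : Type*} [Category W] [MonoidalCategory W] [Category W'] [MonoidalCategory W']
  (G : W' ⥤ W) [G.LaxMonoidal] {X : FIntᵒᵖ ⥤ W} {Y : FIntᵒᵖ ⥤ W'} [X.OplaxMonoidal]
  [Y.OplaxMonoidal]

/-- For a lax monoidal functor `G`, the compatibility of a natural transformation `X ⟶ G Y` with the
colax monoidal structures of `X` and `Y`. If `G` has a left adjoint `H`, with the induced colax
monoidal structure, this says that the transpose `H X ⟶ Y` is monoidal. -/
structure IsColaxMonoidal (α : X ⟶ Y ⋙ G) : Prop where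
  counit : α.app (𝟙_ FIntᵒᵖ) ≫ G.map (Functor.OplaxMonoidal.η Y) =
    Functor.OplaxMonoidal.η X ≫ Functor.LaxMonoidal.ε G
  comul : ∀ k l : FIntᵒᵖ, α.app (k ⊗ l) ≫ G.map (Functor.OplaxMonoidal.δ Y k l) =
    Functor.OplaxMonoidal.δ X k l ≫ (α.app k ⊗ₘ α.app l) ≫ Functor.LaxMonoidal.μ G _ _

variable {α : X ⟶ Y ⋙ G}

variable (α) in
/-- The component of `α` at `[n]`. -/
def cellApp (n : ℕ) : cell X n ⟶ G.obj (cell Y n) := α.app (op ⟨n⟩)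

variable (α) in
/-- The morphism `X_{n₁} ⊗ ... ⊗ X_{nₖ} ⟶ G (Y_{n₁} ⊗ ... ⊗ Y_{nₖ})` induced by `α`. -/
def btApp : ∀ L : List ℕ, beadTensor X L ⟶ G.obj (beadTensor Y L)
  | [] => Functor.LaxMonoidal.ε G
  | n :: L => (cellApp G α n ⊗ₘ btApp L) ≫ Functor.LaxMonoidal.μ G _ _

variable (α) in
lemma cellMap_cellApp (m n : ℕ) (f : ℕ → ℕ) (h : IsIntMap m n f) :
    cellMap X m n f h ≫ cellApp G α m = cellApp G α n ≫ G.map (cellMap Y m n f h) :=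
  α.naturality _

lemma cellδ_cellApp (hα : IsColaxMonoidal G α) (k l n : ℕ) (h : k + l = n) :
    cellApp G α n ≫ G.map (cellδ Y k l n h) =
      cellδ X k l n h ≫ (cellApp G α k ⊗ₘ cellApp G α l) ≫ Functor.LaxMonoidal.μ G _ _ := by
  subst h
  rw [cellδ_rfl, cellδ_rfl]
  exact hα.comul (op ⟨k⟩) (op ⟨l⟩)

lemma catp_btApp (A B L : List ℕ) (h : A ++ B = L) :
    catp X A B L h ≫ btApp G α L =
      (btApp G α A ⊗ₘ btApp G α B) ≫ Functor.LaxMonoidal.μ G _ _ ≫ G.map (catp Y A B L h) := by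
  subst h
  induction A with
  | nil =>
    rw [show catp X [] B ([] ++ B) rfl = (λ_ (beadTensor X B)).hom from catp_nil X B rfl,
      show catp Y [] B ([] ++ B) rfl = (λ_ (beadTensor Y B)).hom from catp_nil Y B rfl]
    change _ = (Functor.LaxMonoidal.ε G ⊗ₘ _) ≫ _
    rw [MonoidalCategory.tensorHom_def'_assoc, ← Functor.LaxMonoidal.left_unitality]
    exact (leftUnitor_naturality _).symm
  | cons a A ih =>
    simp only [List.cons_append]
    rw [catp_cons, catp_cons, btApp, btApp, Category.assoc,
      MonoidalCategory.whiskerLeft_comp_tensorHom_assoc, ih, G.map_comp]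
    have h1 : ((cellApp G α a ⊗ₘ btApp G α A) ≫ Functor.LaxMonoidal.μ G (cell Y a) (beadTensor Y A)) ⊗ₘ
        btApp G α B = ((cellApp G α a ⊗ₘ btApp G α A) ⊗ₘ btApp G α B) ≫
          Functor.LaxMonoidal.μ G (cell Y a) (beadTensor Y A) ▷ _ := by
      rw [← tensorHom_id, tensorHom_comp_tensorHom, Category.comp_id]
    have h2 : cellApp G α a ⊗ₘ ((btApp G α A ⊗ₘ btApp G α B) ≫
          Functor.LaxMonoidal.μ G (beadTensor Y A) (beadTensor Y B) ≫
            G.map (catp Y A B (A ++ B) rfl)) =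
        (cellApp G α a ⊗ₘ (btApp G α A ⊗ₘ btApp G α B)) ≫
          _ ◁ Functor.LaxMonoidal.μ G (beadTensor Y A) (beadTensor Y B) ≫
            _ ◁ G.map (catp Y A B (A ++ B) rfl) := by
      rw [← id_tensorHom, ← id_tensorHom, tensorHom_comp_tensorHom, tensorHom_comp_tensorHom]
      simp only [Category.comp_id]
    rw [h1, h2]
    simp only [Category.assoc]
    rw [Functor.LaxMonoidal.associativity_assoc, Functor.LaxMonoidal.μ_natural_right,
      associator_naturality_assoc]

lemma mup_btApp (hα : IsColaxMonoidal G α) (L : List ℕ) (n : ℕ) (h : L.sum = n) :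
    mup X L n h ≫ btApp G α L = cellApp G α n ≫ G.map (mup Y L n h) := by
  induction L generalizing n with
  | nil =>
    obtain rfl : 0 = n := by simpa using h
    rw [mup_nil, mup_nil]
    exact hα.counit.symm
  | cons a L ih =>
    have hn : a + L.sum = n := by simpa using h
    rw [mup_cons X a L n L.sum h rfl hn, mup_cons Y a L n L.sum h rfl hn, btApp, G.map_comp,
      ← Category.assoc (cellApp G α n), cellδ_cellApp G hα, Category.assoc,
      MonoidalCategory.whiskerLeft_comp_tensorHom_assoc, ih]
    simp only [Category.assoc]
    rw [← Functor.LaxMonoidal.μ_natural_right, ← id_tensorHom,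
      tensorHom_comp_tensorHom_assoc, Category.comp_id]

lemma bmap_btApp (hα : IsColaxMonoidal G α) (L : List ℕ) (u : ℕ) (f : ℕ → ℕ)
    (h : IsIntMap L.sum u f) :
    bmap X L u f h ≫ btApp G α L = cellApp G α u ≫ G.map (bmap Y L u f h) := by
  rw [bmap, bmap, Category.assoc, mup_btApp G hα, ← Category.assoc, cellMap_cellApp, G.map_comp,
    Category.assoc]

variable [IsIso (cellη X)] [IsIso (cellη Y)]

lemma zeta_btApp (hα : IsColaxMonoidal G α) (L : List ℕ) (f : ℕ → ℕ) (h : IsIntMap L.sum 0 f) :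
    zeta X L f h ≫ btApp G α L = Functor.LaxMonoidal.ε G ≫ G.map (zeta Y L f h) := by
  have h0 : cellApp G α 0 ≫ G.map (cellη Y) = cellη X ≫ Functor.LaxMonoidal.ε G := hα.counit
  rw [zeta, zeta, Category.assoc, bmap_btApp G hα, IsIso.inv_comp_eq, ← Category.assoc, ← h0,
    Category.assoc, ← G.map_comp, IsIso.hom_inv_id_assoc]

lemma nmap_btApp (hα : IsColaxMonoidal G α) (M L : List ℕ) (f : ℕ → ℕ) (h : NecCond L M f) :
    nmap X M L f h ≫ btApp G α L = btApp G α M ≫ G.map (nmap Y M L f h) := by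
  induction M generalizing L f with
  | nil => exact zeta_btApp G hα L f h.int_nil
  | cons u M ih =>
    obtain ⟨A, B, hL, hA⟩ := h.exists_append (M := [u]) (N := M) rfl
    have hA' : f A.sum = u := by simpa using hA
    rw [nmap_cons X M u A B L f h hL hA', nmap_cons Y M u A B L f h hL hA', Category.assoc,
      catp_btApp, tensorHom_comp_tensorHom_assoc, bmap_btApp G hα, ih, btApp, G.map_comp,
      Category.assoc, ← Functor.LaxMonoidal.μ_natural_assoc, tensorHom_comp_tensorHom_assoc]

/-- The natural transformation of functors on necklaces induced by `α`. -/
noncomputable def necMap (hα : IsColaxMonoidal G α) : necFunctor X ⟶ necFunctor Y ⋙ G where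
  app T := btApp G α T.unop.beads
  naturality _ _ _ := nmap_btApp G hα _ _ _ _

end NecMap


namespace VQuiver

lemma whiskerRight_tensorHom_aux {V : Type*} [Category V] [MonoidalCategory V] {A B C D E : V}
    {i : A ⟶ B} {m : B ⟶ C} {j : A ⟶ C} (hij : i ≫ m = j) (h : C ⊗ D ⟶ E) :
    i ▷ D ≫ (m ⊗ₘ 𝟙 D) ≫ h = j ▷ D ≫ h := by
  rw [← hij, tensorHom_id, comp_whiskerRight, Category.assoc]

lemma whiskerLeft_tensorHom_aux {V : Type*} [Category V] [MonoidalCategory V] {A B C D E : V}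
    {i : A ⟶ B} {m : B ⟶ C} {j : A ⟶ C} (hij : i ≫ m = j) (h : D ⊗ C ⟶ E) :
    D ◁ i ≫ (𝟙 D ⊗ₘ m) ≫ h = D ◁ j ≫ h := by
  rw [← hij, id_tensorHom, whiskerLeft_comp, Category.assoc]

variable {V : Type u} [Category.{v} V] {S T R : Type v}

/-- The base change functor `f^*`, with `(f^* Q)(a, b) = Q(f a, f b)`. -/
def pull (f : S → T) : VQuiver V T ⥤ VQuiver V S where
  obj Q := ⟨fun a b => Q.obj (f a) (f b)⟩
  map φ := ⟨fun a b => φ.app (f a) (f b)⟩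

variable [MonoidalCategory V] [BraidedCategory V] [MonoidalClosed V] [HasColimits V]

/-- The unit of the lax monoidal structure of `f^*`: the identity on the copies of the unit. -/
noncomputable def pullε (f : S → T) : 𝟙_ (VQuiver V S) ⟶ (pull f).obj (𝟙_ (VQuiver V T)) :=
  ⟨fun a b => Sigma.desc fun e : PLift (a = b) => ιUnit (congrArg f e.down)⟩

/-- The multiplication of the lax monoidal structure of `f^*`: the inclusion of the summand of
`f c` on the summand of `c`. -/
noncomputable def pullμ (f : S → T) (Q P : VQuiver V T) :
    (pull f).obj Q ⊗ (pull f).obj P ⟶ (pull f).obj (Q ⊗ P) :=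
  ⟨fun a b => desc fun c => ι Q P (f a) (f c) (f b)⟩

lemma ιUnit_pullε (f : S → T) {a b : S} (e : a = b) :
    ιUnit e ≫ (pullε (V := V) f).app a b = ιUnit (congrArg f e) :=
  Sigma.ι_desc (fun e : PLift (a = b) => (ιUnit (congrArg f e.down) : 𝟙_ V ⟶ _)) ⟨e⟩

lemma ι_pullμ (f : S → T) (Q P : VQuiver V T) (a c b : S) :
    ι ((pull f).obj Q) ((pull f).obj P) a c b ≫ (pullμ f Q P).app a b =
      ι Q P (f a) (f c) (f b) := ι_desc _ _

lemma ι_pullμ_assoc (f : S → T) (Q P : VQuiver V T) (a c b : S) {W : V}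
    (h : (tensor Q P).obj (f a) (f b) ⟶ W) :
    ι ((pull f).obj Q) ((pull f).obj P) a c b ≫ (pullμ f Q P).app a b ≫ h =
      ι Q P (f a) (f c) (f b) ≫ h := ι_desc_assoc _ _ _

lemma pullμ_natural (f : S → T) {Q Q' P P' : VQuiver V T} (φ : Q ⟶ Q') (ψ : P ⟶ P') :
    tmap ((pull f).map φ) ((pull f).map ψ) ≫ pullμ f Q' P' =
      pullμ f Q P ≫ (pull f).map (tmap φ ψ) := by
  ext a b
  refine tensor_ext fun c => ?_
  refine (ι_tmap_assoc _ _ _ _ _ _).trans ?_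
  refine Eq.trans ?_ (ι_pullμ_assoc _ _ _ _ _ _ _).symm
  refine Eq.trans (congrArg (_ ≫ ·) (ι_pullμ f Q' P' a c b)) ?_
  exact (ι_tmap φ ψ (f a) (f c) (f b)).symm

lemma pullμ_assoc (f : S → T) (Q P R : VQuiver V T) :
    tmap (pullμ f Q P) (𝟙 ((pull f).obj R)) ≫ pullμ f (tensor Q P) R ≫
        (pull f).map (assocHom Q P R) =
      assocHom ((pull f).obj Q) ((pull f).obj P) ((pull f).obj R) ≫
        tmap (𝟙 ((pull f).obj Q)) (pullμ f P R) ≫ pullμ f Q (tensor P R) := by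
  ext a b
  refine tensor_ext fun c => tensorR_ext fun d => ?_
  refine Eq.trans ?_ (ι_assocHom_assoc _ _ _ _ _ _ _ _).symm
  refine Eq.trans (congrArg (_ ≫ ·) (ι_tmap_assoc _ _ _ _ _ _)) ?_
  refine Eq.trans ?_ (congrArg (fun x => _ ≫ _ ≫ x) (ι_tmap_assoc _ _ _ _ _ _).symm)
  refine Eq.trans (congrArg (fun x => _ ≫ _ ≫ x) (ι_pullμ_assoc _ _ _ _ _ _ _)) ?_
  refine Eq.trans ?_ (congrArg (fun x => _ ≫ _ ≫ _ ≫ x) (ι_pullμ f Q (tensor P R) a d b).symm)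
  refine Eq.trans (whiskerRight_tensorHom_aux (ι_pullμ f Q P a d c) _) ?_
  refine Eq.trans ?_ (congrArg (_ ≫ ·) (whiskerLeft_tensorHom_aux (ι_pullμ f P R d c b) _).symm)
  exact ι_assocHom Q P R (f a) (f d) (f c) (f b)

lemma pullμ_left (f : S → T) (Q : VQuiver V T) :
    leftUnitHom ((pull f).obj Q) = tmap (pullε f) (𝟙 ((pull f).obj Q)) ≫ pullμ f (unit V T) Q ≫
      (pull f).map (leftUnitHom Q) := by
  ext a b
  refine tensor_ext fun c => unitR_ext fun e => ?_
  subst e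
  refine (ι_leftUnitHom _ a b).trans ?_
  refine Eq.trans ?_ (congrArg (_ ≫ ·) (ι_tmap_assoc _ _ _ _ _ _).symm)
  refine Eq.trans ?_ (congrArg (fun x => _ ≫ _ ≫ x) (ι_pullμ_assoc f (unit V T) Q a a b
    ((leftUnitHom Q).app (f a) (f b))).symm)
  refine Eq.trans ?_ (whiskerRight_tensorHom_aux (ιUnit_pullε f rfl) _).symm
  exact (ι_leftUnitHom Q (f a) (f b)).symm

lemma pullμ_right (f : S → T) (Q : VQuiver V T) :
    rightUnitHom ((pull f).obj Q) = tmap (𝟙 ((pull f).obj Q)) (pullε f) ≫ pullμ f Q (unit V T) ≫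
      (pull f).map (rightUnitHom Q) := by
  ext a b
  refine tensor_ext fun c => unitL_ext fun e => ?_
  subst e
  refine (ι_rightUnitHom _ a c).trans ?_
  refine Eq.trans ?_ (congrArg (_ ≫ ·) (ι_tmap_assoc _ _ _ _ _ _).symm)
  refine Eq.trans ?_ (congrArg (fun x => _ ≫ _ ≫ x) (ι_pullμ_assoc f Q (unit V T) a c c
    ((rightUnitHom Q).app (f a) (f c))).symm)
  refine Eq.trans ?_ (whiskerLeft_tensorHom_aux (ιUnit_pullε f rfl) _).symm
  exact (ι_rightUnitHom Q (f a) (f c)).symm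

noncomputable instance (f : S → T) : (pull f : VQuiver V T ⥤ VQuiver V S).LaxMonoidal where
  ε := pullε f
  μ := pullμ f
  μ_natural_left φ P := by
    refine Eq.trans ?_ (pullμ_natural f φ (𝟙 P))
    rw [(pull f).map_id]
    rfl
  μ_natural_right P φ := by
    refine Eq.trans ?_ (pullμ_natural f (𝟙 P) φ)
    rw [(pull f).map_id]
    rfl
  associativity Q P R := pullμ_assoc f Q P R
  left_unitality Q := pullμ_left f Q
  right_unitality Q := pullμ_right f Q

end VQuiver

namespace VQuiver

variable {V : Type u} [Category.{v} V] [MonoidalCategory V] [BraidedCategory V] [MonoidalClosed V]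
  [HasColimits V] {S T R : Type v}

lemma unit_ext {a b : S} {W : V} {f g : (unit V S).obj a b ⟶ W}
    (h : ∀ e : a = b, ιUnit e ≫ f = ιUnit e ≫ g) : f = g := Sigma.hom_ext _ _ fun e => h e.down

lemma pullε_id (a b : S) : (pullε (V := V) (id : S → S)).app a b = 𝟙 ((unit V S).obj a b) :=
  unit_ext fun e => (ιUnit_pullε id e).trans (Category.comp_id _).symm

lemma pullμ_id (Q P : VQuiver V S) (a b : S) :
    (pullμ id Q P).app a b = 𝟙 ((tensor Q P).obj a b) :=
  tensor_ext fun c => (ι_pullμ id Q P a c b).trans (Category.comp_id _).symm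

lemma pullε_comp (f : S → T) (g : T → R) (a b : S) :
    (pullε (V := V) f).app a b ≫ (pullε g).app (f a) (f b) = (pullε (g ∘ f)).app a b := by
  refine unit_ext fun e => ?_
  refine (Category.assoc _ _ _).symm.trans ?_
  refine (congrArg (· ≫ (pullε g).app (f a) (f b)) (ιUnit_pullε f e)).trans ?_
  exact (ιUnit_pullε g _).trans (ιUnit_pullε (g ∘ f) e).symm

lemma tmap_pullμ_comp (f : S → T) (g : T → R) {Q₁ Q₂ : VQuiver V S} {P₁ P₂ : VQuiver V T}
    {N₁ N₂ : VQuiver V R} (φ₁ : Q₁ ⟶ (pull f).obj P₁) (φ₂ : Q₂ ⟶ (pull f).obj P₂)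
    (ψ₁ : P₁ ⟶ (pull g).obj N₁) (ψ₂ : P₂ ⟶ (pull g).obj N₂)
    (χ₁ : Q₁ ⟶ (pull (g ∘ f)).obj N₁) (χ₂ : Q₂ ⟶ (pull (g ∘ f)).obj N₂)
    (h₁ : ∀ a b, φ₁.app a b ≫ ψ₁.app (f a) (f b) = χ₁.app a b)
    (h₂ : ∀ a b, φ₂.app a b ≫ ψ₂.app (f a) (f b) = χ₂.app a b) (a b : S) :
    (tmap φ₁ φ₂).app a b ≫ (pullμ f P₁ P₂).app a b ≫ (tmap ψ₁ ψ₂).app (f a) (f b) ≫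
        (pullμ g N₁ N₂).app (f a) (f b) =
      (tmap χ₁ χ₂).app a b ≫ (pullμ (g ∘ f) N₁ N₂).app a b := by
  refine tensor_ext fun c => ?_
  refine (ι_tmap_assoc _ _ _ _ _ _).trans ?_
  refine Eq.trans ?_ (ι_tmap_assoc _ _ _ _ _ _).symm
  refine (congrArg ((φ₁.app a c ⊗ₘ φ₂.app c b) ≫ ·) (ι_pullμ_assoc f P₁ P₂ a c b _)).trans ?_
  refine (congrArg ((φ₁.app a c ⊗ₘ φ₂.app c b) ≫ ·)
    (ι_tmap_assoc ψ₁ ψ₂ (f a) (f c) (f b) _)).trans ?_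
  refine (congrArg (fun x => (φ₁.app a c ⊗ₘ φ₂.app c b) ≫
    (ψ₁.app (f a) (f c) ⊗ₘ ψ₂.app (f c) (f b)) ≫ x) (ι_pullμ g N₁ N₂ (f a) (f c) (f b))).trans ?_
  refine Eq.trans ?_ (congrArg ((χ₁.app a c ⊗ₘ χ₂.app c b) ≫ ·)
    (ι_pullμ (g ∘ f) N₁ N₂ a c b).symm)
  refine (tensorHom_comp_tensorHom_assoc _ _ _ _ _).trans ?_
  exact congrArg₂ (fun x y => (x ⊗ₘ y) ≫ ι N₁ N₂ (g (f a)) (g (f c)) (g (f b))) (h₁ a c) (h₂ c b)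

end VQuiver

/-- A templicial object of `V`: a set `S` of vertices and a strongly unital colax monoidal functor
from the opposite category of finite intervals to `V`-enriched quivers on `S`. -/
structure TemplicialObject (V : Type u) [Category.{v} V] [MonoidalCategory V] [BraidedCategory V]
    [MonoidalClosed V] [HasColimits V] where
  S : Type v
  X : FIntᵒᵖ ⥤ VQuiver V S
  [colax : X.OplaxMonoidal]
  [unital : IsIso (Functor.OplaxMonoidal.η X)]

namespace TemplicialObject

variable {V : Type u} [Category.{v} V] [MonoidalCategory V] [BraidedCategory V] [MonoidalClosed V]
  [HasColimits V]

attribute [instance] TemplicialObject.colax TemplicialObject.unital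

instance (X : TemplicialObject V) : IsIso (cellη X.X) := X.unital

/-- A templicial morphism `(X, S) ⟶ (Y, T)`: a map `f : S → T` and a monoidal natural transformation
`f_! X ⟶ Y`, given by its transpose `X ⟶ f^* Y`. -/
structure Hom (X Y : TemplicialObject V) where
  f : X.S → Y.S
  α : X.X ⟶ Y.X ⋙ VQuiver.pull f
  colax : IsColaxMonoidal (VQuiver.pull f) α

lemma Hom.mk_congr {X Y : TemplicialObject V} {f : X.S → Y.S} {α β : X.X ⟶ Y.X ⋙ VQuiver.pull f}
    (hα : IsColaxMonoidal (VQuiver.pull f) α) (hβ : IsColaxMonoidal (VQuiver.pull f) β)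
    (h : ∀ n a b, (α.app n).app a b = (β.app n).app a b) : Hom.mk f α hα = Hom.mk f β hβ := by
  obtain rfl : α = β := by
    ext n a b
    exact h n a b
  rfl

/-- The identity templicial morphism. -/
def Hom.id (X : TemplicialObject V) : Hom X X where
  f := _root_.id
  α :=
    { app := fun n => ⟨fun a b => 𝟙 ((X.X.obj n).obj a b)⟩
      naturality := fun m n φ => by
        ext a b
        exact (Category.comp_id _).trans (Category.id_comp _).symm }
  colax :=
    { counit := by
        ext a b
        refine (Category.id_comp _).trans ?_
        refine (Category.comp_id _).symm.trans ?_
        exact congrArg (_ ≫ ·) (VQuiver.pullε_id a b).symm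
      comul := fun k l => by
        ext a b
        refine (Category.id_comp _).trans ?_
        refine (Category.comp_id _).symm.trans ?_
        refine congrArg (_ ≫ ·) ?_
        refine Eq.trans ?_ (congrArg (_ ≫ ·) (VQuiver.pullμ_id _ _ a b).symm)
        refine Eq.trans ?_ (Category.comp_id _).symm
        exact (congrArg (fun x : VQuiver.Hom _ _ => x.app a b)
          (VQuiver.tmap_id (X.X.obj k) (X.X.obj l))).symm }

/-- Composition of templicial morphisms. -/
def Hom.comp {X Y Z : TemplicialObject V} (φ : Hom X Y) (ψ : Hom Y Z) : Hom X Z where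
  f := ψ.f ∘ φ.f
  α :=
    { app := fun n => ⟨fun a b => (φ.α.app n).app a b ≫ (ψ.α.app n).app (φ.f a) (φ.f b)⟩
      naturality := fun m n χ => by
        ext a b
        have h1 := congrArg (fun x : VQuiver.Hom _ _ => x.app a b) (φ.α.naturality χ)
        have h2 := congrArg (fun x : VQuiver.Hom _ _ => x.app (φ.f a) (φ.f b)) (ψ.α.naturality χ)
        refine (Category.assoc _ _ _).symm.trans ?_
        refine (congrArg (· ≫ _) h1).trans ?_
        refine (Category.assoc _ _ _).trans ?_
        refine (congrArg (_ ≫ ·) h2).trans ?_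
        exact (Category.assoc _ _ _).symm }
  colax :=
    { counit := by
        ext a b
        have h1 := congrArg (fun x : VQuiver.Hom _ _ => x.app a b) φ.colax.counit
        have h2 := congrArg (fun x : VQuiver.Hom _ _ => x.app (φ.f a) (φ.f b)) ψ.colax.counit
        refine (Category.assoc _ _ _).trans ?_
        refine (congrArg (_ ≫ ·) h2).trans ?_
        refine (Category.assoc _ _ _).symm.trans ?_
        refine (congrArg (· ≫ _) h1).trans ?_
        refine (Category.assoc _ _ _).trans ?_
        exact congrArg (_ ≫ ·) (VQuiver.pullε_comp φ.f ψ.f a b)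
      comul := fun k l => by
        ext a b
        have h1 := congrArg (fun x : VQuiver.Hom _ _ => x.app a b) (φ.colax.comul k l)
        have h2 := congrArg (fun x : VQuiver.Hom _ _ => x.app (φ.f a) (φ.f b)) (ψ.colax.comul k l)
        refine (Category.assoc _ _ _).trans ?_
        refine (congrArg (_ ≫ ·) h2).trans ?_
        refine (Category.assoc _ _ _).symm.trans ?_
        refine (congrArg (· ≫ _) h1).trans ?_
        refine (Category.assoc _ _ _).trans ?_
        refine congrArg (_ ≫ ·) ?_
        refine (Category.assoc _ _ _).trans ?_
        exact VQuiver.tmap_pullμ_comp φ.f ψ.f (φ.α.app k) (φ.α.app l) (ψ.α.app k) (ψ.α.app l) _ _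
          (fun _ _ => rfl) (fun _ _ => rfl) a b }

/-- The category of templicial objects. -/
instance : Category (TemplicialObject V) where
  Hom := Hom
  id := Hom.id
  comp := Hom.comp
  id_comp φ := Hom.mk_congr _ φ.colax fun _ _ _ => Category.id_comp _
  comp_id φ := Hom.mk_congr _ φ.colax fun _ _ _ => Category.comp_id _
  assoc _ _ _ := Hom.mk_congr _ _ fun _ _ _ => Category.assoc _ _ _

/-- The functor `X_•(a, b)` on necklaces. -/
noncomputable def nec (X : TemplicialObject V) (a b : X.S) : Necᵒᵖ ⥤ V :=
  necFunctor X.X ⋙ VQuiver.eval a b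

/-- The natural transformation `X_•(a, b) ⟶ Y_•(f a, f b)` induced by a templicial morphism. -/
noncomputable def necHom {X Y : TemplicialObject V} (φ : X ⟶ Y) (a b : X.S) :
    X.nec a b ⟶ Y.nec (Hom.f φ a) (Hom.f φ b) :=
  Functor.whiskerRight (necMap (VQuiver.pull (Hom.f φ)) (Hom.colax φ)) (VQuiver.eval a b)

end TemplicialObject

/-- A small `V`-category: a set of objects and a monoid in the monoidal category of `V`-enriched
quivers on it. -/
structure SmallVCat (V : Type u) [Category.{v} V] [MonoidalCategory V] [BraidedCategory V]
    [MonoidalClosed V] [HasColimits V] where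
  Ob : Type v
  C : VQuiver V Ob
  [mon : MonObj C]

attribute [instance] SmallVCat.mon

/-- The templicial nerve of a small `V`-category. -/
noncomputable def templicialNerve {V : Type u} [Category.{v} V] [MonoidalCategory V]
    [BraidedCategory V] [MonoidalClosed V] [HasColimits V] (C : SmallVCat V) :
    TemplicialObject V where
  S := C.Ob
  X := monNerve C.C

section Simplices

/-- The morphism `[m] ⟶ [n]` of the simplex category with values `f 0, ..., f m`. -/
def simplexMap (m n : ℕ) (f : ℕ → ℕ) (hf : Monotone f) (h : f m ≤ n) :
    SimplexCategory.mk m ⟶ SimplexCategory.mk n :=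
  SimplexCategory.mkHom
    { toFun := fun i => ⟨f i, Nat.lt_succ_of_le ((hf (Nat.lt_succ_iff.mp i.2)).trans h)⟩
      monotone' := fun _ _ hij => hf hij }

variable (K : SSet.{v})

/-- The action of `f : [m] ⟶ [n]` on a simplicial set. -/
def face (m n : ℕ) (f : ℕ → ℕ) (hf : Monotone f) (h : f m ≤ n)
    (σ : K.obj (op (SimplexCategory.mk n))) : K.obj (op (SimplexCategory.mk m)) :=
  K.map (simplexMap m n f hf h).op σ

/-- The `i`-th vertex of an `n`-simplex. -/
def vertex (n i : ℕ) (h : i ≤ n) (σ : K.obj (op (SimplexCategory.mk n))) :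
    K.obj (op (SimplexCategory.mk 0)) := face K 0 n (fun _ => i) monotone_const h σ

variable {K}

lemma face_congr {m n : ℕ} {f g : ℕ → ℕ} (hf : Monotone f) (hg : Monotone g) (hf' : f m ≤ n)
    (hg' : g m ≤ n) (h : ∀ i ≤ m, f i = g i) (σ : K.obj (op (SimplexCategory.mk n))) :
    face K m n f hf hf' σ = face K m n g hg hg' σ := by
  have : simplexMap m n f hf hf' = simplexMap m n g hg hg' := by
    unfold simplexMap
    congr 2
    funext i
    exact Fin.ext (h i (Nat.lt_succ_iff.mp i.2))
  unfold face
  rw [this]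

lemma face_id {n : ℕ} {f : ℕ → ℕ} (hf : Monotone f) (hf' : f n ≤ n) (h : ∀ i ≤ n, f i = i)
    (σ : K.obj (op (SimplexCategory.mk n))) : face K n n f hf hf' σ = σ := by
  refine (face_congr hf monotone_id hf' le_rfl h σ).trans ?_
  exact K.map_id_apply _ σ

lemma face_face {m n p : ℕ} {f g : ℕ → ℕ} (hf : Monotone f) (hg : Monotone g) (hf' : f m ≤ n)
    (hg' : g n ≤ p) (σ : K.obj (op (SimplexCategory.mk p))) :
    face K m n f hf hf' (face K n p g hg hg' σ) =
      face K m p (fun i => g (f i)) (fun _ _ h => hg (hf h)) ((hg hf').trans hg') σ :=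
  (K.map_comp_apply (simplexMap n p g hg hg').op (simplexMap m n f hf hf').op σ).symm

lemma face_naturality {L : SSet.{v}} (φ : K ⟶ L) {m n : ℕ} {f : ℕ → ℕ} (hf : Monotone f)
    (hf' : f m ≤ n) (σ : K.obj (op (SimplexCategory.mk n))) :
    φ.app _ (face K m n f hf hf' σ) = face L m n f hf hf' (φ.app _ σ) :=
  NatTrans.naturality_apply φ _ σ

lemma vertex_face {m n i j : ℕ} {f : ℕ → ℕ} (hf : Monotone f) (hf' : f m ≤ n) (hi : i ≤ m)
    (hj : f i = j) (σ : K.obj (op (SimplexCategory.mk n))) :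
    vertex K m i hi (face K m n f hf hf' σ) =
      vertex K n j (hj ▸ (hf hi).trans hf') σ := by
  subst hj
  exact face_face monotone_const hf hi hf' σ

lemma vertex_zero (σ : K.obj (op (SimplexCategory.mk 0))) (h : 0 ≤ 0) : vertex K 0 0 h σ = σ :=
  face_id _ _ (fun i hi => by omega) σ

lemma vertex_naturality {L : SSet.{v}} (φ : K ⟶ L) {n i : ℕ} (hi : i ≤ n)
    (σ : K.obj (op (SimplexCategory.mk n))) :
    φ.app _ (vertex K n i hi σ) = vertex L n i hi (φ.app _ σ) := face_naturality φ _ _ σ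

end Simplices

section Free

variable (V : Type u) [Category.{v} V] [MonoidalCategory V] [HasColimits V]

/-- The functor `F` from sets to `V` sending a set to the coproduct of copies of the unit. -/
noncomputable def freeFunctor : Type v ⥤ V := sigmaConst.obj (𝟙_ V)

/-- The quiver `F̃(K)_n` with `F̃(K)_n(a, b) = F(K_n(a, b))`, where `K_n(a, b)` is the set of
`n`-simplices with first vertex `a` and last vertex `b`. -/
noncomputable def freeQuiver (K : SSet.{v}) (n : ℕ) :
    VQuiver V (K.obj (op (SimplexCategory.mk 0))) :=
  ⟨fun a b => (freeFunctor V).obj {σ : K.obj (op (SimplexCategory.mk n)) //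
    vertex K n 0 (Nat.zero_le n) σ = a ∧ vertex K n n le_rfl σ = b}⟩

variable {V} {K : SSet.{v}}

/-- The copy of the unit in `F̃(K)_n(a, b)` of a simplex. -/
noncomputable def gen {n : ℕ} {a b : K.obj (op (SimplexCategory.mk 0))}
    (σ : K.obj (op (SimplexCategory.mk n))) (ha : vertex K n 0 (Nat.zero_le n) σ = a)
    (hb : vertex K n n le_rfl σ = b) : 𝟙_ V ⟶ (freeQuiver V K n).obj a b :=
  Sigma.ι (fun _ : {σ : K.obj (op (SimplexCategory.mk n)) //
    vertex K n 0 (Nat.zero_le n) σ = a ∧ vertex K n n le_rfl σ = b} => 𝟙_ V) ⟨σ, ha, hb⟩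

/-- A morphism out of `F̃(K)_n(a, b)`, given on simplices. -/
noncomputable def freeDesc {n : ℕ} {a b : K.obj (op (SimplexCategory.mk 0))} {W : V}
    (f : ∀ σ : K.obj (op (SimplexCategory.mk n)), vertex K n 0 (Nat.zero_le n) σ = a →
      vertex K n n le_rfl σ = b → (𝟙_ V ⟶ W)) : (freeQuiver V K n).obj a b ⟶ W :=
  Sigma.desc fun σ => f σ.1 σ.2.1 σ.2.2

lemma gen_freeDesc {n : ℕ} {a b : K.obj (op (SimplexCategory.mk 0))} {W : V}
    (f : ∀ σ : K.obj (op (SimplexCategory.mk n)), vertex K n 0 (Nat.zero_le n) σ = a →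
      vertex K n n le_rfl σ = b → (𝟙_ V ⟶ W)) (σ : K.obj (op (SimplexCategory.mk n))) (ha) (hb) :
    gen σ ha hb ≫ freeDesc f = f σ ha hb :=
  Sigma.ι_desc (fun σ : {σ : K.obj (op (SimplexCategory.mk n)) //
    vertex K n 0 (Nat.zero_le n) σ = a ∧ vertex K n n le_rfl σ = b} => f σ.1 σ.2.1 σ.2.2) ⟨σ, ha, hb⟩

lemma free_ext {n : ℕ} {a b : K.obj (op (SimplexCategory.mk 0))} {W : V}
    {f g : (freeQuiver V K n).obj a b ⟶ W} (h : ∀ σ ha hb, gen σ ha hb ≫ f = gen σ ha hb ≫ g) :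
    f = g :=
  Sigma.hom_ext _ _ fun σ => h σ.1 σ.2.1 σ.2.2

lemma gen_congr {n : ℕ} {a b : K.obj (op (SimplexCategory.mk 0))}
    {σ τ : K.obj (op (SimplexCategory.mk n))} (h : σ = τ) (ha) (hb) (ha') (hb') :
    (gen σ ha hb : 𝟙_ V ⟶ (freeQuiver V K n).obj a b) = gen τ ha' hb' := by
  subst h; rfl

variable (V K) in
/-- The action of `f : [m] ⟶ [n]` on `F̃(K)`. -/
noncomputable def freeMap (m n : ℕ) (f : ℕ → ℕ) (h : IsIntMap m n f) :
    freeQuiver V K n ⟶ freeQuiver V K m :=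
  ⟨fun _ _ => freeDesc fun σ ha hb => gen (face K m n f h.mono h.last.le σ)
    ((vertex_face _ _ _ h.zero σ).trans ha) ((vertex_face _ _ _ h.last σ).trans hb)⟩

lemma gen_freeMap {m n : ℕ} {f : ℕ → ℕ} (h : IsIntMap m n f)
    {a b : K.obj (op (SimplexCategory.mk 0))} (σ : K.obj (op (SimplexCategory.mk n))) (ha) (hb)
    (τ : K.obj (op (SimplexCategory.mk m))) (hτ : face K m n f h.mono h.last.le σ = τ) (ha') (hb') :
    gen σ ha hb ≫ (freeMap V K m n f h).app a b = gen τ ha' hb' := by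
  subst hτ
  dsimp only [freeMap]
  exact gen_freeDesc _ σ ha hb

lemma freeMap_id {m : ℕ} {f : ℕ → ℕ} (h : IsIntMap m m f) (hf : ∀ i ≤ m, f i = i) :
    freeMap V K m m f h = 𝟙 _ := by
  ext a b
  refine free_ext fun σ ha hb => ?_
  exact (gen_freeMap h σ ha hb σ (face_id _ _ hf σ) ha hb).trans (Category.comp_id _).symm

lemma freeMap_comp {m n p : ℕ} {f g : ℕ → ℕ} (hf : IsIntMap m n f) (hg : IsIntMap n p g)
    {f' : ℕ → ℕ} (hf' : IsIntMap m p f') (h : ∀ i ≤ m, f' i = g (f i)) :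
    freeMap V K m p f' hf' = freeMap V K n p g hg ≫ freeMap V K m n f hf := by
  ext a b
  refine free_ext fun σ ha hb => ?_
  have h1 := face_face hf.mono hg.mono hf.last.le hg.last.le σ
  have ha₁ : vertex K n 0 (Nat.zero_le n) (face K n p g hg.mono hg.last.le σ) = a :=
    (vertex_face _ _ _ hg.zero σ).trans ha
  have hb₁ : vertex K n n le_rfl (face K n p g hg.mono hg.last.le σ) = b :=
    (vertex_face _ _ _ hg.last σ).trans hb
  refine (gen_freeMap hf' σ ha hb _ ((face_congr _ _ _ _ h σ).trans h1.symm)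
    ((vertex_face _ _ _ hf.zero _).trans ha₁) ((vertex_face _ _ _ hf.last _).trans hb₁)).trans ?_
  refine Eq.trans ?_ (Category.assoc _ _ _)
  refine Eq.trans ?_ (congrArg (· ≫ (freeMap V K m n f hf).app a b)
    (gen_freeMap hg σ ha hb _ rfl ha₁ hb₁).symm)
  exact (gen_freeMap hf _ _ _ _ rfl _ _).symm

variable (V K) in
/-- The functor underlying `F̃(K)`. -/
noncomputable def freeNerve : FIntᵒᵖ ⥤ VQuiver V (K.obj (op (SimplexCategory.mk 0))) where
  obj n := freeQuiver V K n.unop.len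
  map f := freeMap V K _ _ (FInt.raw f.unop) (IsIntMap.raw f.unop)
  map_id _ := freeMap_id _ fun _ hi => min_eq_left hi
  map_comp f g := freeMap_comp _ _ _ fun i _ => FInt.raw_comp g.unop f.unop i

variable [BraidedCategory V] [MonoidalClosed V]

lemma front_le (k l n : ℕ) (h : k + l = n) : k ≤ n := by omega

lemma back_mono (k : ℕ) : Monotone fun i => k + i := fun _ _ h => Nat.add_le_add_left h k

variable (V K) in
/-- The comultiplication of `F̃(K)`: a simplex with `k`-th vertex `c` is mapped to the tensor product
of its front `k`-face and its back `l`-face in the summand of `c`. -/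
noncomputable def freeδ (k l n : ℕ) (h : k + l = n) :
    freeQuiver V K n ⟶ VQuiver.tensor (freeQuiver V K k) (freeQuiver V K l) :=
  ⟨fun a b => freeDesc fun σ ha hb => (λ_ (𝟙_ V)).inv ≫
    (gen (face K k n (fun i => i) monotone_id (front_le k l n h) σ)
        ((vertex_face _ _ _ rfl σ).trans ha) (vertex_face _ _ _ rfl σ) ⊗ₘ
      gen (face K l n (fun i => k + i) (back_mono k) h.le σ)
        (vertex_face _ _ _ rfl σ) ((vertex_face _ _ _ h σ).trans hb)) ≫
    VQuiver.ι (freeQuiver V K k) (freeQuiver V K l) a (vertex K n k (front_le k l n h) σ) b⟩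

lemma gen_freeδ {k l n : ℕ} (h : k + l = n) {a b c : K.obj (op (SimplexCategory.mk 0))}
    (σ : K.obj (op (SimplexCategory.mk n))) (ha) (hb) (hc : vertex K n k (front_le k l n h) σ = c)
    (τ : K.obj (op (SimplexCategory.mk k))) (ρ : K.obj (op (SimplexCategory.mk l)))
    (hτ : face K k n (fun i => i) monotone_id (front_le k l n h) σ = τ)
    (hρ : face K l n (fun i => k + i) (back_mono k) h.le σ = ρ) (h₁) (h₂) (h₃) (h₄) :
    gen σ ha hb ≫ (freeδ V K k l n h).app a b = (λ_ (𝟙_ V)).inv ≫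
      (gen τ h₁ h₂ ⊗ₘ gen ρ h₃ h₄) ≫ VQuiver.ι (freeQuiver V K k) (freeQuiver V K l) a c b := by
  subst hc hτ hρ
  dsimp only [freeδ]
  exact gen_freeDesc _ σ ha hb

variable (V K) in
/-- The counit of `F̃(K)`. -/
noncomputable def freeη : freeQuiver V K 0 ⟶ VQuiver.unit V (K.obj (op (SimplexCategory.mk 0))) :=
  ⟨fun _ _ => freeDesc fun _ ha hb => VQuiver.ιUnit (ha.symm.trans hb)⟩

lemma gen_freeη {a b : K.obj (op (SimplexCategory.mk 0))} (σ : K.obj (op (SimplexCategory.mk 0)))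
    (ha) (hb) (h : a = b) :
    gen σ ha hb ≫ (freeη V K).app a b = VQuiver.ιUnit h := by
  dsimp only [freeη]
  exact gen_freeDesc _ σ ha hb

lemma freeδ_natural {k m p n l q : ℕ} {f : ℕ → ℕ} (hf : IsIntMap p n f) (hp : k + m = p)
    (hl : q + l = n) {f₁ f₂ : ℕ → ℕ} (h₁ : IsIntMap k q f₁) (h₂ : IsIntMap m l f₂)
    (e₁ : ∀ i ≤ k, f i = f₁ i) (e₂ : ∀ i ≤ m, f (k + i) = q + f₂ i) :
    freeMap V K p n f hf ≫ freeδ V K k m p hp =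
      freeδ V K q l n hl ≫ VQuiver.tmap (freeMap V K k q f₁ h₁) (freeMap V K m l f₂ h₂) := by
  ext a b
  refine free_ext fun σ ha hb => ?_
  have hk : f k = q := (e₁ k le_rfl).trans h₁.last
  have hc := vertex_face hf.mono hf.last.le (front_le k m p hp) hk σ
  have ha₁ := (vertex_face hf.mono hf.last.le (Nat.zero_le p) hf.zero σ).trans ha
  have hb₁ := (vertex_face hf.mono hf.last.le le_rfl hf.last σ).trans hb
  have hqn := front_le q l n hl
  -- the front and the back face of `σ`
  have ha₂ := (vertex_face (f := fun i => i) monotone_id hqn (Nat.zero_le q) rfl σ).trans ha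
  have hc₂ := vertex_face (f := fun i => i) monotone_id hqn le_rfl rfl σ
  have hc₃ := vertex_face (f := fun i => q + i) (back_mono q) hl.le (Nat.zero_le l) (Nat.add_zero q) σ
  have hb₃ := (vertex_face (f := fun i => q + i) (back_mono q) hl.le le_rfl hl σ).trans hb
  have ha₄ := (vertex_face h₁.mono h₁.last.le (Nat.zero_le k) h₁.zero _).trans ha₂
  have hc₄ := (vertex_face h₁.mono h₁.last.le le_rfl h₁.last _).trans hc₂
  have hc₅ := (vertex_face h₂.mono h₂.last.le (Nat.zero_le m) h₂.zero _).trans hc₃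
  have hb₅ := (vertex_face h₂.mono h₂.last.le le_rfl h₂.last _).trans hb₃
  have E₁ : face K k p (fun i => i) monotone_id (front_le k m p hp)
      (face K p n f hf.mono hf.last.le σ) = face K k q f₁ h₁.mono h₁.last.le
        (face K q n (fun i => i) monotone_id hqn σ) := by
    rw [face_face, face_face]
    exact face_congr _ _ _ _ e₁ σ
  have E₂ : face K m p (fun i => k + i) (back_mono k) hp.le
      (face K p n f hf.mono hf.last.le σ) = face K m l f₂ h₂.mono h₂.last.le
        (face K l n (fun i => q + i) (back_mono q) hl.le σ) := by
    rw [face_face, face_face]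
    exact face_congr _ _ _ _ e₂ σ
  refine Eq.trans (Category.assoc _ _ _).symm ?_
  refine (congrArg (· ≫ (freeδ V K k m p hp).app a b)
    (gen_freeMap hf σ ha hb _ rfl ha₁ hb₁)).trans ?_
  refine (gen_freeδ hp _ ha₁ hb₁ hc _ _ E₁ E₂ ha₄ hc₄ hc₅ hb₅).trans ?_
  refine Eq.trans ?_ (Category.assoc _ _ _)
  refine Eq.trans ?_ (congrArg (· ≫ (VQuiver.tmap (freeMap V K k q f₁ h₁)
    (freeMap V K m l f₂ h₂)).app a b) (gen_freeδ hl σ ha hb rfl _ _ rfl rfl ha₂ hc₂ hc₃ hb₃).symm)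
  simp only [Category.assoc]
  rw [VQuiver.ι_tmap, tensorHom_comp_tensorHom_assoc, gen_freeMap h₁ _ ha₂ hc₂ _ rfl ha₄ hc₄,
    gen_freeMap h₂ _ hc₃ hb₃ _ rfl hc₅ hb₅]

lemma tensor_glue_unit {A B C AB BC L : V} (c₁ : A ⊗ B ⟶ AB) (c₂ : AB ⊗ C ⟶ L)
    (c₃ : B ⊗ C ⟶ BC) (c₄ : A ⊗ BC ⟶ L) (key : c₁ ▷ C ≫ c₂ = (α_ A B C).hom ≫ A ◁ c₃ ≫ c₄)
    (x : 𝟙_ V ⟶ A) (z : 𝟙_ V ⟶ B) (y : 𝟙_ V ⟶ C) :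
    (λ_ (𝟙_ V)).inv ≫ (((λ_ (𝟙_ V)).inv ≫ (x ⊗ₘ z) ≫ c₁) ⊗ₘ y) ≫ c₂ =
      (λ_ (𝟙_ V)).inv ≫ (x ⊗ₘ ((λ_ (𝟙_ V)).inv ≫ (z ⊗ₘ y) ≫ c₃)) ≫ c₄ := by
  rw [unitors_inv_equal, tensor_glue_right c₁ c₂ c₃ c₄ key, unitors_inv_equal]

lemma freeδ_assoc (a b c ab bc n : ℕ) (h1 : ab + c = n) (h2 : a + b = ab) (h3 : a + bc = n)
    (h4 : b + c = bc) :
    freeδ V K ab c n h1 ≫ VQuiver.tmap (freeδ V K a b ab h2) (𝟙 (freeQuiver V K c)) ≫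
        VQuiver.assocHom (freeQuiver V K a) (freeQuiver V K b) (freeQuiver V K c) =
      freeδ V K a bc n h3 ≫ VQuiver.tmap (𝟙 (freeQuiver V K a)) (freeδ V K b c bc h4) := by
  ext x y
  refine free_ext fun σ hx hy => ?_
  have habn := front_le ab c n h1
  have han := front_le a bc n h3
  have haab := front_le a b ab h2
  have hb' : a + b ≤ n := by omega
  have hx₁ := (vertex_face (f := fun i => i) monotone_id habn (Nat.zero_le ab) rfl σ).trans hx
  have hc₁ := vertex_face (f := fun i => i) monotone_id habn le_rfl rfl σ
  have hc₂ := vertex_face (f := fun i => ab + i) (back_mono ab) h1.le (Nat.zero_le c)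
    (Nat.add_zero ab) σ
  have hy₂ := (vertex_face (f := fun i => ab + i) (back_mono ab) h1.le le_rfl h1 σ).trans hy
  have hx₃ := (vertex_face (f := fun i => i) monotone_id han (Nat.zero_le a) rfl σ).trans hx
  have hd₃ := vertex_face (f := fun i => i) monotone_id han le_rfl rfl σ
  have hd₄ := vertex_face (f := fun i => a + i) (back_mono a) hb' (Nat.zero_le b)
    (Nat.add_zero a) σ
  have hc₄ := vertex_face (f := fun i => a + i) (back_mono a) hb' le_rfl h2 σ
  have hd₅ := vertex_face (f := fun i => a + i) (back_mono a) h3.le (Nat.zero_le bc)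
    (Nat.add_zero a) σ
  have hy₅ := (vertex_face (f := fun i => a + i) (back_mono a) h3.le le_rfl h3 σ).trans hy
  have E₁ : face K a ab (fun i => i) monotone_id haab (face K ab n (fun i => i) monotone_id habn σ) =
      face K a n (fun i => i) monotone_id han σ := face_face _ _ _ _ σ
  have E₂ : face K b ab (fun i => a + i) (back_mono a) h2.le
      (face K ab n (fun i => i) monotone_id habn σ) = face K b n (fun i => a + i) (back_mono a) hb' σ :=
    face_face _ _ _ _ σ
  have E₃ : face K b bc (fun i => i) monotone_id (front_le b c bc h4)
      (face K bc n (fun i => a + i) (back_mono a) h3.le σ) =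
        face K b n (fun i => a + i) (back_mono a) hb' σ := face_face _ _ _ _ σ
  have E₄ : face K c bc (fun i => b + i) (back_mono b) h4.le
      (face K bc n (fun i => a + i) (back_mono a) h3.le σ) =
        face K c n (fun i => ab + i) (back_mono ab) h1.le σ :=
    (face_face _ _ _ _ σ).trans (face_congr _ _ _ _ (fun i _ => by omega) σ)
  have D₁ := vertex_face (f := fun i => i) monotone_id habn haab rfl σ
  have D₂ := vertex_face (f := fun i => a + i) (back_mono a) h3.le (front_le b c bc h4) h2 σ
  have L₁ := gen_freeδ (V := V) h1 σ hx hy rfl _ _ rfl rfl hx₁ hc₁ hc₂ hy₂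
  have L₂ := gen_freeδ (V := V) h2 _ hx₁ hc₁ D₁ _ _ E₁ E₂ hx₃ hd₃ hd₄ hc₄
  have R₁ := gen_freeδ (V := V) h3 σ hx hy rfl _ _ rfl rfl hx₃ hd₃ hd₅ hy₅
  have R₂ := gen_freeδ (V := V) h4 _ hd₅ hy₅ D₂ _ _ E₃ E₄ hd₄ hc₄ hc₂ hy₂
  rw [VQuiver.comp_app, VQuiver.comp_app, VQuiver.comp_app, ← Category.assoc, L₁, ← Category.assoc (gen σ hx hy),
    R₁]
  simp only [Category.assoc]
  rw [VQuiver.ι_tmap_assoc, VQuiver.ι_tmap, tensorHom_comp_tensorHom_assoc,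
    tensorHom_comp_tensorHom_assoc, L₂, R₂, VQuiver.id_app, VQuiver.id_app, Category.comp_id,
    Category.comp_id]
  exact tensor_glue_unit _ _ _ _ (VQuiver.ι_assocHom _ _ _ _ _ _ _) _ _ _

lemma freeδ_left (k : ℕ) (h : 0 + k = k) :
    freeδ V K 0 k k h ≫ VQuiver.tmap (freeη V K) (𝟙 (freeQuiver V K k)) =
      (λ_ (freeQuiver V K k)).inv := by
  ext a b
  refine free_ext fun σ ha hb => ?_
  have ha₁ := (vertex_face (f := fun i => i) monotone_id (Nat.zero_le k) le_rfl rfl σ).trans ha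
  have L := gen_freeδ (V := V) h σ ha hb ha _ _ rfl
    (face_id (back_mono 0) h.le (fun i _ => Nat.zero_add i) σ) ha₁ ha₁ ha hb
  rw [VQuiver.comp_app, ← Category.assoc, L]
  simp only [Category.assoc]
  rw [VQuiver.ι_tmap, tensorHom_comp_tensorHom_assoc, gen_freeη _ _ _ rfl, VQuiver.id_app,
    Category.comp_id, MonoidalCategory.tensorHom_def'_assoc]
  exact (leftUnitor_inv_naturality_assoc _ _).symm

lemma freeδ_right (k : ℕ) (h : k + 0 = k) :
    freeδ V K k 0 k h ≫ VQuiver.tmap (𝟙 (freeQuiver V K k)) (freeη V K) =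
      (ρ_ (freeQuiver V K k)).inv := by
  ext a b
  refine free_ext fun σ ha hb => ?_
  have hb₁ := (vertex_face (f := fun i => k + i) (back_mono k) h.le le_rfl h σ).trans hb
  have L := gen_freeδ (V := V) h σ ha hb hb _ _
    (face_id monotone_id le_rfl (fun i _ => rfl) σ) rfl ha hb hb₁ hb₁
  rw [VQuiver.comp_app, ← Category.assoc, L]
  simp only [Category.assoc]
  rw [VQuiver.ι_tmap, tensorHom_comp_tensorHom_assoc, gen_freeη _ _ _ rfl, VQuiver.id_app,
    Category.comp_id, MonoidalCategory.tensorHom_def_assoc, unitors_inv_equal]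
  exact (rightUnitor_inv_naturality_assoc _ _).symm

lemma freeMap_freeδ (m n k l : ℕ) (f : ℕ → ℕ) (hf : IsIntMap m n f) (h : ∀ i ≤ m, f i = i)
    (hm : k + l = m) (hn : k + l = n) :
    freeMap V K m n f hf ≫ freeδ V K k l m hm = freeδ V K k l n hn := by
  subst hm
  subst hn
  rw [freeMap_id hf h, Category.id_comp]

lemma freeδ_tensorHom {X X' Y Y' : FInt} (f : X ⟶ X') (g : Y ⟶ Y') :
    freeδ V K X'.len Y'.len _ rfl ≫ VQuiver.tmap (freeMap V K _ _ (FInt.raw f) (IsIntMap.raw f))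
        (freeMap V K _ _ (FInt.raw g) (IsIntMap.raw g)) =
      freeMap V K _ _ (FInt.raw (f ⊗ₘ g)) (IsIntMap.raw (f ⊗ₘ g)) ≫
        freeδ V K X.len Y.len _ rfl := by
  refine (freeδ_natural (IsIntMap.raw (f ⊗ₘ g)) rfl rfl (IsIntMap.raw f) (IsIntMap.raw g)
    (fun i hi => ?_) fun i _ => ?_).symm
  · rw [FInt.raw_tensorHom, show i - X.len = 0 by omega, FInt.raw_zero, Nat.add_zero]
  · rw [FInt.raw_tensorHom, FInt.raw_of_le f (by omega), Nat.add_sub_cancel_left]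

lemma freeMap_raw_id (X : FInt) :
    freeMap V K _ _ (FInt.raw (𝟙 X)) (IsIntMap.raw (𝟙 X)) = 𝟙 (freeQuiver V K X.len) :=
  freeMap_id _ fun _ hi => min_eq_left hi

/-- The colax monoidal structure of `F̃(K)`. -/
noncomputable instance : (freeNerve V K).OplaxMonoidal where
  η := freeη V K
  δ k l := freeδ V K k.unop.len l.unop.len _ rfl
  δ_natural_left {k k'} f l := by
    have := freeδ_tensorHom (V := V) (K := K) f.unop (𝟙 l.unop)
    rw [freeMap_raw_id, tensorHom_id] at this
    exact this
  δ_natural_right {k k'} l f := by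
    have := freeδ_tensorHom (V := V) (K := K) (𝟙 l.unop) f.unop
    rw [freeMap_raw_id, id_tensorHom] at this
    exact this
  oplax_associativity k l m := by
    refine (freeδ_assoc k.unop.len l.unop.len m.unop.len _ _ _ rfl rfl
      (Nat.add_assoc _ _ _).symm rfl).trans ?_
    refine Eq.trans ?_ (Category.assoc _ _ _)
    exact congrArg (· ≫ VQuiver.tmap (𝟙 (freeQuiver V K k.unop.len))
      (freeδ V K l.unop.len m.unop.len _ rfl)) (freeMap_freeδ _ _ _ _ _
        (IsIntMap.raw (α_ k.unop l.unop m.unop).inv) (fun _ hi => min_eq_left hi) rfl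
        (Nat.add_assoc _ _ _).symm).symm
  oplax_left_unitality k := by
    refine (freeδ_left k.unop.len (Nat.zero_add _)).symm.trans ?_
    refine Eq.trans ?_ (Category.assoc _ _ _)
    exact congrArg (· ≫ VQuiver.tmap (freeη V K) (𝟙 (freeQuiver V K k.unop.len)))
      (freeMap_freeδ _ _ _ _ _ (IsIntMap.raw (λ_ k.unop).hom) (fun _ hi => min_eq_left hi) rfl
        (Nat.zero_add _)).symm
  oplax_right_unitality k := by
    refine (freeδ_right k.unop.len (Nat.add_zero _)).symm.trans ?_
    refine Eq.trans ?_ (Category.assoc _ _ _)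
    exact congrArg (· ≫ VQuiver.tmap (𝟙 (freeQuiver V K k.unop.len)) (freeη V K))
      (freeMap_freeδ _ _ _ _ _ (IsIntMap.raw (ρ_ k.unop).hom) (fun _ hi => min_eq_left hi) rfl
        (Nat.add_zero _)).symm

lemma isIso_freeη : IsIso (freeη V K) := by
  let inv (a b : K.obj (op (SimplexCategory.mk 0))) :
      (VQuiver.unit V (K.obj (op (SimplexCategory.mk 0)))).obj a b ⟶ (freeQuiver V K 0).obj a b :=
    Sigma.desc fun e : PLift (a = b) => gen a (vertex_zero a _) ((vertex_zero a _).trans e.down)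
  have h (a b : K.obj (op (SimplexCategory.mk 0))) (e : a = b) :
      VQuiver.ιUnit e ≫ inv a b = gen a (vertex_zero a _) ((vertex_zero a _).trans e) :=
    Sigma.ι_desc (fun e : PLift (a = b) => (gen a (vertex_zero a _) ((vertex_zero a _).trans e.down) :
      𝟙_ V ⟶ (freeQuiver V K 0).obj a b)) ⟨e⟩
  refine ⟨⟨inv⟩, ?_, ?_⟩
  · ext a b
    refine free_ext fun σ ha hb => ?_
    refine (Category.assoc _ _ _).symm.trans ?_
    refine (congrArg (· ≫ inv a b) (gen_freeη σ ha hb (ha.symm.trans hb))).trans ?_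
    refine (h a b (ha.symm.trans hb)).trans ?_
    exact (gen_congr (ha.symm.trans (vertex_zero σ _)) _ _ _ _).trans (Category.comp_id _).symm
  · ext a b
    refine VQuiver.unit_ext fun e => ?_
    refine (Category.assoc _ _ _).symm.trans ?_
    refine (congrArg (· ≫ (freeη V K).app a b) (h a b e)).trans ?_
    exact (gen_freeη _ _ _ e).trans (Category.comp_id _).symm

instance : IsIso (Functor.OplaxMonoidal.η (freeNerve V K)) := isIso_freeη

variable (V K) in
/-- The free templicial object `F̃(K)` on a simplicial set `K`. -/
noncomputable def freeTemplicial : TemplicialObject V where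
  S := K.obj (op (SimplexCategory.mk 0))
  X := freeNerve V K

variable {L : SSet.{v}}

/-- The action of a simplicial map on vertices. -/
def vertexMap (φ : K ⟶ L) (a : K.obj (op (SimplexCategory.mk 0))) :
    L.obj (op (SimplexCategory.mk 0)) := φ.app _ a

/-- The action of a simplicial map on the quivers `F̃(K)_n`. -/
noncomputable def freeApp (φ : K ⟶ L) (n : ℕ) :
    freeQuiver V K n ⟶ (VQuiver.pull (vertexMap φ)).obj (freeQuiver V L n) :=
  ⟨fun _ _ => freeDesc fun σ ha hb => gen (K := L) (φ.app _ σ)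
    ((vertex_naturality φ _ σ).symm.trans (congrArg (vertexMap φ) ha))
    ((vertex_naturality φ _ σ).symm.trans (congrArg (vertexMap φ) hb))⟩

lemma gen_freeApp (φ : K ⟶ L) {n : ℕ} {a b : K.obj (op (SimplexCategory.mk 0))}
    (σ : K.obj (op (SimplexCategory.mk n))) (ha) (hb) (ha') (hb') :
    gen σ ha hb ≫ (freeApp (V := V) φ n).app a b =
      (gen (φ.app _ σ) ha' hb' : 𝟙_ V ⟶ (freeQuiver V L n).obj (vertexMap φ a) (vertexMap φ b)) := by
  dsimp only [freeApp]
  exact gen_freeDesc _ σ ha hb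

lemma freeApp_natural (φ : K ⟶ L) {m n : ℕ} {f : ℕ → ℕ} (h : IsIntMap m n f) :
    freeMap V K m n f h ≫ freeApp φ m =
      freeApp φ n ≫ (VQuiver.pull (vertexMap φ)).map (freeMap V L m n f h) := by
  ext a b
  refine free_ext fun σ ha hb => ?_
  have ha₁ := (vertex_face h.mono h.last.le (Nat.zero_le m) h.zero σ).trans ha
  have hb₁ := (vertex_face h.mono h.last.le le_rfl h.last σ).trans hb
  have ha₂ := (vertex_naturality φ _ σ).symm.trans (congrArg (vertexMap φ) ha)
  have hb₂ := (vertex_naturality φ _ σ).symm.trans (congrArg (vertexMap φ) hb)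
  have ha₃ := (vertex_naturality φ _ _).symm.trans (congrArg (vertexMap φ) ha₁)
  have hb₃ := (vertex_naturality φ _ _).symm.trans (congrArg (vertexMap φ) hb₁)
  refine Eq.trans (Category.assoc _ _ _).symm ?_
  refine (congrArg (· ≫ (freeApp φ m).app a b) (gen_freeMap h σ ha hb _ rfl ha₁ hb₁)).trans ?_
  refine (gen_freeApp φ _ ha₁ hb₁ ha₃ hb₃).trans ?_
  refine Eq.trans ?_ (Category.assoc _ _ _)
  refine Eq.trans ?_ (congrArg (· ≫ (freeMap V L m n f h).app (vertexMap φ a) (vertexMap φ b))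
    (gen_freeApp φ σ ha hb ha₂ hb₂).symm)
  exact (gen_freeMap h _ ha₂ hb₂ _ (face_naturality φ _ _ σ).symm ha₃ hb₃).symm

lemma freeApp_counit (φ : K ⟶ L) :
    freeApp φ 0 ≫ (VQuiver.pull (vertexMap φ)).map (freeη V L) =
      freeη V K ≫ VQuiver.pullε (vertexMap φ) := by
  ext a b
  refine free_ext fun σ ha hb => ?_
  have ha₂ := (vertex_naturality φ _ σ).symm.trans (congrArg (vertexMap φ) ha)
  have hb₂ := (vertex_naturality φ _ σ).symm.trans (congrArg (vertexMap φ) hb)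
  have e : a = b := ha.symm.trans hb
  refine Eq.trans (Category.assoc _ _ _).symm ?_
  refine (congrArg (· ≫ (freeη V L).app (vertexMap φ a) (vertexMap φ b))
    (gen_freeApp φ σ ha hb ha₂ hb₂)).trans ?_
  refine (gen_freeη _ ha₂ hb₂ (congrArg (vertexMap φ) e)).trans ?_
  refine Eq.trans ?_ (Category.assoc _ _ _)
  refine Eq.trans ?_ (congrArg (· ≫ (VQuiver.pullε (vertexMap φ)).app a b)
    (gen_freeη σ ha hb e).symm)
  exact (VQuiver.ιUnit_pullε (vertexMap φ) e).symm

lemma freeApp_comul (φ : K ⟶ L) (k l n : ℕ) (h : k + l = n) :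
    freeApp φ n ≫ (VQuiver.pull (vertexMap φ)).map (freeδ V L k l n h) =
      freeδ V K k l n h ≫ VQuiver.tmap (freeApp φ k) (freeApp φ l) ≫
        VQuiver.pullμ (vertexMap φ) (freeQuiver V L k) (freeQuiver V L l) := by
  ext a b
  refine free_ext fun σ ha hb => ?_
  have hkn := front_le k l n h
  have ha₂ := (vertex_naturality φ _ σ).symm.trans (congrArg (vertexMap φ) ha)
  have hb₂ := (vertex_naturality φ _ σ).symm.trans (congrArg (vertexMap φ) hb)
  have ha₃ := (vertex_face (f := fun i => i) monotone_id hkn (Nat.zero_le k) rfl σ).trans ha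
  have hc₃ := vertex_face (f := fun i => i) monotone_id hkn le_rfl rfl σ
  have hc₄ := vertex_face (f := fun i => k + i) (back_mono k) h.le (Nat.zero_le l)
    (Nat.add_zero k) σ
  have hb₄ := (vertex_face (f := fun i => k + i) (back_mono k) h.le le_rfl h σ).trans hb
  have ha₅ := (vertex_naturality φ _ _).symm.trans (congrArg (vertexMap φ) ha₃)
  have hc₅ := (vertex_naturality φ _ _).symm.trans (congrArg (vertexMap φ) hc₃)
  have hc₆ := (vertex_naturality φ _ _).symm.trans (congrArg (vertexMap φ) hc₄)
  have hb₆ := (vertex_naturality φ _ _).symm.trans (congrArg (vertexMap φ) hb₄)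
  have L₁ := gen_freeδ (V := V) h σ ha hb rfl _ _ rfl rfl ha₃ hc₃ hc₄ hb₄
  have R₁ := gen_freeδ (V := V) h (φ.app _ σ) ha₂ hb₂ (vertex_naturality φ hkn σ).symm _ _
    (face_naturality φ _ _ σ).symm (face_naturality φ _ _ σ).symm ha₅ hc₅ hc₆ hb₆
  refine Eq.trans (Category.assoc _ _ _).symm ?_
  refine (congrArg (· ≫ (freeδ V L k l n h).app (vertexMap φ a) (vertexMap φ b))
    (gen_freeApp φ σ ha hb ha₂ hb₂)).trans ?_
  refine R₁.trans ?_
  rw [VQuiver.comp_app, VQuiver.comp_app, ← Category.assoc (gen σ ha hb), L₁]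
  simp only [Category.assoc]
  refine congrArg (_ ≫ ·) ?_
  rw [VQuiver.ι_tmap_assoc, tensorHom_comp_tensorHom_assoc, VQuiver.ι_pullμ]
  exact congrArg₂ (fun x y => (x ⊗ₘ y) ≫ _) (gen_freeApp φ _ ha₃ hc₃ ha₅ hc₅).symm
    (gen_freeApp φ _ hc₄ hb₄ hc₆ hb₆).symm

variable (V) in
/-- The natural transformation underlying `F̃(φ)`. -/
noncomputable def freeNat (φ : K ⟶ L) :
    freeNerve V K ⟶ freeNerve V L ⋙ VQuiver.pull (vertexMap φ) where
  app n := freeApp φ n.unop.len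
  naturality _ _ f := freeApp_natural φ (IsIntMap.raw f.unop)

lemma isColaxMonoidal_freeNat (φ : K ⟶ L) :
    IsColaxMonoidal (VQuiver.pull (vertexMap φ)) (freeNat V φ) where
  counit := freeApp_counit φ
  comul k l := freeApp_comul φ k.unop.len l.unop.len _ rfl

variable (V) in
/-- The templicial morphism `F̃(φ)` for a simplicial map `φ`. -/
noncomputable def freeTemplicialMap (φ : K ⟶ L) : freeTemplicial V K ⟶ freeTemplicial V L :=
  TemplicialObject.Hom.mk (X := freeTemplicial V K) (Y := freeTemplicial V L) (vertexMap φ)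
    (freeNat V φ) (isColaxMonoidal_freeNat φ)

end Free

section Horns

variable {V : Type u} [Category.{v} V] [MonoidalCategory V] [BraidedCategory V] [MonoidalClosed V]
  [HasColimits V]

/-- The `i`-th vertex of the horn `Λ^{n+2}_j`. -/
def hornVertex (n : ℕ) (j i : Fin (n + 3)) :
    (SSet.horn.{v} (n + 2) j).toSSet.obj (op (SimplexCategory.mk 0)) :=
  ⟨SSet.stdSimplex.obj₀Equiv.symm i, by rw [SSet.horn_obj_zero]; trivial⟩

/-- The `i`-th vertex of the simplex `Δ^n`. -/
def simplexVertex (n : ℕ) (i : Fin (n + 1)) :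
    (SSet.stdSimplex.{v}.obj (SimplexCategory.mk n)).obj (op (SimplexCategory.mk 0)) :=
  SSet.stdSimplex.obj₀Equiv.symm i

variable (V) in
/-- The functor `F̃(Λ^n_j)_•(0, n)` on necklaces, with `n` replaced by `n + 2`. -/
noncomputable def hornNec (n : ℕ) (j : Fin (n + 3)) : Necᵒᵖ ⥤ V :=
  (freeTemplicial V (SSet.horn.{v} (n + 2) j).toSSet).nec (hornVertex n j 0)
    (hornVertex n j (Fin.last (n + 2)))

variable (V) in
/-- The functor `F̃(Δ^n)_•(0, n)` on necklaces. -/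
noncomputable def simplexNec (n : ℕ) : Necᵒᵖ ⥤ V :=
  (freeTemplicial V (SSet.stdSimplex.{v}.obj (SimplexCategory.mk n))).nec (simplexVertex n 0)
    (simplexVertex n (Fin.last n))

variable (V) in
/-- The morphism `F̃(Λ^n_j)_•(0, n) ⟶ F̃(Δ^n)_•(0, n)` induced by the inclusion of the horn. -/
noncomputable def hornInclusion (n : ℕ) (j : Fin (n + 3)) : hornNec V n j ⟶ simplexNec V (n + 2) :=
  TemplicialObject.necHom (freeTemplicialMap V (SSet.horn.{v} (n + 2) j).ι) (hornVertex n j 0)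
    (hornVertex n j (Fin.last (n + 2)))

/-- A functor on necklaces lifts inner horns uniquely if every morphism from the inner horn
`F̃(Λ^n_j)_•(0, n)`, for `0 < j < n`, extends uniquely to `F̃(Δ^n)_•(0, n)`. As there is such a `j`
only for `n ≥ 2`, `n + 2` stands for `n`. -/
def LiftsInnerHornsUniquely (Y : Necᵒᵖ ⥤ V) : Prop :=
  ∀ (n : ℕ) (j : Fin (n + 3)), 0 < j → j < Fin.last (n + 2) →
    ∀ g : hornNec V n j ⟶ Y, ∃! h : simplexNec V (n + 2) ⟶ Y, hornInclusion V n j ≫ h = g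

end Horns

/-! Both statements are compared with the Segal condition `IsSegal`: all comultiplications X_n ⟶ X_k
⊗ X_l are isomorphisms.

Statement (1) is equivalent to it without any hypothesis on U. The comultiplications of a nerve are
invertible, and this passes along isomorphisms of templicial objects because their vertex maps are
bijective (`isSegal_of_iso`). Conversely, under the Segal condition X_1 is a monoid with
multiplication X_1 ⊗ X_1 ≅ X_2 ⟶ X_1, and the iterated comultiplications X_n ⟶ X_1 ⊗ ... ⊗ X_1 form
a monoidal natural isomorphism from X to the nerve of X_1 (`exists_iso_templicialNerve`).

For statement (2), the value of F̃(K)_•(a, b) at a necklace T is a coproduct of copies of I indexed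
by the chains of simplices of shape T from a to b. A morphism to X_•(p, q) is therefore a family of
elements I ⟶ X_T(p, q), one for each chain, compatible with restriction. In Δ^n every chain from 0
to n is a restriction of the top simplex, so a morphism out of F̃(Δ^n)_•(0, n) is a single element
of X_n(p, q). In the inner horn Λ^n_j a chain from 0 to n either has a joint at an interior vertex
k, and is a restriction of Δ^k ∨ Δ^{n-k}, or misses an interior vertex i ≠ j, and is a restriction
of the i-th face. If the Segal condition holds in dimensions below n, the values on all of these are
determined by the value on Δ^j ∨ Δ^{n-j}, by passing to common restrictions (`hornNec_hom_ext`).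
Extending a morphism from the horn to the simplex then means finding an element of X_n(p, q) with
prescribed image under the comultiplication for (j, n-j), so the Segal condition gives unique
lifting (`liftsInnerHornsUniquely_of_isSegal`).

The converse is an induction on n. If the Segal condition holds below n, then for j = 1 every
element of (X_1 ⊗ X_{n-1})(p, q) does come from a morphism out of the horn (`exists_hornNec_hom`).
Unique lifting thus says that U sends the comultiplication X_n(p, q) ⟶ (X_1 ⊗ X_{n-1})(p, q) to a
bijection (`bijective_comp_nmap`). When U is conservative this comultiplication is an isomorphism,
and coassociativity yields the other ones in dimension n (`segalBelow_of_one`). -/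

/-! ### The Segal condition and the monoid structure on X_1. -/

section Segal

variable {W : Type*} [Category W] [MonoidalCategory W] (X : FIntᵒᵖ ⥤ W) [X.OplaxMonoidal]

/-- All comultiplications out of `X_m` with `m < n` are isomorphisms. -/
def SegalBelow (n : ℕ) : Prop :=
  ∀ (a b m : ℕ) (h : a + b = m), m < n → IsIso (cellδ X a b m h)

/-- All comultiplications of `X` are isomorphisms. -/
def IsSegal : Prop := ∀ (a b m : ℕ) (h : a + b = m), IsIso (cellδ X a b m h)

section Unital

variable [IsIso (cellη X)]

/-- By counitality this comultiplication, followed by the invertible counit on the left factor, is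
an inverse unitor. -/
lemma isIso_cellδ_zero_left (n : ℕ) (h : 0 + n = n) : IsIso (cellδ X 0 n n h) := by
  have := cellδ_left X n h
  exact IsIso.of_isIso_fac_right this

lemma isIso_cellδ_zero_right (n : ℕ) (h : n + 0 = n) : IsIso (cellδ X n 0 n h) := by
  have := cellδ_right X n h
  exact IsIso.of_isIso_fac_right this

/-- It suffices to split off one-dimensional simplices. -/
lemma segalBelow_of_one (n : ℕ) (H : ∀ (b m : ℕ) (h : 1 + b = m), m < n → IsIso (cellδ X 1 b m h)) :
    SegalBelow X n := by
  intro a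
  induction a with
  | zero =>
    intro b m h hm
    obtain rfl : b = m := by omega
    exact isIso_cellδ_zero_left X b h
  | succ a ih =>
    intro b m h hm
    -- Coassociativity cuts off the first edge: of the four comultiplications in the square for 1 +
    -- a + b, three are invertible by `H` and induction, hence so is the fourth.
    have e := cellδ_assoc X 1 a b (a + 1) (a + b) m h (Nat.add_comm 1 a) (by omega) rfl
    have := H a (a + 1) (by omega) (by omega)
    have := H (a + b) m (by omega) (by omega)
    have := ih b (a + b) rfl (by omega)
    have : IsIso (cellδ X (a + 1) b m h ≫ cellδ X 1 a (a + 1) (Nat.add_comm 1 a) ▷ cell X b) :=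
      e ▸ inferInstance
    exact IsIso.of_isIso_comp_right _ (cellδ X 1 a (a + 1) (Nat.add_comm 1 a) ▷ cell X b)

end Unital

/-- The map `[1] ⟶ [q]` of finite intervals. -/
def edgeMap (q i : ℕ) : ℕ := min i 1 * q

lemma isIntMap_edgeMap (q : ℕ) : IsIntMap 1 q (edgeMap q) where
  mono := by intro i j hij; exact Nat.mul_le_mul_right _ (by omega)
  zero := by simp [edgeMap]
  last := by simp [edgeMap]

/-- The map `X_q ⟶ X_1`. -/
def cellEdge (q : ℕ) : cell X q ⟶ cell X 1 := cellMap X 1 q (edgeMap q) (isIntMap_edgeMap q)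

/-- Preservation of the endpoints leaves only one map from [1] to [q]. -/
lemma cellMap_one_eq_cellEdge {q : ℕ} {f : ℕ → ℕ} (hf : IsIntMap 1 q f) :
    cellMap X 1 q f hf = cellEdge X q :=
  cellMap_congr X _ _ fun i hi => by
    interval_cases i
    · rw [hf.zero, (isIntMap_edgeMap q).zero]
    · rw [hf.last, (isIntMap_edgeMap q).last]

lemma cellEdge_one : cellEdge X 1 = 𝟙 _ :=
  cellMap_id X _ fun i hi => by simp [edgeMap, hi]

/-- The iterated comultiplication `X_n ⟶ X_1 ⊗ ... ⊗ X_1`. -/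
def spineMap : ∀ n : ℕ, cell X n ⟶ tpow (cell X 1) n
  | 0 => cellη X
  | n + 1 => cellδ X 1 n (n + 1) (Nat.add_comm 1 n) ≫ cell X 1 ◁ spineMap n

lemma spineMap_succ (n : ℕ) : spineMap X (n + 1) =
    cellδ X 1 n (n + 1) (Nat.add_comm 1 n) ≫ cell X 1 ◁ spineMap X n := rfl

/-- Iterated coassociativity. This is the compatibility of the spine maps with the comultiplications
of X and of the nerve. -/
lemma spineMap_tsplit (k l n : ℕ) (h : k + l = n) :
    spineMap X n ≫ tsplit (cell X 1) k l n h =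
      cellδ X k l n h ≫ (spineMap X k ⊗ₘ spineMap X l) := by
  induction k generalizing n with
  | zero =>
    obtain rfl : l = n := by omega
    rw [tsplit_zero, MonoidalCategory.tensorHom_def]
    change _ = _ ≫ cellη X ▷ _ ≫ _
    rw [← Category.assoc (cellδ X 0 l l h), cellδ_left]
    exact leftUnitor_inv_naturality _
  | succ k ih =>
    obtain ⟨n, rfl⟩ : ∃ r, n = r + 1 := ⟨n - 1, by omega⟩
    have e := cellδ_assoc X 1 k l (k + 1) n (n + 1) h (by omega) (by omega) (by omega)
    rw [tsplit_succ, spineMap_succ, spineMap_succ, ← MonoidalCategory.whiskerRight_comp_tensorHom,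
      ← Category.assoc (cellδ X (k + 1) l (n + 1) h), e]
    simp only [Category.assoc]
    rw [← whiskerLeft_comp_assoc, ih n (by omega), ← id_tensorHom (cell X 1) (spineMap X k),
      ← associator_inv_naturality, id_tensorHom, whiskerLeft_comp_assoc]

variable {X}

section

variable (hX : IsSegal X)

/-- The multiplication `X_1 ⊗ X_1 ≅ X_2 ⟶ X_1`. -/
noncomputable def segalMul : cell X 1 ⊗ cell X 1 ⟶ cell X 1 :=
  haveI := hX 1 1 2 rfl
  inv (cellδ X 1 1 2 rfl) ≫ cellEdge X 2

/-- The long edge of a simplex is the product of the long edges of its front and back faces. For k =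
l = 1 this is the definition of the product; the general case follows by restricting to a 2-simplex.
-/
lemma cellδ_segalMul (k l n : ℕ) (h : k + l = n) :
    cellδ X k l n h ≫ (cellEdge X k ⊗ₘ cellEdge X l) ≫ segalMul hX = cellEdge X n := by
  -- The map [2] ⟶ [n] with values 0, k, n.
  have hf : IsIntMap 2 n (fun i => min i 1 * k + min (i - 1) 1 * l) :=
    { mono := by
        intro i j hij
        exact Nat.add_le_add (Nat.mul_le_mul_right _ (by omega)) (Nat.mul_le_mul_right _ (by omega))
      zero := by simp
      last := by simp [h] }
  have e := cellδ_natural X (k := 1) (m := 1) (q := k) (l := l) hf rfl (by simp) h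
  rw [cellMap_one_eq_cellEdge, cellMap_one_eq_cellEdge] at e
  have := hX 1 1 2 rfl
  rw [← Category.assoc, ← e, segalMul, Category.assoc, IsIso.hom_inv_id_assoc, cellEdge,
    cellMap_comp, cellMap_one_eq_cellEdge]

lemma cellδ_segalMul_left (l n : ℕ) (h : 1 + l = n) :
    cellδ X 1 l n h ≫ cell X 1 ◁ cellEdge X l ≫ segalMul hX = cellEdge X n := by
  rw [← cellδ_segalMul hX 1 l n h, cellEdge_one, id_tensorHom]

lemma cellδ_segalMul_right (l n : ℕ) (h : l + 1 = n) :
    cellδ X l 1 n h ≫ cellEdge X l ▷ cell X 1 ≫ segalMul hX = cellEdge X n := by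
  rw [← cellδ_segalMul hX l 1 n h, cellEdge_one, tensorHom_id]

variable [IsIso (cellη X)]

/-- The monoid `X_1` of a functor whose comultiplications are isomorphisms. -/
noncomputable abbrev segalMon : MonObj (cell X 1) where
  one := inv (cellη X) ≫ cellEdge X 0
  mul := segalMul hX
  one_mul := by
    have := hX 0 1 1 rfl
    have e := cellδ_segalMul_right hX 0 1 rfl
    have e' := cellδ_left X 1 rfl
    rw [cellEdge_one] at e
    -- Written through the comultiplication for 0 + 1, the inverse unitor contains the counit, which
    -- cancels against its inverse in the unit of the monoid; what remains is the long edge of X_1,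
    -- the identity.
    rw [← cancel_epi (λ_ (cell X 1)).inv, Iso.inv_hom_id, ← e', ← e, Category.assoc,
      ← comp_whiskerRight_assoc, IsIso.hom_inv_id_assoc]
  mul_one := by
    have := hX 1 0 1 rfl
    have e := cellδ_segalMul_left hX 0 1 rfl
    have e' := cellδ_right X 1 rfl
    rw [cellEdge_one] at e
    rw [← cancel_epi (ρ_ (cell X 1)).inv, Iso.inv_hom_id, ← e', ← e, Category.assoc,
      ← whiskerLeft_comp_assoc, IsIso.hom_inv_id_assoc]
  mul_assoc := by
    have := hX 2 1 3 rfl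
    have := hX 1 1 2 rfl
    have h2 : cellδ X 1 1 2 rfl ≫ segalMul hX = cellEdge X 2 := by
      have := cellδ_segalMul hX 1 1 2 rfl
      rwa [cellEdge_one, id_tensorHom_id, Category.id_comp] at this
    -- Associativity is tested on X_3, which is isomorphic to the triple tensor product; both
    -- products become the long edge X_3 ⟶ X_1.
    rw [← cancel_epi (cellδ X 2 1 3 rfl ≫ cellδ X 1 1 2 rfl ▷ _)]
    have e := cellδ_assoc X 1 1 1 2 2 3 rfl rfl rfl rfl
    rw [Category.assoc, ← comp_whiskerRight_assoc, h2, cellδ_segalMul_right, e]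
    simp only [Category.assoc, Iso.inv_hom_id_assoc]
    rw [← whiskerLeft_comp_assoc, h2, cellδ_segalMul_left]

lemma spineMap_tmul (n : ℕ) :
    letI := segalMon hX
    spineMap X n ≫ tmul (cell X 1) n = cellEdge X n := by
  let := segalMon hX
  induction n with
  | zero => exact IsIso.hom_inv_id_assoc (cellη X) _
  | succ n ih =>
    rw [spineMap_succ, tmul, Category.assoc, ← whiskerLeft_comp_assoc, ih]
    exact cellδ_segalMul_left hX n (n + 1) _

/-- Naturality of the spine maps as a transformation from X to the nerve of X_1. Cutting at `f 1`
separates the first tensor factor, where both sides give the long edge, from the part handled by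
induction. -/
lemma cellMap_spineMap (m n : ℕ) (f : ℕ → ℕ) (hf : IsIntMap m n f) :
    letI := segalMon hX
    cellMap X m n f hf ≫ spineMap X m = spineMap X n ≫ powMap (cell X 1) m n f hf := by
  let := segalMon hX
  induction m generalizing n f with
  | zero =>
    obtain rfl : 0 = n := by rw [← hf.last, hf.zero]
    rw [powMap_zero, Category.comp_id, cellMap_id X hf, Category.id_comp]
    intro i hi
    obtain rfl : i = 0 := by omega
    exact hf.zero
  | succ m ih =>
    obtain ⟨l, hl⟩ : ∃ l, f 1 + l = n := ⟨n - f 1, Nat.add_sub_cancel' (hf.le (by omega) rfl)⟩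
    rw [powMap_succ _ m n (f 1) l f hf rfl hl, spineMap_succ, ← Category.assoc,
      cellδ_natural X hf (Nat.add_comm 1 m) rfl hl, ← Category.assoc (spineMap X n),
      spineMap_tsplit, Category.assoc, Category.assoc, tensorHom_comp_tensorHom, ← ih,
      spineMap_tmul, cellMap_one_eq_cellEdge, ← id_tensorHom, tensorHom_comp_tensorHom,
      Category.comp_id]

end

lemma isIso_spineMap [IsIso (cellη X)] (hX : IsSegal X) (n : ℕ) : IsIso (spineMap X n) := by
  induction n with
  | zero => exact inferInstanceAs (IsIso (cellη X))
  | succ n ih =>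
    have := hX 1 n (n + 1) (Nat.add_comm 1 n)
    rw [spineMap_succ]
    infer_instance

end Segal

/-! ### Nerves are, up to isomorphism, the templicial objects that satisfy the Segal condition. -/

lemma isIso_tsplit {W : Type*} [Category W] [MonoidalCategory W] (C : W) (k l n : ℕ)
    (h : k + l = n) : IsIso (tsplit C k l n h) := by
  induction k generalizing n with
  | zero =>
    obtain rfl : l = n := by omega
    rw [tsplit_zero]
    infer_instance
  | succ k ih =>
    obtain ⟨n, rfl⟩ : ∃ r, n = r + 1 := ⟨n - 1, by omega⟩
    have := ih n (by omega)
    rw [tsplit_succ]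
    infer_instance

/-- The middle morphism is a split epimorphism by the first hypothesis and a monomorphism by the
second, hence invertible. -/
lemma isIso_of_two_of_six {W : Type*} [Category W] {A B C D : W} {α : A ⟶ B} {β : B ⟶ C}
    {γ : C ⟶ D} (h₁ : IsIso (α ≫ β)) (h₂ : IsIso (β ≫ γ)) : IsIso α := by
  have : IsSplitEpi β := ⟨⟨⟨inv (α ≫ β) ≫ α, by simp⟩⟩⟩
  have : Mono β := mono_of_mono β γ
  have : IsIso β := isIso_of_mono_of_isSplitEpi β
  exact IsIso.of_isIso_comp_right α β

namespace VQuiver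

variable {V : Type u} [Category.{v} V] {S T : Type v}

lemma isIso_of_app {Q P : VQuiver V S} {f : Q ⟶ P} (h : ∀ a b, IsIso (f.app a b)) : IsIso f :=
  ⟨⟨fun a b => inv (f.app a b)⟩, by ext a b; simp, by ext a b; simp⟩

lemma isIso_app {Q P : VQuiver V S} (f : Q ⟶ P) [IsIso f] (a b : S) : IsIso (f.app a b) :=
  inferInstanceAs (IsIso ((eval a b).map f))

variable [MonoidalCategory V] [BraidedCategory V] [MonoidalClosed V] [HasColimits V]

/-- On each pair of vertices the map reindexes the coproduct over intermediate vertices along the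
bijection `f`. -/
lemma isIso_pullμ {f : S → T} (hf : Function.Bijective f) (Q P : VQuiver V T) :
    IsIso (pullμ f Q P) := by
  refine isIso_of_app fun a b => ?_
  let F (c : T) : V := Q.obj (f a) c ⊗ P.obj c (f b)
  have : (pullμ f Q P).app a b = (Sigma.reindex (Equiv.ofBijective f hf) F).hom :=
    Sigma.hom_ext _ _ fun c => (ι_pullμ f Q P a c b).trans
      (Sigma.ι_reindex_hom (Equiv.ofBijective f hf) F c).symm
  rw [this]
  exact Iso.isIso_hom _

end VQuiver

namespace TemplicialObject

variable {V : Type u} [Category.{v} V] [MonoidalCategory V] [BraidedCategory V] [MonoidalClosed V]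
  [HasColimits V]

section

variable {S : Type v} {X Y : FIntᵒᵖ ⥤ VQuiver V S} [X.OplaxMonoidal] [Y.OplaxMonoidal]
  [IsIso (Functor.OplaxMonoidal.η X)] [IsIso (Functor.OplaxMonoidal.η Y)]

/-- Base change along the identity has identities as lax structure maps, so the condition reduces to
ordinary monoidality. -/
lemma isColaxMonoidal_pull_id (α : X ⟶ Y)
    (counit : α.app (𝟙_ FIntᵒᵖ) ≫ Functor.OplaxMonoidal.η Y = Functor.OplaxMonoidal.η X)
    (comul : ∀ k l : FIntᵒᵖ, α.app (k ⊗ l) ≫ Functor.OplaxMonoidal.δ Y k l =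
      Functor.OplaxMonoidal.δ X k l ≫ (α.app k ⊗ₘ α.app l)) :
    IsColaxMonoidal (X := X) (Y := Y) (VQuiver.pull id) α where
  counit := by
    ext a b
    refine (congrArg (fun x : VQuiver.Hom _ _ => x.app a b) counit).trans ?_
    refine (Category.comp_id _).symm.trans ?_
    exact congrArg (_ ≫ ·) (VQuiver.pullε_id a b).symm
  comul k l := by
    ext a b
    refine (congrArg (fun x : VQuiver.Hom _ _ => x.app a b) (comul k l)).trans ?_
    refine congrArg ((Functor.OplaxMonoidal.δ X k l).app a b ≫ ·) ?_
    refine (Category.comp_id _).symm.trans ?_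
    exact congrArg (_ ≫ ·) (VQuiver.pullμ_id _ _ a b).symm

/-- A monoidal natural isomorphism gives an isomorphism of templicial objects. -/
def isoOfNatIso (e : X ≅ Y)
    (counit : e.hom.app (𝟙_ FIntᵒᵖ) ≫ Functor.OplaxMonoidal.η Y = Functor.OplaxMonoidal.η X)
    (comul : ∀ k l : FIntᵒᵖ, e.hom.app (k ⊗ l) ≫ Functor.OplaxMonoidal.δ Y k l =
      Functor.OplaxMonoidal.δ X k l ≫ (e.hom.app k ⊗ₘ e.hom.app l)) :
    (⟨S, X⟩ : TemplicialObject V) ≅ ⟨S, Y⟩ where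
  hom := Hom.mk (X := ⟨S, X⟩) (Y := ⟨S, Y⟩) id e.hom (isColaxMonoidal_pull_id e.hom counit comul)
  inv := Hom.mk (X := ⟨S, Y⟩) (Y := ⟨S, X⟩) id e.inv (isColaxMonoidal_pull_id e.inv
    (by rw [← counit, Iso.inv_hom_id_app_assoc]) fun k l => by
      rw [← cancel_epi (e.hom.app (k ⊗ l)), Iso.hom_inv_id_app_assoc, ← Category.assoc, comul,
        Category.assoc, tensorHom_comp_tensorHom, Iso.hom_inv_id_app, Iso.hom_inv_id_app,
        id_tensorHom_id, Category.comp_id])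
  hom_inv_id := Hom.mk_congr _ _ fun n a b =>
    congrArg (fun x : VQuiver.Hom _ _ => x.app a b) (e.hom_inv_id_app n)
  inv_hom_id := Hom.mk_congr _ _ fun n a b =>
    congrArg (fun x : VQuiver.Hom _ _ => x.app a b) (e.inv_hom_id_app n)

end

/-- The isomorphism is given by the spine maps, over the identity on vertices. -/
lemma exists_iso_templicialNerve (X : TemplicialObject V) (hX : IsSegal X.X) :
    ∃ C : SmallVCat V, Nonempty (X ≅ templicialNerve C) := by
  let := segalMon hX
  let e : X.X ≅ monNerve (cell X.X 1) := NatIso.ofComponents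
    (fun n => @asIso (VQuiver V X.S) _ _ _ (spineMap X.X n.unop.len) (isIso_spineMap hX _)) fun {m n} f => by
      have h := cellMap_spineMap hX _ _ _ (IsIntMap.raw f.unop)
      rw [← map_eq_cellMap] at h
      exact h
  refine ⟨⟨X.S, cell X.X 1⟩, ⟨isoOfNatIso e ?_ fun k l => ?_⟩⟩
  · exact Category.comp_id (cellη X.X)
  · have h := spineMap_tsplit X.X k.unop.len l.unop.len _ rfl
    rw [cellδ_rfl] at h
    exact h

lemma isSegal_templicialNerve (C : SmallVCat V) : IsSegal (templicialNerve C).X := by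
  intro k l n h
  subst h
  rw [cellδ_rfl]
  exact isIso_tsplit C.C k l _ rfl

/-- The two composites of an isomorphism with its inverse are identities only up to an equality that
also involves the vertex maps. With a variable endomorphism the equality can be substituted, and no
transport of components is needed. -/
lemma isIso_comp_app {X : TemplicialObject V} {θ : Hom X X} (h : θ = Hom.id X) (n : FIntᵒᵖ)
    (a b : X.S) : IsIso ((θ.α.app n).app a b) := by
  subst h
  exact inferInstanceAs (IsIso (𝟙 _))

lemma isIso_hom_app {X Y : TemplicialObject V} (φ : X ≅ Y) (n : FIntᵒᵖ) :
    IsIso ((Hom.α φ.hom).app n) := by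
  refine VQuiver.isIso_of_app fun a b => ?_
  -- The three consecutive morphisms are the components of `φ.hom`, `φ.inv` and `φ.hom` at (a, b)
  -- and at its successive images.
  exact isIso_of_two_of_six (isIso_comp_app φ.hom_inv_id n a b)
    (isIso_comp_app φ.inv_hom_id n (Hom.f φ.hom a) (Hom.f φ.hom b))

lemma bijective_hom_f {X Y : TemplicialObject V} (φ : X ≅ Y) : Function.Bijective (Hom.f φ.hom) :=
  Function.bijective_iff_has_inverse.mpr ⟨Hom.f φ.inv,
    fun a => congrFun (congrArg Hom.f φ.hom_inv_id) a,
    fun a => congrFun (congrArg Hom.f φ.inv_hom_id) a⟩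

/-- In the square comparing the comultiplications of X and Y all other sides are invertible,
including the lax structure map of base change along the bijection on vertices. -/
lemma isSegal_of_iso {X Y : TemplicialObject V} (φ : X ≅ Y) (hY : IsSegal Y.X) : IsSegal X.X := by
  intro k l n h
  have e := cellδ_cellApp (VQuiver.pull (Hom.f φ.hom)) (Hom.colax φ.hom) k l n h
  have i (m : ℕ) : IsIso (cellApp (VQuiver.pull (Hom.f φ.hom)) (Hom.α φ.hom) m) :=
    isIso_hom_app φ (op ⟨m⟩)
  have := i k
  have := i l
  have := i n
  have := hY k l n h
  have : IsIso (Functor.LaxMonoidal.μ (VQuiver.pull (Hom.f φ.hom)) (cell Y.X k) (cell Y.X l)) :=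
    VQuiver.isIso_pullμ (bijective_hom_f φ) _ _
  exact IsIso.of_isIso_fac_right e.symm

end TemplicialObject

/-! ### Chains of simplices as generators of F̃(K)_•(a, b). -/

section Chains

/-- The vertices of a simplicial set. -/
abbrev Vert (K : SSet.{v}) : Type v := K.obj (op (SimplexCategory.mk 0))

/-- A chain of simplices from `a` to `b`, with dimensions given by a list, such that the last vertex
of each simplex is the first vertex of the next one. -/
inductive Chain (K : SSet.{v}) : List ℕ → Vert K → Vert K → Type v
  -- The equality is kept as data to match the coproduct over proofs of `a = b` that defines the
  -- unit quiver.
  | nil {a b : Vert K} (h : a = b) : Chain K [] a b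
  | cons {n : ℕ} {L : List ℕ} {a b c : Vert K} (σ : K.obj (op (SimplexCategory.mk n)))
      (ha : vertex K n 0 (Nat.zero_le n) σ = a) (hc : vertex K n n le_rfl σ = c)
      (γ : Chain K L c b) : Chain K (n :: L) a b

namespace Chain

variable {K : SSet.{v}}

/-- The vertices of a chain, in order. -/
def vert : ∀ {L : List ℕ} {a b : Vert K}, Chain K L a b → ℕ → Vert K
  -- Indices beyond the end of a chain thus give its last vertex.
  | _, a, _, nil _, _ => a
  | _, _, _, cons (n := n) σ _ _ γ, t => if h : t ≤ n then vertex K n t h σ else γ.vert (t - n)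

lemma vert_cons_of_le {n : ℕ} {L : List ℕ} {a b c : Vert K} (σ : K.obj (op (SimplexCategory.mk n)))
    (ha) (hc) (γ : Chain K L c b) {t : ℕ} (h : t ≤ n) :
    (cons (a := a) σ ha hc γ).vert t = vertex K n t h σ := dif_pos h

lemma vert_zero {L : List ℕ} {a b : Vert K} (γ : Chain K L a b) : γ.vert 0 = a := by
  cases γ with
  | nil h => rfl
  | cons σ ha hc γ => exact (vert_cons_of_le σ ha hc γ (Nat.zero_le _)).trans ha

lemma vert_cons_add {n : ℕ} {L : List ℕ} {a b c : Vert K} (σ : K.obj (op (SimplexCategory.mk n)))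
    (ha) (hc) (γ : Chain K L c b) (t : ℕ) :
    (cons (a := a) σ ha hc γ).vert (n + t) = γ.vert t := by
  rcases Nat.eq_zero_or_pos t with rfl | h
  · rw [vert_zero]
    exact (vert_cons_of_le σ ha hc γ le_rfl).trans hc
  · refine (dif_neg (by omega)).trans ?_
    rw [Nat.add_sub_cancel_left]

lemma vert_sum {L : List ℕ} {a b : Vert K} (γ : Chain K L a b) : γ.vert L.sum = b := by
  induction γ with
  | nil h => exact h
  | cons σ ha hc γ ih => rw [List.sum_cons, vert_cons_add, ih]

/-- Concatenation of chains. -/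
def append : ∀ {A B : List ℕ} {a b c : Vert K}, Chain K A a c → Chain K B c b → Chain K (A ++ B) a b
  | _, _, _, _, _, nil h, γ' => h ▸ γ'
  | _, _, _, _, _, cons σ ha hc γ, γ' => cons σ ha hc (γ.append γ')

lemma vert_append_of_le {A B : List ℕ} {a b c : Vert K} (γ : Chain K A a c) (γ' : Chain K B c b)
    {t : ℕ} (h : t ≤ A.sum) : (γ.append γ').vert t = γ.vert t := by
  induction γ generalizing t with
  | nil e =>
    subst e
    obtain rfl : t = 0 := by simpa using h
    rw [vert_zero, vert_zero]
  | @cons n L a b c σ ha hc γ ih =>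
    rcases le_total t n with h' | h'
    · rw [append, vert_cons_of_le _ _ _ _ h', vert_cons_of_le _ _ _ _ h']
    · obtain ⟨t, rfl⟩ := Nat.exists_eq_add_of_le h'
      rw [append, vert_cons_add, vert_cons_add, ih]
      rw [List.sum_cons] at h
      omega

lemma vert_append_add {A B : List ℕ} {a b c : Vert K} (γ : Chain K A a c) (γ' : Chain K B c b)
    (t : ℕ) : (γ.append γ').vert (A.sum + t) = γ'.vert t := by
  induction γ with
  | nil e =>
    subst e
    rw [append, List.sum_nil, Nat.zero_add]
  | cons σ ha hc γ ih => rw [append, List.sum_cons, Nat.add_assoc, vert_cons_add, ih]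

end Chain

variable {V : Type u} [Category.{v} V] [MonoidalCategory V] [BraidedCategory V] [MonoidalClosed V]
  [HasColimits V] {K : SSet.{v}}

instance : IsIso (cellη (freeNerve V K)) := isIso_freeη

variable (V) in
/-- The copy of the unit in `F(K)_T(a, b)` of a chain. -/
noncomputable def genChain : ∀ {L : List ℕ} {a b : Vert K}, Chain K L a b →
    (𝟙_ V ⟶ (beadTensor (freeNerve V K) L).obj a b)
  | _, _, _, .nil h => VQuiver.ιUnit h
  | _, a, b, .cons (n := n) (L := L) (c := c) σ ha hc γ =>
    (λ_ (𝟙_ V)).inv ≫ (gen σ ha hc ⊗ₘ genChain γ) ≫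
      VQuiver.ι (freeQuiver V K n) (beadTensor (freeNerve V K) L) a c b

lemma genChain_cons {n : ℕ} {L : List ℕ} {a b c : Vert K} (σ : K.obj (op (SimplexCategory.mk n)))
    (ha : vertex K n 0 (Nat.zero_le n) σ = a) (hc : vertex K n n le_rfl σ = c)
    (γ : Chain K L c b) : genChain V (.cons σ ha hc γ) =
      (λ_ (𝟙_ V)).inv ≫ (gen σ ha hc ⊗ₘ genChain V γ) ≫
        VQuiver.ι (freeQuiver V K n) (beadTensor (freeNerve V K) L) a c b := rfl

/-- Form suited to induction on the list: the shorter chain comes first, and the remaining factors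
are absorbed into a morphism with the same target. -/
lemma genChain_cons_comp {n : ℕ} {L : List ℕ} {a b c : Vert K}
    (σ : K.obj (op (SimplexCategory.mk n))) (ha : vertex K n 0 (Nat.zero_le n) σ = a)
    (hc : vertex K n n le_rfl σ = c) (γ : Chain K L c b) {W : V}
    (f : (VQuiver.tensor (freeQuiver V K n) (beadTensor (freeNerve V K) L)).obj a b ⟶ W) :
    genChain V (.cons σ ha hc γ) ≫ f = genChain V γ ≫ (λ_ _).inv ≫ gen σ ha hc ▷ _ ≫
      VQuiver.ι (freeQuiver V K n) (beadTensor (freeNerve V K) L) a c b ≫ f := by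
  rw [leftUnitor_inv_naturality_assoc, ← MonoidalCategory.tensorHom_def'_assoc]
  refine (Category.assoc _ _ _).trans (congrArg (_ ≫ ·) (Category.assoc _ _ _))

/-- As the tensor product distributes over coproducts, a tensor product of free quivers is a
coproduct of copies of the unit indexed by chains. This is the uniqueness half of its universal
property, and `exists_genChain_desc` is the existence half. -/
lemma genChain_ext {L : List ℕ} {a b : Vert K} {W : V}
    {f g : (beadTensor (freeNerve V K) L).obj a b ⟶ W}
    (h : ∀ γ : Chain K L a b, genChain V γ ≫ f = genChain V γ ≫ g) : f = g := by
  induction L generalizing a W with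
  | nil => exact VQuiver.unit_ext fun e => h (.nil e)
  | cons n L ih =>
    refine VQuiver.tensor_ext (Q := freeQuiver V K n) fun c => sigmaTensor_hom_ext fun σ => ?_
    rw [← cancel_epi (λ_ _).inv]
    refine ih fun γ => ?_
    have := h (.cons σ.1 σ.2.1 σ.2.2 γ)
    exact (genChain_cons_comp σ.1 σ.2.1 σ.2.2 γ f).symm.trans
      (this.trans (genChain_cons_comp σ.1 σ.2.1 σ.2.2 γ g))

lemma exists_genChain_desc {L : List ℕ} {a b : Vert K} {W : V}
    (y : Chain K L a b → (𝟙_ V ⟶ W)) :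
    ∃ f : (beadTensor (freeNerve V K) L).obj a b ⟶ W, ∀ γ, genChain V γ ≫ f = y γ := by
  induction L generalizing a W with
  | nil =>
    refine ⟨Sigma.desc fun e : PLift (a = b) => y (.nil e.down), fun γ => ?_⟩
    cases γ with
    | nil h => exact Sigma.ι_desc (fun e : PLift (a = b) => y (.nil e.down)) ⟨h⟩
  | cons n L ih =>
    -- For each intermediate vertex and each first simplex, induction supplies a morphism on the
    -- tail.
    choose f hf using fun (c : Vert K) (σ : {σ : K.obj (op (SimplexCategory.mk n)) //
      vertex K n 0 (Nat.zero_le n) σ = a ∧ vertex K n n le_rfl σ = c}) =>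
        ih (a := c) (W := W) fun γ => y (.cons σ.1 σ.2.1 σ.2.2 γ)
    refine ⟨VQuiver.desc (Q := freeQuiver V K n) fun c =>
      sigmaTensorDesc _ fun σ => (λ_ _).hom ≫ f c σ, fun γ => ?_⟩
    cases γ with
    | @cons _ _ _ _ c σ ha hc γ =>
      refine (genChain_cons_comp σ ha hc γ _).trans (Eq.trans ?_ (hf c ⟨σ, ha, hc⟩ γ))
      refine congrArg (genChain V γ ≫ ·) ?_
      refine Eq.trans (congrArg (fun x => _ ≫ _ ≫ x) (VQuiver.ι_desc _ c)) ?_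
      refine Eq.trans (congrArg (_ ≫ ·) (ι_whiskerRight_sigmaTensorDesc _ _
        (⟨σ, ha, hc⟩ : {σ : K.obj (op (SimplexCategory.mk n)) //
          vertex K n 0 (Nat.zero_le n) σ = a ∧ vertex K n n le_rfl σ = c}))) ?_
      exact Iso.inv_hom_id_assoc _ _

/-- The canonical isomorphism for concatenated lists glues chains; this is needed because `nmap`
assembles its values by `catp`. -/
lemma genChain_append {A B : List ℕ} {a b c : Vert K} (γ : Chain K A a c) (γ' : Chain K B c b) :
    (λ_ (𝟙_ V)).inv ≫ (genChain V γ ⊗ₘ genChain V γ') ≫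
        VQuiver.ι (beadTensor (freeNerve V K) A) (beadTensor (freeNerve V K) B) a c b ≫
          (catp (freeNerve V K) A B (A ++ B) rfl).app a b = genChain V (γ.append γ') := by
  induction γ with
  | nil e =>
    subst e
    rw [show catp (freeNerve V K) [] B ([] ++ B) rfl = _ from catp_nil (freeNerve V K) B rfl,
      MonoidalCategory.tensorHom_def', Category.assoc]
    refine Eq.trans (congrArg (fun x => _ ≫ _ ≫ x) (VQuiver.ι_leftUnitHom _ _ _)) ?_
    refine Eq.trans (congrArg (_ ≫ ·) (leftUnitor_naturality (genChain V γ'))) ?_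
    exact Iso.inv_hom_id_assoc _ _
  | @cons n L a c d σ ha hd γ ih =>
    simp only [Chain.append, List.cons_append, genChain_cons]
    rw [catp_cons, ← ih]
    refine (tensor_glue_unit _ _ (VQuiver.ι _ _ d c b) (VQuiver.ι (freeQuiver V K n)
      (beadTensor (freeNerve V K) L ⊗ beadTensor (freeNerve V K) B) a d b ≫
        (cell (freeNerve V K) n ◁ catp (freeNerve V K) L B (L ++ B) rfl).app a b) ?_ _ _ _).trans ?_
    · exact VQuiver.ι_assocHom_assoc _ _ _ _ _ _ _ _
    · refine Eq.trans (congrArg (fun x => _ ≫ _ ≫ x) (VQuiver.ι_tmap _ _ _ _ _)) ?_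
      rw [tensorHom_comp_tensorHom_assoc]
      simp only [VQuiver.id_app, Category.assoc]
      exact congrArg (fun x => _ ≫ (x ⊗ₘ _) ≫ _) (Category.comp_id (gen σ ha hd))

lemma gen_cellMap {m n : ℕ} {f : ℕ → ℕ} (h : IsIntMap m n f) {a b : Vert K}
    (σ : K.obj (op (SimplexCategory.mk n))) (ha) (hb) (ha') (hb') :
    gen σ ha hb ≫ (cellMap (freeNerve V K) m n f h).app a b =
      gen (face K m n f h.mono h.last.le σ) ha' hb' :=
  gen_freeMap (V := V) (IsIntMap.raw (X := ⟨m⟩) (Y := ⟨n⟩) _) σ ha hb _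
    (face_congr _ _ _ _ (fun _ hi => congrArg f (min_eq_left hi)) σ) ha' hb'

lemma gen_cellδ {k l n : ℕ} (h : k + l = n) {a b c : Vert K} (σ : K.obj (op (SimplexCategory.mk n)))
    (ha) (hb) (hc : vertex K n k (front_le k l n h) σ = c) (h₁) (h₂) (h₃) (h₄) :
    gen σ ha hb ≫ (cellδ (freeNerve V K) k l n h).app a b = (λ_ (𝟙_ V)).inv ≫
      (gen (face K k n (fun i => i) monotone_id (front_le k l n h) σ) h₁ h₂ ⊗ₘ
        gen (face K l n (fun i => k + i) (back_mono k) h.le σ) h₃ h₄) ≫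
          VQuiver.ι (freeQuiver V K k) (freeQuiver V K l) a c b := by
  subst h
  rw [cellδ_rfl]
  exact gen_freeδ rfl σ ha hb hc _ _ rfl rfl h₁ h₂ h₃ h₄

/-- Iterated comultiplication cuts a simplex into consecutive faces. Only the vertices of the
resulting chain are recorded: in a subcomplex of a simplex they identify it, see `Chain.ext_num`. -/
lemma exists_gen_mup (L : List ℕ) (n : ℕ) (h : L.sum = n) {a b : Vert K}
    (σ : K.obj (op (SimplexCategory.mk n))) (ha) (hb) :
    ∃ γ : Chain K L a b, gen σ ha hb ≫ (mup (freeNerve V K) L n h).app a b = genChain V γ ∧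
      ∀ t (ht : t ≤ n), γ.vert t = vertex K n t ht σ := by
  induction L generalizing n a with
  | nil =>
    obtain rfl : 0 = n := by simpa using h
    refine ⟨.nil (ha.symm.trans hb), ?_, fun t ht => ?_⟩
    · rw [mup_nil]
      exact gen_freeη σ ha hb _
    · obtain rfl : t = 0 := by omega
      exact ha.symm
  | cons k L ih =>
    have hn : k + L.sum = n := by simpa using h
    have hk := front_le k L.sum n hn
    have h₁ := (vertex_face (f := fun i => i) monotone_id hk (Nat.zero_le k) rfl σ).trans ha
    have h₂ := vertex_face (f := fun i => i) monotone_id hk le_rfl rfl σ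
    have h₃ := vertex_face (f := fun i => k + i) (back_mono k) hn.le (Nat.zero_le _) rfl σ
    have h₄ := (vertex_face (f := fun i => k + i) (back_mono k) hn.le le_rfl hn σ).trans hb
    obtain ⟨γ, hγ, hv⟩ := ih L.sum rfl _ h₃ h₄
    refine ⟨.cons _ h₁ h₂ γ, ?_, fun t ht => ?_⟩
    · rw [mup_cons (freeNerve V K) k L n L.sum h rfl hn, genChain_cons, ← hγ]
      refine (Category.assoc _ _ _).symm.trans ?_
      refine (congrArg (· ≫ _) (gen_cellδ hn σ ha hb rfl h₁ h₂ h₃ h₄)).trans ?_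
      refine (Category.assoc _ _ _).trans (congrArg (_ ≫ ·) ?_)
      refine (Category.assoc _ _ _).trans ?_
      refine (congrArg (_ ≫ ·) (VQuiver.ι_tmap _ _ _ _ _)).trans ?_
      refine (tensorHom_comp_tensorHom_assoc _ _ _ _ _).trans ?_
      exact congrArg (fun x => (x ⊗ₘ _) ≫ _) (Category.comp_id _)
    · rcases le_total t k with h' | h'
      · rw [Chain.vert_cons_of_le _ _ _ _ h']
        exact vertex_face (f := fun i => i) monotone_id hk h' rfl σ
      · obtain ⟨t, rfl⟩ := Nat.exists_eq_add_of_le h'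
        rw [Chain.vert_cons_add, hv t (by omega)]
        exact vertex_face (f := fun i => k + i) (back_mono k) hn.le _ rfl σ

lemma exists_gen_bmap (L : List ℕ) (u : ℕ) (f : ℕ → ℕ) (h : IsIntMap L.sum u f) {a b : Vert K}
    (σ : K.obj (op (SimplexCategory.mk u))) (ha) (hb) :
    ∃ γ : Chain K L a b, gen σ ha hb ≫ (bmap (freeNerve V K) L u f h).app a b = genChain V γ ∧
      ∀ t (ht : t ≤ L.sum), γ.vert t = vertex K u (f t) (h.le ht rfl) σ := by
  obtain ⟨γ, hγ, hv⟩ := exists_gen_mup (V := V) L L.sum rfl (face K L.sum u f h.mono h.last.le σ)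
    ((vertex_face h.mono h.last.le _ h.zero σ).trans ha)
    ((vertex_face h.mono h.last.le _ h.last σ).trans hb)
  refine ⟨γ, ?_, fun t ht => (hv t ht).trans (vertex_face h.mono h.last.le ht rfl σ)⟩
  refine (Category.assoc _ _ _).symm.trans (Eq.trans ?_ hγ)
  exact congrArg (· ≫ _) (gen_cellMap h σ ha hb _ _)

/-- The inverse counit turns the unit at `a` into the 0-simplex `a`; the resulting chain consists of
degeneracies of it. -/
lemma exists_ιUnit_zeta (L : List ℕ) (f : ℕ → ℕ) (h : IsIntMap L.sum 0 f) {a b : Vert K}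
    (e : a = b) :
    ∃ γ : Chain K L a b, VQuiver.ιUnit e ≫ (zeta (freeNerve V K) L f h).app a b = genChain V γ ∧
      ∀ t ≤ L.sum, γ.vert t = a := by
  obtain ⟨γ, hγ, hv⟩ := exists_gen_bmap (V := V) L 0 f h a (vertex_zero a _)
    ((vertex_zero a _).trans e)
  refine ⟨γ, hγ ▸ ?_, fun t ht => (hv t ht).trans ?_⟩
  -- The unit is written as the image of the 0-simplex `a` under the counit, which then cancels
  -- against its inverse in `zeta`.
  · rw [← gen_freeη a (vertex_zero a _) ((vertex_zero a _).trans e) e]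
    refine (Category.assoc _ _ _).trans (congrArg (_ ≫ ·) ?_)
    have := congrArg (fun x : VQuiver.Hom _ _ => x.app a b) (IsIso.hom_inv_id_assoc
      (cellη (freeNerve V K)) (bmap (freeNerve V K) L 0 f h))
    exact this
  · have : f t = 0 := Nat.le_zero.mp (h.le ht rfl)
    simp only [this]
    exact vertex_zero a _

/-- The action of a map of necklaces on chains. -/
lemma exists_genChain_nmap (M L : List ℕ) (f : ℕ → ℕ) (h : NecCond L M f) {a b : Vert K}
    (γ : Chain K M a b) :
    ∃ γ' : Chain K L a b, genChain V γ ≫ (nmap (freeNerve V K) M L f h).app a b = genChain V γ' ∧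
      ∀ t ≤ L.sum, γ'.vert t = γ.vert (f t) := by
  induction γ generalizing L f with
  | nil e => exact exists_ιUnit_zeta L f h.int_nil e
  | @cons u M a b c σ ha hc γ ih =>
    -- The joint behind the first bead is hit by some joint of `L`; the list is cut there, so that
    -- the simplex and the rest of the chain restrict separately.
    obtain ⟨A, B, hL, hA⟩ := h.exists_append (M := [u]) (N := M) rfl
    have hA' : f A.sum = u := by simpa using hA
    obtain ⟨γ₁, h₁, hv₁⟩ := exists_gen_bmap (V := V) A u f (h.int.take hA') σ ha hc
    obtain ⟨γ₂, h₂, hv₂⟩ := ih B (shiftMap f A.sum) (h.tail hL hA')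
    subst hL
    refine ⟨γ₁.append γ₂, ?_, fun t ht => ?_⟩
    · rw [nmap_cons (freeNerve V K) M u A B _ f h rfl hA', ← genChain_append, ← h₁, ← h₂,
        genChain_cons]
      refine (Category.assoc _ _ _).trans (congrArg (_ ≫ ·) ?_)
      refine (Category.assoc _ _ _).trans ?_
      refine Eq.trans (congrArg (_ ≫ ·) (VQuiver.ι_tmap_assoc _ _ _ _ _ _)) ?_
      exact tensorHom_comp_tensorHom_assoc _ _ _ _ _
    · rcases le_total t A.sum with h' | h'
      · have : f t ≤ u := hA' ▸ h.int.mono h'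
        rw [Chain.vert_append_of_le _ _ h', hv₁ t h', Chain.vert_cons_of_le _ _ _ _ this]
      · obtain ⟨t, rfl⟩ := Nat.exists_eq_add_of_le h'
        rw [List.sum_append] at ht
        have h1 := h.int.mono h'
        have : f (A.sum + t) = u + shiftMap f A.sum t := by
          simp only [shiftMap]; omega
        rw [Chain.vert_append_add, hv₂ t (by omega), this, Chain.vert_cons_add]

end Chains

/-! ### Morphisms out of F̃(K)_•(a, b) as families of values on chains. -/

section ChainMaps

variable {V : Type u} [Category.{v} V] [MonoidalCategory V] [BraidedCategory V] [MonoidalClosed V]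
  [HasColimits V] {K K' : SSet.{v}}

/-- The action of a simplicial map on chains. -/
lemma exists_genChain_btApp (φ : K ⟶ K') {L : List ℕ} {a b : Vert K} (γ : Chain K L a b) :
    ∃ γ' : Chain K' L (vertexMap φ a) (vertexMap φ b),
      genChain V γ ≫ (btApp (VQuiver.pull (vertexMap φ)) (freeNat V φ) L).app a b = genChain V γ' ∧
        ∀ t, γ'.vert t = vertexMap φ (γ.vert t) := by
  induction γ with
  | nil e => exact ⟨.nil (congrArg _ e), VQuiver.ιUnit_pullε _ e, fun _ => rfl⟩
  | @cons n L a b c σ ha hc γ ih =>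
    obtain ⟨γ', h, hv⟩ := ih
    have ha' := (vertex_naturality φ _ σ).symm.trans (congrArg (vertexMap φ) ha)
    have hc' := (vertex_naturality φ _ σ).symm.trans (congrArg (vertexMap φ) hc)
    refine ⟨.cons (φ.app _ σ) ha' hc' γ', ?_, fun t => ?_⟩
    · rw [genChain_cons, genChain_cons, ← h]
      refine (Category.assoc _ _ _).trans (congrArg (_ ≫ ·) ?_)
      refine (Category.assoc _ _ _).trans ?_
      refine Eq.trans (congrArg (_ ≫ ·) (VQuiver.ι_tmap_assoc _ _ _ _ _ _)) ?_
      refine (tensorHom_comp_tensorHom_assoc _ _ _ _ _).trans ?_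
      exact congrArg₂ (fun x y => (x ⊗ₘ _) ≫ y) (gen_freeApp φ σ ha hc ha' hc')
        (VQuiver.ι_pullμ _ _ _ _ _ _)
    · rcases le_total t n with h' | h'
      · rw [Chain.vert_cons_of_le _ _ _ _ h', Chain.vert_cons_of_le _ _ _ _ h']
        exact (vertex_naturality φ _ σ).symm
      · obtain ⟨t, rfl⟩ := Nat.exists_eq_add_of_le h'
        rw [Chain.vert_cons_add, Chain.vert_cons_add, hv]

variable {a b : Vert K} {Y : Necᵒᵖ ⥤ V}

lemma freeNec_hom_ext {g g' : (freeTemplicial V K).nec a b ⟶ Y}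
    (h : ∀ (T : Nec) (γ : Chain K T.beads a b),
      genChain V γ ≫ g.app (op T) = genChain V γ ≫ g'.app (op T)) : g = g' := by
  ext T
  exact genChain_ext (h T.unop)

/-- Compatibility is asked for every chain with the right vertices, not just for the actual
restriction, because the restriction is known only through its vertices. -/
lemma exists_freeNec_hom (y : ∀ T : Nec, Chain K T.beads a b → (𝟙_ V ⟶ Y.obj (op T)))
    (hy : ∀ (T T' : Nec) (u : T' ⟶ T) (γ : Chain K T.beads a b) (γ' : Chain K T'.beads a b),
      (∀ t ≤ T'.beads.sum, γ'.vert t = γ.vert (u.toHom.raw t)) →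
        y T' γ' = y T γ ≫ Y.map u.op) :
    ∃ g : (freeTemplicial V K).nec a b ⟶ Y,
      ∀ (T : Nec) (γ : Chain K T.beads a b), genChain V γ ≫ g.app (op T) = y T γ := by
  choose f hf using fun T : Nec => exists_genChain_desc (V := V) (y T)
  refine ⟨{ app := fun T => f T.unop, naturality := fun T T' u => ?_ }, hf⟩
  refine genChain_ext fun γ => ?_
  obtain ⟨γ', h, hv⟩ := exists_genChain_nmap (V := V) _ _ _ u.unop.necCond γ
  refine (Category.assoc _ _ _).symm.trans ((congrArg (· ≫ f T'.unop) h).trans ?_)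
  refine (hf _ _).trans (Eq.trans (hy _ _ u.unop γ γ' hv) ?_)
  refine Eq.trans ?_ (Category.assoc _ _ _)
  exact congrArg (· ≫ _) (hf T.unop γ).symm

end ChainMaps

/-! ### Subcomplexes of a simplex, where chains are determined by the numbers of their vertices. -/

section Numbers

variable {N : ℕ} {K : SSet.{v}} (j : K ⟶ SSet.stdSimplex.{v}.obj (SimplexCategory.mk N))

/-- The number of a vertex of a simplicial set over `Δ^N`. -/
def num (x : Vert K) : ℕ := (SSet.stdSimplex.obj₀Equiv (j.app _ x) : Fin (N + 1))

lemma num_le (x : Vert K) : num j x ≤ N := Nat.lt_succ_iff.mp (Fin.is_lt _)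

lemma num_vertex {m : ℕ} (σ : K.obj (op (SimplexCategory.mk m))) {t : ℕ} (h : t ≤ m) :
    num j (vertex K m t h σ) =
      ((SSet.stdSimplex.asOrderHom (j.app _ σ) ⟨t, Nat.lt_succ_of_le h⟩ : Fin (N + 1)) : ℕ) := by
  unfold num
  rw [vertex_naturality]
  rfl

lemma num_vertex_mono {m : ℕ} (σ : K.obj (op (SimplexCategory.mk m))) {s t : ℕ} (h : s ≤ t)
    (ht : t ≤ m) : num j (vertex K m s (h.trans ht) σ) ≤ num j (vertex K m t ht σ) := by
  rw [num_vertex, num_vertex]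
  exact (SSet.stdSimplex.asOrderHom (j.app _ σ)).monotone h

lemma num_vert_mono {L : List ℕ} {a b : Vert K} (γ : Chain K L a b) {s t : ℕ} (h : s ≤ t)
    (ht : t ≤ L.sum) : num j (γ.vert s) ≤ num j (γ.vert t) := by
  induction γ generalizing s t with
  | nil e => rfl
  | @cons n L a b c σ ha hc γ ih =>
    rw [List.sum_cons] at ht
    rcases le_total t n with h' | h'
    · rw [Chain.vert_cons_of_le _ _ _ _ h', Chain.vert_cons_of_le _ _ _ _ (h.trans h')]
      exact num_vertex_mono j σ h h'
    · obtain ⟨t, rfl⟩ := Nat.exists_eq_add_of_le h'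
      rw [Chain.vert_cons_add]
      rcases le_total s n with hs | hs
      · rw [Chain.vert_cons_of_le _ _ _ _ hs]
        refine (num_vertex_mono j σ hs le_rfl).trans ?_
        rw [hc]
        have := ih (Nat.zero_le t) (by omega)
        rwa [Chain.vert_zero] at this
      · obtain ⟨s, rfl⟩ := Nat.exists_eq_add_of_le hs
        rw [Chain.vert_cons_add]
        exact ih (by omega) (by omega)

/-- The map of vertices given by a chain. -/
def chainMap {L : List ℕ} {a b : Vert K} (γ : Chain K L a b) (t : ℕ) : ℕ :=
  num j (γ.vert (min t L.sum))

lemma chainMap_of_le {L : List ℕ} {a b : Vert K} (γ : Chain K L a b) {t : ℕ} (h : t ≤ L.sum) :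
    chainMap j γ t = num j (γ.vert t) := by
  rw [chainMap, min_eq_left h]

lemma isIntMap_chainMap {L : List ℕ} {a b : Vert K} (γ : Chain K L a b) (ha : num j a = 0)
    (hb : num j b = N) : IsIntMap L.sum N (chainMap j γ) where
  mono := by
    intro s t h
    exact num_vert_mono j γ (by omega) (by omega)
  zero := by rw [chainMap, Nat.zero_min, Chain.vert_zero, ha]
  last := by rw [chainMap, min_self, Chain.vert_sum, hb]

variable {j}

lemma num_injective (hj : ∀ m, Function.Injective (j.app (op (SimplexCategory.mk m)))) :
    Function.Injective (num j) := fun _ _ h =>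
  hj 0 (SSet.stdSimplex.obj₀Equiv.injective (Fin.ext h))

/-- A simplex of Δ^N is a monotone map, hence determined by its vertices, and `j` embeds K in Δ^N.
-/
lemma simplex_ext_num (hj : ∀ m, Function.Injective (j.app (op (SimplexCategory.mk m))))
    {m : ℕ} {σ τ : K.obj (op (SimplexCategory.mk m))}
    (h : ∀ t (ht : t ≤ m), num j (vertex K m t ht σ) = num j (vertex K m t ht τ)) : σ = τ := by
  refine hj m (SSet.stdSimplex.ext _ _ fun i => Fin.ext ?_)
  have := h i (Nat.lt_succ_iff.mp i.2)
  rwa [num_vertex, num_vertex] at this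

/-- This makes the merely existential descriptions of restricted chains sufficient: a chain with the
expected vertices is the restriction. -/
lemma Chain.ext_num (hj : ∀ m, Function.Injective (j.app (op (SimplexCategory.mk m))))
    {L : List ℕ} {a b : Vert K} {γ γ' : Chain K L a b}
    (h : ∀ t ≤ L.sum, num j (γ.vert t) = num j (γ'.vert t)) : γ = γ' := by
  induction γ with
  | nil e => cases γ'; rfl
  | @cons n L a b c σ ha hc γ ih =>
    cases γ' with
    | @cons _ _ _ _ c' σ' ha' hc' γ' =>
      obtain rfl : σ = σ' := simplex_ext_num hj fun t ht => by
        have := h t (by rw [List.sum_cons]; omega)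
        rwa [vert_cons_of_le _ _ _ _ ht, vert_cons_of_le _ _ _ _ ht] at this
      obtain rfl : c = c' := hc.symm.trans hc'
      obtain rfl : γ = γ' := ih fun t ht => by
        have := h (n + t) (by rw [List.sum_cons]; omega)
        rwa [vert_cons_add, vert_cons_add] at this
      rfl

end Numbers

/-! ### Maps of necklaces and criteria for their action to be invertible. -/

section NecklaceMaps

/-- A single bead has only the endpoints as joints, and these are hit by every endpoint-preserving
map. -/
lemma necCond_singleton {L : List ℕ} {N : ℕ} {f : ℕ → ℕ} (h : IsIntMap L.sum N f) :
    NecCond L [N] f where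
  int := by simpa using h
  joint j := by
    rcases j with _ | j
    · exact ⟨0, by simp [h.zero]⟩
    · exact ⟨L.length, by simp [h.last]⟩

/-- Besides the endpoints there is only the joint `k` to be hit. -/
lemma necCond_pair {L A B : List ℕ} {k l : ℕ} {f : ℕ → ℕ} (h : IsIntMap L.sum (k + l) f)
    (hL : A ++ B = L) (hA : f A.sum = k) : NecCond L [k, l] f where
  int := by simpa using h
  joint j := by
    rcases j with _ | _ | j
    · exact ⟨0, by simp [h.zero]⟩
    · exact ⟨A.length, by simp [← hL, hA]⟩
    · exact ⟨L.length, by simp [h.last]⟩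

lemma NecCond.congr {L M : List ℕ} {f g : ℕ → ℕ} (h : NecCond L M f) (hg : Monotone g)
    (e : ∀ i ≤ L.sum, f i = g i) : NecCond L M g where
  int := ⟨hg, (e 0 (Nat.zero_le _)).symm.trans h.int.zero, (e _ le_rfl).symm.trans h.int.last⟩
  joint j := by
    obtain ⟨i, hi⟩ := h.joint j
    exact ⟨i, by rw [← e _ ((List.take_sublist i L).sum_le_sum (by simp)), hi]⟩

/-- The map of necklaces given by a map of vertices. -/
def Nec.homOfCond {T U : Nec} {f : ℕ → ℕ} (h : NecCond T.beads U.beads f) : T ⟶ U where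
  toHom := FInt.Hom.ofRaw T.dim U.dim f h.int.mono h.int.zero h.int.last
  joints_subset := by
    rintro u ⟨j, hj⟩
    obtain ⟨i, hi⟩ := h.joint j
    refine ⟨⟨(T.beads.take i).sum, Nat.lt_succ_of_le
      ((List.take_sublist i T.beads).sum_le_sum (by simp))⟩, ⟨i, rfl⟩, Fin.ext ?_⟩
    exact hi.trans hj.symm

variable {W : Type*} [Category W] [MonoidalCategory W] (X : FIntᵒᵖ ⥤ W)

lemma isIso_catp (A B L : List ℕ) (h : A ++ B = L) : IsIso (catp X A B L h) := by
  induction A generalizing L with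
  | nil =>
    obtain rfl : B = L := h
    rw [catp_nil]
    infer_instance
  | cons a A ih =>
    subst h
    have := ih _ rfl
    simp only [List.cons_append]
    rw [catp_cons]
    infer_instance

variable [X.OplaxMonoidal] [IsIso (cellη X)]

/-- Maps of necklaces are represented by functions on all natural numbers; the values beyond the
last vertex of `L` are irrelevant. -/
lemma nmap_congr_of_le {M L : List ℕ} {f g : ℕ → ℕ} (hf : NecCond L M f) (hg : NecCond L M g)
    (h : ∀ i ≤ L.sum, f i = g i) : nmap X M L f hf = nmap X M L g hg := by
  induction M generalizing L f g with
  | nil =>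
    change inv (cellη X) ≫ cellMap X _ _ _ _ ≫ _ = inv (cellη X) ≫ cellMap X _ _ _ _ ≫ _
    rw [cellMap_congr X _ _ h]
  | cons u M ih =>
    obtain ⟨A, B, hL, hA⟩ := hf.exists_append (M := [u]) (N := M) rfl
    have hA' : f A.sum = u := by simpa using hA
    have hs : L.sum = A.sum + B.sum := by rw [← hL, List.sum_append]
    have hA'' : g A.sum = u := (h _ (by omega)).symm.trans hA'
    rw [nmap_cons X M u A B L f hf hL hA', nmap_cons X M u A B L g hg hL hA'',
      ih (g := shiftMap g A.sum) _ (hg.tail hL hA'')]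
    · congr 2
      change cellMap X _ _ _ _ ≫ _ = cellMap X _ _ _ _ ≫ _
      rw [cellMap_congr X _ _ fun i hi => h i (by omega)]
    · intro i hi
      simp only [shiftMap]
      rw [h _ (by omega), h _ (by omega)]

/-- With `f` the identity on [k], only the comultiplication remains, up to the inverse right unitor
left by the counit at the end of the list. -/
lemma isIso_bmap_pair {a b k : ℕ} (hk : a + b = k) [IsIso (cellδ X a b k hk)] {f : ℕ → ℕ}
    (h : IsIntMap [a, b].sum k f) (hf : ∀ i ≤ k, f i = i) : IsIso (bmap X [a, b] k f h) := by
  have hs : [a, b].sum = k := by simpa using hk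
  have h1 : IsIso (mup X [b] b (by simp)) := by
    have e : mup X [b] b (by simp) = (ρ_ (cell X b)).inv := by
      rw [mup_cons X b [] b 0 _ List.sum_nil (Nat.add_zero b), mup_nil, cellδ_right]
    exact e ▸ inferInstance
  have h2 : IsIso (mup X [a, b] k hs) := by
    rw [mup_cons X a [b] k b hs (by simp) hk]
    infer_instance
  subst hk
  have : bmap X [a, b] (a + b) f h = mup X [a, b] (a + b) hs := by
    refine Eq.trans ?_ (Category.id_comp _)
    exact congrArg (· ≫ mup X [a, b] (a + b) hs) (cellMap_id X (m := a + b) h hf)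
  rw [this]
  exact h2

/-- The effect of splitting the first bead. -/
lemma isIso_nmap_split {a b k : ℕ} (hk : a + b = k) [IsIso (cellδ X a b k hk)] (M : List ℕ)
    {f : ℕ → ℕ} (h : NecCond (a :: b :: M) (k :: M) f) (hf : ∀ i ≤ k + M.sum, f i = i) :
    IsIso (nmap X (k :: M) (a :: b :: M) f h) := by
  have hab : [a, b].sum = k := by simpa using hk
  have hA : f [a, b].sum = k := by rw [hab, hf k (by omega)]
  -- The two new beads cover the old first bead, and the remaining beads are carried along by an
  -- identity.
  rw [nmap_cons X M k [a, b] M _ f h rfl hA, nmap_id]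
  · have h1 := isIso_catp X [a, b] M _ rfl
    have := isIso_bmap_pair X hk (h.int.take hA) fun i hi => hf i (by omega)
    exact IsIso.comp_isIso' inferInstance h1
  · intro i hi
    simp only [shiftMap]
    rw [hA, hab, hf _ (by omega)]
    omega

/-- On an unchanged first bead the action is a unitor up to gluing. Together with `isIso_nmap_split`
this handles subdivisions of the second bead. -/
lemma isIso_nmap_cons (k : ℕ) (M L : List ℕ) {f : ℕ → ℕ} (h : NecCond (k :: L) (k :: M) f)
    (hf : ∀ i ≤ k, f i = i) (hk : f [k].sum = k)
    (hi : IsIso (nmap X M L (shiftMap f [k].sum) (h.tail (A := [k]) rfl hk))) :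
    IsIso (nmap X (k :: M) (k :: L) f h) := by
  rw [nmap_cons X M k [k] L _ f h rfl hk, bmap_singleton X k f _ hf]
  exact IsIso.comp_isIso' inferInstance (isIso_catp X [k] L _ rfl)

end NecklaceMaps

/-! ### Values of morphisms at chains and their behaviour under restriction. -/

section NecValues

variable {V : Type u} [Category.{v} V] [MonoidalCategory V] [BraidedCategory V] [MonoidalClosed V]
  [HasColimits V] {X : TemplicialObject V} {p q : X.S}

lemma nec_map_homOfCond {T U : Nec} {f : ℕ → ℕ} (h : NecCond T.beads U.beads f) :
    (X.nec p q).map (Nec.homOfCond h).op = (nmap X.X U.beads T.beads f h).app p q :=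
  congrArg (fun x : VQuiver.Hom _ _ => x.app p q)
    (nmap_congr_of_le X.X _ _ fun _ hi => congrArg f (min_eq_left hi))

variable {N : ℕ} {K : SSet.{v}} {j : K ⟶ SSet.stdSimplex.{v}.obj (SimplexCategory.mk N)}
  {a b : Vert K}

/-- The value of a morphism out of `F(K)_•(a, b)` at a chain. -/
noncomputable def necValue (g : (freeTemplicial V K).nec a b ⟶ X.nec p q) {L : List ℕ}
    (hL : ∀ n ∈ L, 0 < n) (γ : Chain K L a b) : 𝟙_ V ⟶ (beadTensor X.X L).obj p q :=
  genChain V γ ≫ g.app (op ⟨L, hL⟩)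

lemma necValue_ext {g g' : (freeTemplicial V K).nec a b ⟶ X.nec p q}
    (h : ∀ (L : List ℕ) (hL : ∀ n ∈ L, 0 < n) (γ : Chain K L a b),
      necValue g hL γ = necValue g' hL γ) : g = g' :=
  freeNec_hom_ext fun T γ => h T.beads T.pos γ

/-- Naturality of `g`: by the condition on vertices, `γ'` is the restriction of `γ` along `f`. -/
lemma necValue_restrict (hj : ∀ m, Function.Injective (j.app (op (SimplexCategory.mk m))))
    (g : (freeTemplicial V K).nec a b ⟶ X.nec p q) {L M : List ℕ} (hL : ∀ n ∈ L, 0 < n)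
    (hM : ∀ n ∈ M, 0 < n) {f : ℕ → ℕ} (h : NecCond L M f) (γ : Chain K M a b)
    (γ' : Chain K L a b) (hγ : ∀ t ≤ L.sum, num j (γ'.vert t) = num j (γ.vert (f t))) :
    necValue g hL γ' = necValue g hM γ ≫ (nmap X.X M L f h).app p q := by
  have h' : NecCond (Nec.mk L hL).beads (Nec.mk M hM).beads f := h
  obtain ⟨γ'', h₁, hv⟩ := exists_genChain_nmap (V := V) _ _ _ (Nec.homOfCond h').necCond γ
  obtain rfl : γ' = γ'' := Chain.ext_num hj fun t ht => by
    rw [hγ t ht, hv t ht]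
    exact congrArg (fun x => num j (γ.vert (f x))) (min_eq_left ht).symm
  refine Eq.trans ?_ (congrArg (_ ≫ ·) (nec_map_homOfCond h'))
  refine (congrArg (· ≫ g.app (op ⟨L, hL⟩)) h₁).symm.trans ?_
  refine (Category.assoc _ _ _).trans (Eq.trans ?_ (Category.assoc _ _ _).symm)
  exact congrArg (_ ≫ ·) (g.naturality (Nec.homOfCond h').op)

/-- The conclusion is purely combinatorial; `V` is explicit because the chain is read off from the
action on generators in `V`. -/
lemma exists_chain_restrict (V : Type u) [Category.{v} V]
    [MonoidalCategory V] [BraidedCategory V] [MonoidalClosed V] [HasColimits V]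
    {L M : List ℕ} {f : ℕ → ℕ} (h : NecCond L M f) (γ : Chain K M a b) :
    ∃ γ' : Chain K L a b, ∀ t ≤ L.sum, γ'.vert t = γ.vert (f t) := by
  obtain ⟨γ', _, hv⟩ := exists_genChain_nmap (V := V) _ _ _ h γ
  exact ⟨γ', hv⟩

/-- Two morphisms that agree on `γ₀` agree on `γ₁`, if `γ₀` and `γ₁` have a common restriction along
which `X` is injective on the shape of `γ₁`. -/
lemma necValue_eq_of_common_restriction
    (hj : ∀ m, Function.Injective (j.app (op (SimplexCategory.mk m))))
    (g g' : (freeTemplicial V K).nec a b ⟶ X.nec p q) {L M₀ M₁ : List ℕ} (hL : ∀ n ∈ L, 0 < n)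
    (hM₀ : ∀ n ∈ M₀, 0 < n) (hM₁ : ∀ n ∈ M₁, 0 < n) {f₀ f₁ : ℕ → ℕ}
    (h₀ : NecCond L M₀ f₀) (h₁ : NecCond L M₁ f₁)
    (γ₀ : Chain K M₀ a b) (γ₁ : Chain K M₁ a b)
    (hγ : ∀ t ≤ L.sum, num j (γ₀.vert (f₀ t)) = num j (γ₁.vert (f₁ t)))
    (hi : IsIso (nmap X.X M₁ L f₁ h₁))
    (e : necValue g hM₀ γ₀ = necValue g' hM₀ γ₀) : necValue g hM₁ γ₁ = necValue g' hM₁ γ₁ := by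
  obtain ⟨γ, hv⟩ := exists_chain_restrict V h₁ γ₁
  have := VQuiver.isIso_app (nmap X.X M₁ L f₁ h₁) p q
  have hv₁ : ∀ t ≤ L.sum, num j (γ.vert t) = num j (γ₁.vert (f₁ t)) := fun t ht => by
    rw [hv t ht]
  have hv₀ : ∀ t ≤ L.sum, num j (γ.vert t) = num j (γ₀.vert (f₀ t)) := fun t ht => by
    rw [hv t ht, hγ t ht]
  -- Equality is tested after restriction to `L`, where the values at `γ₁` become restrictions of
  -- the values at `γ₀`.
  rw [← cancel_mono ((nmap X.X M₁ L f₁ h₁).app p q), ← necValue_restrict hj g hL hM₁ h₁ γ₁ γ hv₁,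
    ← necValue_restrict hj g' hL hM₁ h₁ γ₁ γ hv₁, necValue_restrict hj g hL hM₀ h₀ γ₀ γ hv₀,
    necValue_restrict hj g' hL hM₀ h₀ γ₀ γ hv₀, e]

end NecValues

/-! ### Chains in simplices and in inner horns. -/

section HornChains

lemma exists_chain_singleton {N : ℕ} {K : SSet.{v}}
    {j : K ⟶ SSet.stdSimplex.{v}.obj (SimplexCategory.mk N)}
    (hj : ∀ m, Function.Injective (j.app (op (SimplexCategory.mk m)))) {a b : Vert K} {m : ℕ}
    {f : ℕ → ℕ} (σ : K.obj (op (SimplexCategory.mk m)))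
    (hσ : ∀ t (h : t ≤ m), num j (vertex K m t h σ) = f t) (ha : num j a = f 0)
    (hb : num j b = f m) :
    ∃ γ : Chain K [m] a b, ∀ t ≤ m, num j (γ.vert t) = f t := by
  refine ⟨.cons σ (num_injective hj ((hσ _ _).trans ha.symm))
    (num_injective hj ((hσ _ _).trans hb.symm)) (.nil rfl), fun t ht => ?_⟩
  rw [Chain.vert_cons_of_le _ _ _ _ ht, hσ]

lemma exists_chain_pair {N : ℕ} {K : SSet.{v}}
    {j : K ⟶ SSet.stdSimplex.{v}.obj (SimplexCategory.mk N)}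
    (hj : ∀ m, Function.Injective (j.app (op (SimplexCategory.mk m)))) {a b : Vert K} {k l : ℕ}
    {f : ℕ → ℕ} (σ : K.obj (op (SimplexCategory.mk k))) (τ : K.obj (op (SimplexCategory.mk l)))
    (hσ : ∀ t (h : t ≤ k), num j (vertex K k t h σ) = f t)
    (hτ : ∀ t (h : t ≤ l), num j (vertex K l t h τ) = f (k + t)) (ha : num j a = f 0)
    (hb : num j b = f (k + l)) :
    ∃ γ : Chain K [k, l] a b, ∀ t ≤ k + l, num j (γ.vert t) = f t := by
  obtain ⟨γ, hγ⟩ := exists_chain_singleton hj (f := fun t => f (k + t))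
    (a := vertex K k k le_rfl σ) (b := b) τ hτ (hσ _ _) hb
  refine ⟨.cons σ (num_injective hj ((hσ _ _).trans ha.symm)) rfl γ, fun t ht => ?_⟩
  rcases le_total t k with h | h
  · rw [Chain.vert_cons_of_le _ _ _ _ h, hσ]
  · obtain ⟨t, rfl⟩ := Nat.exists_eq_add_of_le h
    rw [Chain.vert_cons_add, hγ _ (by omega)]

/-- The simplex of `Δ^N` with vertices `f 0, ..., f m`. -/
def stdCell {N : ℕ} (m : ℕ) (f : ℕ → ℕ) (hf : Monotone f) (h : f m ≤ N) :
    (SSet.stdSimplex.{v}.obj (SimplexCategory.mk N)).obj (op (SimplexCategory.mk m)) :=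
  SSet.stdSimplex.objEquiv.symm (simplexMap m N f hf h)

/-- The inclusion of the horn `Λ^{n+2}_j`. -/
abbrev hornι (n : ℕ) (j : Fin (n + 3)) :
    (SSet.horn.{v} (n + 2) j).toSSet ⟶ SSet.stdSimplex.{v}.obj (SimplexCategory.mk (n + 2)) :=
  (SSet.horn.{v} (n + 2) j).ι

/-- `Δ^N` over itself. -/
abbrev simplexId (N : ℕ) : SSet.stdSimplex.{v}.obj (SimplexCategory.mk N) ⟶
    SSet.stdSimplex.{v}.obj (SimplexCategory.mk N) := 𝟙 _

lemma simplexId_injective (N m : ℕ) :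
    Function.Injective ((simplexId.{v} N).app (op (SimplexCategory.mk m))) := fun _ _ h => h

lemma hornι_injective (n : ℕ) (j : Fin (n + 3)) (m : ℕ) :
    Function.Injective ((hornι.{v} n j).app (op (SimplexCategory.mk m))) :=
  fun _ _ h => Subtype.ext h

lemma exists_top_chain (N : ℕ) :
    ∃ γ : Chain (SSet.stdSimplex.{v}.obj (SimplexCategory.mk N)) [N] (simplexVertex N 0)
      (simplexVertex N (Fin.last N)), ∀ t ≤ N, num (simplexId N) (γ.vert t) = t :=
  exists_chain_singleton (simplexId_injective N) (f := fun t => t)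
    (stdCell N (fun t => t) monotone_id le_rfl) (fun _ h => num_vertex (simplexId N) _ h) rfl rfl

variable {n : ℕ} {j : Fin (n + 3)}

/-- A simplex lies in the horn as soon as it misses some vertex `i` other than `j`. -/
lemma exists_horn_simplex (m : ℕ) (f : ℕ → ℕ) (hf : Monotone f) (h : f m ≤ n + 2) (i : Fin (n + 3))
    (hij : i ≠ j) (hi : ∀ t ≤ m, f t ≠ i) :
    ∃ σ : (SSet.horn.{v} (n + 2) j).toSSet.obj (op (SimplexCategory.mk m)),
      ∀ t (ht : t ≤ m), num (hornι n j) (vertex _ m t ht σ) = f t := by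
  refine ⟨⟨stdCell m f hf h, ?_⟩, fun t ht => num_vertex (hornι n j) _ ht⟩
  rw [SSet.mem_horn_iff_notMem_range]
  refine ⟨i, hij, ?_⟩
  rintro ⟨t, ht⟩
  exact hi t (Nat.lt_succ_iff.mp t.2) (congrArg Fin.val ht)

/-- As `j` is interior, the horn contains every face that misses the last vertex and every face that
misses 0. So it contains Δ^k ∨ Δ^l for every interior `k`, not only for `k = j`. -/
lemma exists_split_chain (h0 : 0 < j) (hl : j < Fin.last (n + 2)) (k l : ℕ) (hk : 0 < k)
    (h : 0 < l) (hkl : k + l = n + 2) :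
    ∃ γ : Chain (SSet.horn.{v} (n + 2) j).toSSet [k, l] (hornVertex n j 0)
      (hornVertex n j (Fin.last (n + 2))), ∀ t ≤ n + 2, num (hornι n j) (γ.vert t) = t := by
  obtain ⟨σ, hσ⟩ := exists_horn_simplex.{v} (n := n) (j := j) k (fun t => t) monotone_id (by omega)
    (Fin.last (n + 2)) hl.ne' (fun t ht => by simp; omega)
  obtain ⟨τ, hτ⟩ := exists_horn_simplex.{v} (n := n) (j := j) l (fun t => k + t) (back_mono k)
    (by omega) 0 h0.ne (fun t ht => by simp; omega)
  obtain ⟨γ, hγ⟩ := exists_chain_pair (hornι_injective n j) (f := fun t => t)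
    (a := hornVertex n j 0) (b := hornVertex n j (Fin.last (n + 2))) σ τ hσ hτ rfl hkl.symm
  exact ⟨γ, fun t ht => hγ t (ht.trans_eq hkl.symm)⟩

/-- The map `[n] ⟶ [n + 1]` that omits the value `i`. -/
def skip (i t : ℕ) : ℕ := if t < i then t else t + 1

/-- The left inverse of `skip i` that maps `i` to `i - 1`. -/
def unskip (i t : ℕ) : ℕ := if t < i then t else t - 1

lemma skip_mono (i : ℕ) : Monotone (skip i) := by
  intro s t h
  simp only [skip]
  split_ifs <;> omega

lemma unskip_mono (i : ℕ) : Monotone (unskip i) := by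
  intro s t h
  simp only [unskip]
  split_ifs <;> omega

lemma skip_unskip {i t : ℕ} (h : t ≠ i) : skip i (unskip i t) = t := by
  simp only [skip, unskip]
  split_ifs <;> omega

lemma skip_ne (i t : ℕ) : skip i t ≠ i := by
  simp only [skip]
  split_ifs <;> omega

/-- The face opposite `i` lies in the horn and, as `i` is interior, still runs from the first to the
last vertex. -/
lemma exists_face_chain (i : ℕ) (hi : 0 < i) (hi' : i < n + 2) (hij : i ≠ j) :
    ∃ γ : Chain (SSet.horn.{v} (n + 2) j).toSSet [n + 1] (hornVertex n j 0)
      (hornVertex n j (Fin.last (n + 2))), ∀ t ≤ n + 1, num (hornι n j) (γ.vert t) = skip i t := by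
  have hl : skip i (n + 1) = n + 2 := by simp only [skip]; split_ifs <;> omega
  obtain ⟨σ, hσ⟩ := exists_horn_simplex.{v} (n := n) (j := j) (n + 1) (skip i) (skip_mono i)
    hl.le ⟨i, by omega⟩ (fun h => hij (congrArg Fin.val h)) (fun t _ => skip_ne i t)
  exact exists_chain_singleton (hornι_injective n j) σ hσ (by simp [skip, hi]; rfl) hl.symm

/-- A chain in an inner horn either has a joint in the interior or misses a vertex. -/
lemma horn_chain_cases {L : List ℕ} {a b : Vert (SSet.horn.{v} (n + 2) j).toSSet}
    (γ : Chain (SSet.horn.{v} (n + 2) j).toSSet L a b) (ha : num (hornι n j) a = 0)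
    (hb : num (hornι n j) b = n + 2) :
    (∃ A B, A ++ B = L ∧ 0 < num (hornι n j) (γ.vert A.sum) ∧
      num (hornι n j) (γ.vert A.sum) < n + 2) ∨
    ∃ i, 0 < i ∧ i < n + 2 ∧ i ≠ j ∧ ∀ t ≤ L.sum, num (hornι n j) (γ.vert t) ≠ i := by
  induction γ with
  | nil e => subst e; omega
  | @cons m L a b c σ ha' hc γ ih =>
    have hle : ∀ t (ht : t ≤ m), num (hornι n j) (vertex _ m t ht σ) ≤ num (hornι n j) c :=
      fun t ht => (num_vertex_mono (hornι n j) σ ht le_rfl).trans_eq (congrArg _ hc)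
    -- The cases are those of the last vertex `c` of the first bead. If `c` is 0, this bead is
    -- constant at 0 and the tail decides.
    rcases Nat.eq_zero_or_pos (num (hornι n j) c) with hc0 | hc0
    · rcases ih hc0 hb with ⟨A, B, rfl, h₁, h₂⟩ | ⟨i, hi, hi', hij, h⟩
      · refine .inl ⟨m :: A, B, rfl, ?_⟩
        rw [List.sum_cons, Chain.vert_cons_add]
        exact ⟨h₁, h₂⟩
      · refine .inr ⟨i, hi, hi', hij, fun t ht => ?_⟩
        rw [List.sum_cons] at ht
        rcases le_total t m with h' | h'
        · rw [Chain.vert_cons_of_le _ _ _ _ h']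
          have := hle t h'
          omega
        · obtain ⟨t, rfl⟩ := Nat.exists_eq_add_of_le h'
          rw [Chain.vert_cons_add]
          exact h t (by omega)
    -- If `c` is interior, it is the joint sought.
    · rcases Nat.lt_or_ge (num (hornι n j) c) (n + 2) with hc1 | hc1
      · refine .inl ⟨[m], L, rfl, ?_⟩
        have : (Chain.cons σ ha' hc γ).vert [m].sum = c := by
          rw [List.sum_singleton, Chain.vert_cons_of_le _ _ _ _ le_rfl, hc]
        rw [this]
        exact ⟨hc0, hc1⟩
      -- The first bead already reaches the last vertex. As a simplex of the horn it misses some `i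
      -- ≠ j`, which is interior because both endpoints occur; the later beads stay at the last
      -- vertex.
      · obtain ⟨i, hij, hi⟩ := (SSet.mem_horn_iff_notMem_range _ _).mp σ.2
        have hσ : ∀ t (ht : t ≤ m), num (hornι n j) (vertex _ m t ht σ) ≠ i := fun t ht e =>
          hi ⟨⟨t, Nat.lt_succ_of_le ht⟩, Fin.ext ((num_vertex (hornι n j) σ ht).symm.trans e)⟩
        have h0 := hσ 0 (Nat.zero_le m)
        have h1 := hσ m le_rfl
        rw [ha', ha] at h0
        rw [hc] at h1
        have hcN := num_le (hornι n j) c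
        have hiN : (i : ℕ) ≤ n + 2 := Nat.lt_succ_iff.mp i.2
        refine .inr ⟨i, by omega, by omega, fun h => hij (Fin.ext h), fun t ht => ?_⟩
        rw [List.sum_cons] at ht
        rcases le_total t m with h' | h'
        · rw [Chain.vert_cons_of_le _ _ _ _ h']
          exact hσ t h'
        · obtain ⟨t, rfl⟩ := Nat.exists_eq_add_of_le h'
          rw [Chain.vert_cons_add]
          have := num_vert_mono (hornι n j) γ (Nat.zero_le t) (by omega)
          rw [Chain.vert_zero] at this
          omega

end HornChains

/-! ### The Segal condition implies unique lifting of inner horns. -/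

section Lifting

variable {V : Type u} [Category.{v} V] [MonoidalCategory V] [BraidedCategory V] [MonoidalClosed V]
  [HasColimits V] {X : TemplicialObject V} {p q : X.S}

lemma isIntMap_id (m : ℕ) : IsIntMap m m (fun i => i) := ⟨monotone_id, rfl, rfl⟩

/-- The existence half of a Yoneda argument: the numbers of the vertices of a chain from 0 to N form
a map of necklaces to Δ^N, and the value at the chain is the restriction of `x` along it. -/
lemma exists_simplexNec_hom {N : ℕ} (x : 𝟙_ V ⟶ (beadTensor X.X [N]).obj p q) :
    ∃ h : (freeTemplicial V (SSet.stdSimplex.{v}.obj (SimplexCategory.mk N))).nec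
        (simplexVertex N 0) (simplexVertex N (Fin.last N)) ⟶ X.nec p q,
      ∀ (L : List ℕ) (hL : ∀ n ∈ L, 0 < n) (γ : Chain _ L _ _), necValue h hL γ =
        x ≫ (nmap X.X [N] L (chainMap (simplexId N) γ)
          (necCond_singleton (isIntMap_chainMap (simplexId N) γ rfl rfl))).app p q := by
  obtain ⟨h, hh⟩ := exists_freeNec_hom (V := V) (Y := X.nec p q)
    (K := SSet.stdSimplex.{v}.obj (SimplexCategory.mk N))
    (a := simplexVertex N 0) (b := simplexVertex N (Fin.last N))
    (fun T γ => x ≫ (nmap X.X [N] T.beads (chainMap (simplexId N) γ)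
      (necCond_singleton (isIntMap_chainMap (simplexId N) γ rfl rfl))).app p q)
    (fun T T' u γ γ' hγ => by
      refine Eq.trans ?_ (Category.assoc _ _ _).symm
      refine congrArg (x ≫ ·) ?_
      refine Eq.trans ?_ (congrArg (fun x : VQuiver.Hom _ _ => x.app p q)
        (nmap_comp X.X T.beads [N] T'.beads u.toHom.raw _ u.necCond
          (necCond_singleton (isIntMap_chainMap (simplexId N) γ rfl rfl)))).symm
      refine congrArg (fun x : VQuiver.Hom _ _ => x.app p q) (nmap_congr_of_le X.X _ _ fun t ht => ?_)
      rw [chainMap_of_le _ _ ht, hγ t ht, chainMap_of_le]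
      exact u.necCond.int.le ht rfl)
  exact ⟨h, fun L hL γ => hh ⟨L, hL⟩ γ⟩

/-- The top simplex of `Δ^N` as a chain. -/
noncomputable def topChain (N : ℕ) : Chain (SSet.stdSimplex.{v}.obj (SimplexCategory.mk N)) [N]
    (simplexVertex N 0) (simplexVertex N (Fin.last N)) := (exists_top_chain N).choose

lemma num_topChain {N t : ℕ} (h : t ≤ N) : num (simplexId.{v} N) ((topChain N).vert t) = t :=
  (exists_top_chain N).choose_spec t h

lemma singleton_pos {N : ℕ} (h : 0 < N) : ∀ n ∈ [N], 0 < n := by simpa using h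

lemma pair_pos {k l : ℕ} (hk : 0 < k) (hl : 0 < l) : ∀ n ∈ [k, l], 0 < n := by
  simpa using ⟨hk, hl⟩

/-- Every chain from 0 to N is a restriction of the top simplex, so a morphism is determined by its
value there. -/
lemma necValue_eq_top {N : ℕ} (hN : 0 < N)
    (h : (freeTemplicial V (SSet.stdSimplex.{v}.obj (SimplexCategory.mk N))).nec
        (simplexVertex N 0) (simplexVertex N (Fin.last N)) ⟶ X.nec p q) {L : List ℕ}
    (hL : ∀ n ∈ L, 0 < n) (γ : Chain _ L _ _) {f : ℕ → ℕ} (hf : NecCond L [N] f)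
    (hγ : ∀ t ≤ L.sum, num (simplexId N) (γ.vert t) = f t) :
    necValue h hL γ =
      necValue h (singleton_pos hN) (topChain N) ≫ (nmap X.X [N] L f hf).app p q := by
  refine necValue_restrict (simplexId_injective N) h hL _ hf _ γ fun t ht => ?_
  rw [hγ t ht, num_topChain]
  have := hf.int.le ht rfl
  simpa using this

lemma simplexNec_hom_ext {N : ℕ} (hN : 0 < N)
    {h h' : (freeTemplicial V (SSet.stdSimplex.{v}.obj (SimplexCategory.mk N))).nec
        (simplexVertex N 0) (simplexVertex N (Fin.last N)) ⟶ X.nec p q}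
    (e : necValue h (singleton_pos hN) (topChain N) =
      necValue h' (singleton_pos hN) (topChain N)) : h = h' := by
  refine necValue_ext fun L hL γ => ?_
  have hf := necCond_singleton (isIntMap_chainMap (simplexId N) γ rfl rfl)
  have hγ : ∀ t ≤ L.sum, num (simplexId N) (γ.vert t) = chainMap (simplexId N) γ t :=
    fun t ht => (chainMap_of_le _ _ ht).symm
  rw [necValue_eq_top hN h hL γ hf hγ, necValue_eq_top hN h' hL γ hf hγ, e]

lemma exists_simplexNec_hom_top {N : ℕ} (hN : 0 < N) (x : 𝟙_ V ⟶ (beadTensor X.X [N]).obj p q) :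
    ∃ h : (freeTemplicial V (SSet.stdSimplex.{v}.obj (SimplexCategory.mk N))).nec
        (simplexVertex N 0) (simplexVertex N (Fin.last N)) ⟶ X.nec p q,
      necValue h (singleton_pos hN) (topChain N) = x := by
  obtain ⟨h, hh⟩ := exists_simplexNec_hom x
  refine ⟨h, (hh _ _ _).trans ?_⟩
  rw [nmap_id]
  · exact Category.comp_id x
  · intro i hi
    rw [chainMap_of_le _ _ hi, num_topChain (by simpa using hi)]

variable {n : ℕ} {j : Fin (n + 3)}

/-- One chain `γ'`, the image of `γ` in the simplex, works for all `h`; its vertices keep their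
numbers. -/
lemma exists_hornInclusion_value {L : List ℕ} (hL : ∀ n ∈ L, 0 < n)
    (γ : Chain (SSet.horn.{v} (n + 2) j).toSSet L (hornVertex n j 0)
      (hornVertex n j (Fin.last (n + 2)))) :
    ∃ γ' : Chain (SSet.stdSimplex.{v}.obj (SimplexCategory.mk (n + 2))) L (simplexVertex (n + 2) 0)
        (simplexVertex (n + 2) (Fin.last (n + 2))),
      (∀ t, num (simplexId (n + 2)) (γ'.vert t) = num (hornι n j) (γ.vert t)) ∧
      ∀ h : (freeTemplicial V (SSet.stdSimplex.{v}.obj (SimplexCategory.mk (n + 2)))).nec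
          (simplexVertex (n + 2) 0) (simplexVertex (n + 2) (Fin.last (n + 2))) ⟶ X.nec p q,
        necValue (K := (SSet.horn.{v} (n + 2) j).toSSet) (hornInclusion V n j ≫ h) hL γ =
          necValue h hL γ' := by
  obtain ⟨γ', h₁, hv⟩ := exists_genChain_btApp (V := V) (SSet.horn.{v} (n + 2) j).ι γ
  refine ⟨γ', fun t => congrArg (num (simplexId (n + 2))) (hv t), fun h => ?_⟩
  refine (Category.assoc _ _ _).symm.trans ?_
  exact congrArg (· ≫ h.app (op ⟨L, hL⟩)) h₁

lemma necValue_hornInclusion_comp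
    (h : (freeTemplicial V (SSet.stdSimplex.{v}.obj (SimplexCategory.mk (n + 2)))).nec
      (simplexVertex (n + 2) 0) (simplexVertex (n + 2) (Fin.last (n + 2))) ⟶ X.nec p q) {L : List ℕ}
    (hL : ∀ n ∈ L, 0 < n) (γ : Chain (SSet.horn.{v} (n + 2) j).toSSet L (hornVertex n j 0)
      (hornVertex n j (Fin.last (n + 2)))) {f : ℕ → ℕ} (hf : NecCond L [n + 2] f)
    (hγ : ∀ t ≤ L.sum, num (hornι n j) (γ.vert t) = f t) :
    necValue (K := (SSet.horn.{v} (n + 2) j).toSSet) (hornInclusion V n j ≫ h) hL γ =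
      necValue h (singleton_pos (Nat.succ_pos _)) (topChain (n + 2)) ≫
        (nmap X.X [n + 2] L f hf).app p q := by
  obtain ⟨γ', hv, e⟩ := exists_hornInclusion_value (X := X) (p := p) (q := q) hL γ
  refine (e h).trans ?_
  exact necValue_eq_top (Nat.succ_pos (n + 1)) h hL γ' hf fun t ht => (hv t).trans (hγ t ht)

/-- Factorization of chains in an inner horn. -/
lemma horn_chain_factor {L : List ℕ}
    (γ : Chain (SSet.horn.{v} (n + 2) j).toSSet L (hornVertex n j 0)
      (hornVertex n j (Fin.last (n + 2)))) :
    (∃ k l : ℕ, 0 < k ∧ 0 < l ∧ k + l = n + 2 ∧ NecCond L [k, l] (chainMap (hornι n j) γ)) ∨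
    ∃ i : ℕ, 0 < i ∧ i < n + 2 ∧ i ≠ j ∧
      NecCond L [n + 1] (fun t => unskip i (chainMap (hornι n j) γ t)) ∧
        ∀ t ≤ L.sum, num (hornι n j) (γ.vert t) ≠ i := by
  have hint : IsIntMap L.sum (n + 2) (chainMap (hornι n j) γ) :=
    isIntMap_chainMap (hornι n j) γ rfl rfl
  rcases horn_chain_cases γ rfl rfl with ⟨A, B, hL, h₁, h₂⟩ | ⟨i, hi, hi', hij, h⟩
  · obtain ⟨l, hkl⟩ := Nat.exists_eq_add_of_le h₂.le
    -- The position of the interior joint gives the first of the two beads.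
    refine .inl ⟨num (hornι n j) (γ.vert A.sum), l, h₁, by omega, hkl.symm,
      necCond_pair (hkl ▸ hint) hL (chainMap_of_le _ _ ?_)⟩
    rw [← hL, List.sum_append]
    omega
  -- A chain that misses `i` factors through `skip i`; the factor is recovered by `unskip i`.
  · refine .inr ⟨i, hi, hi', hij, necCond_singleton ⟨?_, ?_, ?_⟩, h⟩
    · exact fun s t hst => unskip_mono i (hint.mono hst)
    · rw [hint.zero, unskip, if_pos hi]
    · rw [hint.last, unskip, if_neg (by omega)]
      omega

/-- If `X` satisfies the Segal condition below the dimension of an inner horn `Λ^n_j`, morphisms out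
of the horn are determined by their values on `Δ^j ∨ Δ^{n-j}`. -/
lemma hornNec_hom_ext (hS : SegalBelow X.X (n + 2)) (h0 : 0 < j) (hl : j < Fin.last (n + 2))
    {l₀ : ℕ} (hl₀ : (j : ℕ) + l₀ = n + 2) (hpos : ∀ m ∈ [(j : ℕ), l₀], 0 < m)
    (γ₀ : Chain (SSet.horn.{v} (n + 2) j).toSSet [(j : ℕ), l₀] (hornVertex n j 0)
      (hornVertex n j (Fin.last (n + 2))))
    (hγ₀ : ∀ t ≤ n + 2, num (hornι n j) (γ₀.vert t) = t)
    {g g' : (freeTemplicial V (SSet.horn.{v} (n + 2) j).toSSet).nec (hornVertex n j 0)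
      (hornVertex n j (Fin.last (n + 2))) ⟶ X.nec p q}
    (e : necValue g hpos γ₀ = necValue g' hpos γ₀) : g = g' := by
  have hj0 : 0 < (j : ℕ) := h0
  have hl0 : 0 < l₀ := hpos l₀ (by simp)
  refine necValue_ext fun L hL γ => ?_
  have hle : ∀ t, chainMap (hornι n j) γ t ≤ n + 2 := fun t => num_le _ _
  -- It suffices to compare `g` and `g'` on the generating chains: the pairs Δ^k ∨ Δ^l and the inner
  -- faces.
  rcases horn_chain_factor γ with ⟨k, l, hk, hl', hkl, hc⟩ | ⟨i, hi, hi', hij, hc, hm⟩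
  · obtain ⟨γ₁, hγ₁⟩ := exists_split_chain h0 hl k l hk hl' hkl
    have hv : ∀ t ≤ L.sum, num (hornι n j) (γ.vert t) =
        num (hornι n j) (γ₁.vert (chainMap (hornι n j) γ t)) := fun t ht => by
      rw [hγ₁ _ (hle t), chainMap_of_le _ _ ht]
    rw [necValue_restrict (hornι_injective n j) g hL (pair_pos hk hl') hc γ₁ γ hv,
      necValue_restrict (hornι_injective n j) g' hL (pair_pos hk hl') hc γ₁ γ hv]
    refine congrArg (· ≫ _) ?_
    rcases lt_trichotomy k j with hkj | hkj | hkj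
    -- For k < j the common restriction with `γ₀` has shape Δ^k ∨ Δ^{j-k} ∨ Δ^{n+2-j}, where `r + 1`
    -- is j - k. It subdivides the second bead Δ^l, and l < n + 2.
    · obtain ⟨r, hr⟩ := Nat.exists_eq_add_of_lt hkj
      have hs : [k, r + 1, l₀].sum = n + 2 := by simp; omega
      have h₁ : NecCond [k, r + 1, l₀] [k, l] (fun i => i) :=
        necCond_pair (A := [k]) (by rw [hs, hkl]; exact isIntMap_id _) rfl (by simp)
      refine necValue_eq_of_common_restriction (hornι_injective n j) g g' (L := [k, r + 1, l₀])
        (by simp; omega) hpos (pair_pos hk hl') (f₀ := fun i => i) (f₁ := fun i => i)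
        (necCond_pair (A := [k, r + 1]) (by rw [hs, hl₀]; exact isIntMap_id _) rfl (by simp; omega))
        h₁ γ₀ γ₁ (fun t ht => ?_) ?_ e
      · rw [hs] at ht
        rw [hγ₀ t ht, hγ₁ t ht]
      · have := hS (r + 1) l₀ l (by omega) (by omega)
        refine isIso_nmap_cons X.X k [l] [r + 1, l₀] h₁ (fun _ _ => rfl) (by simp) ?_
        exact isIso_nmap_split X.X _ [] _ fun i _ => by simp [shiftMap]
    -- For k = j the chain is `γ₀` itself.
    · subst hkj
      obtain rfl : l = l₀ := by omega
      obtain rfl : γ₀ = γ₁ := Chain.ext_num (hornι_injective n j) fun t ht => by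
        have ht' : t ≤ n + 2 := ht.trans_eq (by simp; omega)
        rw [hγ₀ t ht', hγ₁ t ht']
      exact e
    -- For k > j the first bead is subdivided at `j` instead; its dimension k is below n + 2.
    · obtain ⟨r, hr⟩ := Nat.exists_eq_add_of_lt hkj
      have hs : [(j : ℕ), r + 1, l].sum = n + 2 := by simp; omega
      have h₁ : NecCond [(j : ℕ), r + 1, l] [k, l] (fun i => i) :=
        necCond_pair (A := [(j : ℕ), r + 1]) (by rw [hs, hkl]; exact isIntMap_id _) rfl
          (by simp; omega)
      refine necValue_eq_of_common_restriction (hornι_injective n j) g g' (L := [(j : ℕ), r + 1, l])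
        (by simp; omega) hpos (pair_pos hk hl') (f₀ := fun i => i) (f₁ := fun i => i)
        (necCond_pair (A := [(j : ℕ)]) (by rw [hs, hl₀]; exact isIntMap_id _) rfl (by simp))
        h₁ γ₀ γ₁ (fun t ht => ?_) ?_ e
      · rw [hs] at ht
        rw [hγ₀ t ht, hγ₁ t ht]
      · have := hS j (r + 1) k (by omega) (by omega)
        exact isIso_nmap_split X.X _ [l] h₁ fun _ _ => rfl
  · obtain ⟨γ₁, hγ₁⟩ := exists_face_chain.{v} (n := n) (j := j) i hi hi' hij
    have hv : ∀ t ≤ L.sum, num (hornι n j) (γ.vert t) =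
        num (hornι n j) (γ₁.vert (unskip i (chainMap (hornι n j) γ t))) := fun t ht => by
      have h1 := hc.int.le ht rfl
      rw [List.sum_singleton] at h1
      rw [hγ₁ _ h1, chainMap_of_le _ _ ht, skip_unskip (hm t ht)]
    have hp : ∀ m ∈ [n + 1], 0 < m := singleton_pos (Nat.succ_pos n)
    rw [necValue_restrict (hornι_injective n j) g hL hp hc γ₁ γ hv,
      necValue_restrict (hornι_injective n j) g' hL hp hc γ₁ γ hv]
    refine congrArg (· ≫ _) ?_
    have hskip : IsIntMap (n + 1) (n + 2) (skip i) :=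
      ⟨skip_mono i, by simp [skip, hi], by simp only [skip]; split_ifs <;> omega⟩
    have hskip_le : ∀ t ≤ n + 1, skip i t ≤ n + 2 := fun t ht => hskip.le ht rfl
    -- The common restriction is the face cut at the vertex `j`. This vertex has position j - 1 in
    -- the face if i < j, and position j if i > j. The face has dimension n + 1, so the cut is
    -- invertible.
    rcases lt_or_gt_of_ne hij with hij' | hij'
    · obtain ⟨r, hr⟩ : ∃ r, (j : ℕ) = r + 1 := ⟨j - 1, by omega⟩
      have hs : [r, l₀].sum = n + 1 := by simp; omega
      have h₁ : NecCond [r, l₀] [n + 1] (fun i => i) :=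
        necCond_singleton (by rw [hs]; exact isIntMap_id _)
      refine necValue_eq_of_common_restriction (hornι_injective n j) g g' (L := [r, l₀])
        (by simp; omega) hpos hp (f₀ := skip i) (f₁ := fun i => i)
        (necCond_pair (A := [r]) (by rw [hs, hl₀]; exact hskip) rfl
          (by simp only [List.sum_singleton, skip]; split_ifs <;> omega))
        h₁ γ₀ γ₁ (fun t ht => ?_) ?_ e
      · rw [hs] at ht
        rw [hγ₀ _ (hskip_le t ht), hγ₁ t ht]
      · have := hS r l₀ (n + 1) (by omega) (by omega)
        exact isIso_nmap_split X.X _ [] h₁ fun _ _ => rfl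
    · obtain ⟨r, hr⟩ : ∃ r, l₀ = r + 1 := ⟨l₀ - 1, by omega⟩
      have hs : [(j : ℕ), r].sum = n + 1 := by simp; omega
      have h₁ : NecCond [(j : ℕ), r] [n + 1] (fun i => i) :=
        necCond_singleton (by rw [hs]; exact isIntMap_id _)
      refine necValue_eq_of_common_restriction (hornι_injective n j) g g' (L := [(j : ℕ), r])
        (by simp; omega) hpos hp (f₀ := skip i) (f₁ := fun i => i)
        (necCond_pair (A := [(j : ℕ)]) (by rw [hs, hl₀]; exact hskip) rfl
          (by simp only [List.sum_singleton, skip]; split_ifs <;> omega))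
        h₁ γ₀ γ₁ (fun t ht => ?_) ?_ e
      · rw [hs] at ht
        rw [hγ₀ _ (hskip_le t ht), hγ₁ t ht]
      · have := hS j r (n + 1) (by omega) (by omega)
        exact isIso_nmap_split X.X _ [] h₁ fun _ _ => rfl

lemma necCond_split {k l N : ℕ} (h : k + l = N) : NecCond [k, l] [N] (fun i => i) :=
  necCond_singleton (by rw [← h]; simpa using isIntMap_id (k + l))

/-- The Segal condition implies unique lifting of inner horns. -/
lemma liftsInnerHornsUniquely_of_isSegal (hS : IsSegal X.X) (p q : X.S) :
    LiftsInnerHornsUniquely (X.nec p q) := by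
  intro n j h0 hl g
  have hj0 : 0 < (j : ℕ) := h0
  have hjl : (j : ℕ) < n + 2 := hl
  obtain ⟨l₀, hl₀⟩ := Nat.exists_eq_add_of_lt hjl
  have hl₀' : (j : ℕ) + (l₀ + 1) = n + 2 := by omega
  have hpos := pair_pos hj0 (Nat.succ_pos l₀)
  obtain ⟨γ₀, hγ₀⟩ := exists_split_chain h0 hl j (l₀ + 1) hj0 (Nat.succ_pos _) hl₀'
  have := hS j (l₀ + 1) (n + 2) hl₀'
  have : IsIso (nmap X.X [n + 2] [(j : ℕ), l₀ + 1] (fun i => i) (necCond_split hl₀')) :=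
    isIso_nmap_split X.X hl₀' [] _ fun _ _ => rfl
  have := VQuiver.isIso_app
    (nmap X.X [n + 2] [(j : ℕ), l₀ + 1] (fun i => i) (necCond_split hl₀')) p q
  have hv : ∀ t ≤ [(j : ℕ), l₀ + 1].sum, num (hornι n j) (γ₀.vert t) = t := fun t ht =>
    hγ₀ t (ht.trans_eq (by simp; omega))
  -- The only possible value at the top simplex: the restriction to Δ^j ∨ Δ^{n+2-j} must be the
  -- value of `g`, and this restriction is invertible.
  obtain ⟨h, hh⟩ := exists_simplexNec_hom_top (X := X) (p := p) (q := q) (N := n + 2)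
    (Nat.succ_pos (n + 1))
    (necValue (K := (SSet.horn.{v} (n + 2) j).toSSet) g hpos γ₀ ≫
      inv ((nmap X.X [n + 2] [(j : ℕ), l₀ + 1] (fun i => i) (necCond_split hl₀')).app p q))
  refine ⟨h, ?_, fun h' hh' => ?_⟩
  · refine hornNec_hom_ext (fun a b m e _ => hS a b m e) h0 hl hl₀' hpos γ₀ hγ₀ ?_
    refine (necValue_hornInclusion_comp h hpos γ₀ (necCond_split hl₀') hv).trans ?_
    refine (congrArg (· ≫ _) hh).trans ?_
    rw [Category.assoc, IsIso.inv_hom_id, Category.comp_id]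
  -- Any other extension has the same value on the split chain, hence the same value at the top
  -- simplex.
  · refine simplexNec_hom_ext (N := n + 2) (Nat.succ_pos (n + 1)) (Eq.trans ?_ hh.symm)
    rw [IsIso.eq_comp_inv]
    refine (necValue_hornInclusion_comp h' hpos γ₀ (necCond_split hl₀') hv).symm.trans ?_
    exact congrArg (fun x => necValue (K := (SSet.horn.{v} (n + 2) j).toSSet) x hpos γ₀) hh'

end Lifting

/-! ### Morphisms out of the horn with j = 1, constructed from an element of shape Δ^1 ∨ Δ^{n+1}. -/

section Front

variable {V : Type u} [Category.{v} V] [MonoidalCategory V] [BraidedCategory V] [MonoidalClosed V]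
  [HasColimits V] {X : TemplicialObject V} {p q : X.S} {n : ℕ}

/-- This cuts the first bead behind its first edge. The case r = 0 is allowed, since the lists need
not have positive entries here. -/
lemma necCond_cons_split (r : ℕ) (M : List ℕ) :
    NecCond (1 :: r :: M) ((r + 1) :: M) (fun i => i) where
  int := ⟨monotone_id, rfl, by simp only [List.sum_cons]; omega⟩
  joint i := by
    rcases i with _ | i
    · exact ⟨0, rfl⟩
    · exact ⟨i + 2, by simp only [List.take_succ_cons, List.sum_cons]; omega⟩

/-- As `f 1 = 1`, the new joint at 1 is hit as well, so the same function is a map between the cut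
necklaces. -/
lemma NecCond.cons_split {r s : ℕ} {L M : List ℕ} {f : ℕ → ℕ}
    (h : NecCond ((r + 1) :: L) ((s + 1) :: M) f) (h1 : f 1 = 1) :
    NecCond (1 :: r :: L) (1 :: s :: M) f where
  int := by
    have := h.int
    simp only [List.sum_cons] at this ⊢
    rwa [← add_assoc, ← add_assoc, add_comm 1 r, add_comm 1 s]
  joint i := by
    rcases i with _ | _ | i
    · exact ⟨0, h.int.zero⟩
    · exact ⟨1, by simpa using h1⟩
    · obtain ⟨t, ht⟩ := h.joint (i + 1)
      have e : ((1 :: s :: M).take (i + 2)).sum = (((s + 1) :: M).take (i + 1)).sum := by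
        simp only [List.take_succ_cons, List.sum_cons]; omega
      rcases t with _ | t
      · exact ⟨0, ht.trans e.symm⟩
      · refine ⟨t + 2, Eq.trans (congrArg f ?_) (ht.trans e.symm)⟩
        simp only [List.take_succ_cons, List.sum_cons]; omega

lemma necCond_one_pair {r : ℕ} {M : List ℕ} {f : ℕ → ℕ}
    (h : IsIntMap ((r + 1) :: M).sum (n + 2) f) (h1 : f 1 = 1) :
    NecCond (1 :: r :: M) [1, n + 1] f := by
  refine necCond_pair (A := [1]) ?_ rfl (by simpa using h1)
  simp only [List.sum_cons] at h ⊢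
  rwa [← add_assoc, add_comm 1 r, add_comm 1 (n + 1)]

/-- An element `z` of the shape `Δ^{r+1} ∨ ...` restricts on `Δ^1 ∨ Δ^r ∨ ...` to the restriction of
the element `w` of shape `Δ^1 ∨ Δ^{n+1}` along `φ`. -/
structure IsFront (w : 𝟙_ V ⟶ (beadTensor X.X [1, n + 1]).obj p q) (r : ℕ) (M : List ℕ)
    (φ : ℕ → ℕ) (z : 𝟙_ V ⟶ (beadTensor X.X ((r + 1) :: M)).obj p q) : Prop where
  lt : r < n + 1
  cond : NecCond (1 :: r :: M) [1, n + 1] φ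
  eq : z ≫ (nmap X.X ((r + 1) :: M) (1 :: r :: M) (fun i => i) (necCond_cons_split r M)).app p q =
    w ≫ (nmap X.X [1, n + 1] (1 :: r :: M) φ cond).app p q

variable {w : 𝟙_ V ⟶ (beadTensor X.X [1, n + 1]).obj p q}

lemma isIso_nmap_cons_split (hS : SegalBelow X.X (n + 2)) {r : ℕ} (hr : r < n + 1) (M : List ℕ)
    (p q : X.S) : IsIso ((nmap X.X ((r + 1) :: M) (1 :: r :: M) (fun i => i)
      (necCond_cons_split r M)).app p q) := by
  have := hS 1 r (r + 1) (add_comm 1 r) (by omega)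
  have := isIso_nmap_split X.X (add_comm 1 r) M (necCond_cons_split r M) fun _ _ => rfl
  exact VQuiver.isIso_app _ p q

/-- The first bead has dimension r + 1 < n + 2, so cutting off its first edge acts invertibly and an
element is determined by its restriction to the cut necklace. -/
lemma IsFront.unique (hS : SegalBelow X.X (n + 2)) {r : ℕ} {M : List ℕ} {φ φ' : ℕ → ℕ}
    {z z' : 𝟙_ V ⟶ (beadTensor X.X ((r + 1) :: M)).obj p q} (h : IsFront w r M φ z)
    (h' : IsFront w r M φ' z') (e : ∀ t, φ t = φ' t) : z = z' := by
  obtain rfl : φ = φ' := funext e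
  have := isIso_nmap_cons_split hS h.lt M p q
  exact (cancel_mono _).mp (h.eq.trans h'.eq.symm)

lemma exists_isFront (hS : SegalBelow X.X (n + 2))
    (w : 𝟙_ V ⟶ (beadTensor X.X [1, n + 1]).obj p q) {r : ℕ} {M : List ℕ} {φ : ℕ → ℕ}
    (hr : r < n + 1) (h : IsIntMap ((r + 1) :: M).sum (n + 2) φ) (h1 : φ 1 = 1) :
    ∃ z, IsFront w r M φ z := by
  have := isIso_nmap_cons_split hS hr M p q
  refine ⟨w ≫ (nmap X.X [1, n + 1] (1 :: r :: M) φ (necCond_one_pair h h1)).app p q ≫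
    inv ((nmap X.X ((r + 1) :: M) (1 :: r :: M) (fun i => i) (necCond_cons_split r M)).app p q),
    hr, necCond_one_pair h h1, ?_⟩
  rw [Category.assoc, Category.assoc, IsIso.inv_hom_id, Category.comp_id]

lemma nmap_app_comp (M N L : List ℕ) (f g : ℕ → ℕ) (hf : NecCond L M f) (hg : NecCond M N g)
    (z : 𝟙_ V ⟶ (beadTensor X.X N).obj p q) :
    (z ≫ (nmap X.X N M g hg).app p q) ≫ (nmap X.X M L f hf).app p q =
      z ≫ (nmap X.X N L (fun i => g (f i)) (hf.comp hg)).app p q :=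
  (Category.assoc _ _ _).trans (congrArg (z ≫ ·)
    (congrArg (fun x : VQuiver.Hom _ _ => x.app p q) (nmap_comp X.X M N L f g hf hg)))

/-- Functoriality: restriction along `f` commutes with cutting off the first edge. -/
lemma IsFront.restrict {r s : ℕ} {L M : List ℕ} {φ : ℕ → ℕ}
    {z : 𝟙_ V ⟶ (beadTensor X.X ((r + 1) :: M)).obj p q} (h : IsFront w r M φ z) {f : ℕ → ℕ}
    (hf : NecCond ((s + 1) :: L) ((r + 1) :: M) f) (h1 : f 1 = 1) (hs : s < n + 1) :
    IsFront w s L (fun t => φ (f t))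
      (z ≫ (nmap X.X ((r + 1) :: M) ((s + 1) :: L) f hf).app p q) where
  lt := hs
  cond := (hf.cons_split h1).comp h.cond
  eq := by
    refine (nmap_app_comp _ _ _ _ _ _ _ _).trans ?_
    refine (nmap_app_comp _ _ _ _ _ (hf.cons_split h1) (necCond_cons_split r M) z).symm.trans ?_
    refine (congrArg (· ≫ _) h.eq).trans ?_
    exact nmap_app_comp _ _ _ _ _ (hf.cons_split h1) h.cond w

/-- Restrictions of two elements as in `IsFront` along maps with a common refinement agree. -/
lemma IsFront.common (hS : SegalBelow X.X (n + 2)) {r r' s : ℕ} {M M' T L : List ℕ}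
    {φ φ' f f' g u u' : ℕ → ℕ}
    {z : 𝟙_ V ⟶ (beadTensor X.X ((r + 1) :: M)).obj p q} (h : IsFront w r M φ z)
    {z' : 𝟙_ V ⟶ (beadTensor X.X ((r' + 1) :: M')).obj p q} (h' : IsFront w r' M' φ' z')
    (hs : s < n + 1) (hf : NecCond ((s + 1) :: T) ((r + 1) :: M) f) (h1 : f 1 = 1)
    (hf' : NecCond ((s + 1) :: T) ((r' + 1) :: M') f') (h1' : f' 1 = 1)
    (e : ∀ t, φ (f t) = φ' (f' t)) (hg : NecCond L ((s + 1) :: T) g)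
    (hu : NecCond L ((r + 1) :: M) u) (hu' : NecCond L ((r' + 1) :: M') u')
    (eu : ∀ t ≤ L.sum, f (g t) = u t) (eu' : ∀ t ≤ L.sum, f' (g t) = u' t) :
    z ≫ (nmap X.X ((r + 1) :: M) L u hu).app p q =
      z' ≫ (nmap X.X ((r' + 1) :: M') L u' hu').app p q := by
  -- On the refinement both elements restrict to the element determined by `w` and the same map to
  -- [n + 2].
  have hz := IsFront.unique hS (h.restrict hf h1 hs) (h'.restrict hf' h1' hs) e
  rw [← nmap_congr_of_le X.X (hg.comp hf) hu eu, ← nmap_congr_of_le X.X (hg.comp hf') hu' eu',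
    ← nmap_app_comp _ _ _ _ _ hg hf, ← nmap_app_comp _ _ _ _ _ hg hf', hz]

lemma isIntMap_skip {m i : ℕ} (hi : 0 < i) (h : i ≤ m) : IsIntMap m (m + 1) (skip i) :=
  ⟨skip_mono i, by simp [skip, hi], by simp only [skip]; split_ifs <;> omega⟩

/-- The value at a chain in `Λ^{n+2}_1` with vertices `c 0 ≤ c 1 ≤ ...` of the morphism determined by
an element `w` of shape `Δ^1 ∨ Δ^{n+1}`. -/
inductive IsHornValue (w : 𝟙_ V ⟶ (beadTensor X.X [1, n + 1]).obj p q) (L : List ℕ) (c : ℕ → ℕ) :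
    (𝟙_ V ⟶ (beadTensor X.X L).obj p q) → Prop
  | pair (r l : ℕ) (h : r + 1 + l = n + 2) (z : 𝟙_ V ⟶ (beadTensor X.X [r + 1, l]).obj p q)
    (hz : IsFront w r [l] (fun i => i) z) (hc : NecCond L [r + 1, l] c) :
    IsHornValue w L c (z ≫ (nmap X.X [r + 1, l] L c hc).app p q)
  -- These are the interior vertices other than 1. The condition on `c` ensures that `skip i` undoes
  -- `unskip i` along the chain.
  | face (i : ℕ) (hi : 2 ≤ i) (hi' : i < n + 2)
    (z : 𝟙_ V ⟶ (beadTensor X.X [n + 1]).obj p q) (hz : IsFront w n [] (skip i) z)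
    (hc : NecCond L [n + 1] (fun t => unskip i (c t))) (hm : ∀ t ≤ L.sum, c t ≠ i) :
    IsHornValue w L c (z ≫ (nmap X.X [n + 1] L (fun t => unskip i (c t)) hc).app p q)

lemma NecCond.exists_joint {L : List ℕ} {k l : ℕ} {f : ℕ → ℕ} (h : NecCond L [k, l] f) :
    ∃ A B, A ++ B = L ∧ f A.sum = k := by
  obtain ⟨i, hi⟩ := h.joint 1
  exact ⟨L.take i, L.drop i, List.take_append_drop i L, by simpa using hi⟩

/-- The chain has joints over both r + 1 and r' + 1, so it factors through the common refinement
with three beads. -/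
lemma isHornValue_pair_pair (hS : SegalBelow X.X (n + 2)) {L : List ℕ} {c : ℕ → ℕ} {r r' l l' : ℕ}
    (hr : r < r') (h : r + 1 + l = n + 2) (h' : r' + 1 + l' = n + 2)
    {z : 𝟙_ V ⟶ (beadTensor X.X [r + 1, l]).obj p q} (hz : IsFront w r [l] (fun i => i) z)
    {z' : 𝟙_ V ⟶ (beadTensor X.X [r' + 1, l']).obj p q} (hz' : IsFront w r' [l'] (fun i => i) z')
    (hc : NecCond L [r + 1, l] c) (hc' : NecCond L [r' + 1, l'] c) :
    z ≫ (nmap X.X [r + 1, l] L c hc).app p q = z' ≫ (nmap X.X [r' + 1, l'] L c hc').app p q := by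
  obtain ⟨d, rfl⟩ := Nat.exists_eq_add_of_lt hr
  have hs : [r + 1, d + 1, l'].sum = n + 2 := by simp; omega
  have hg : NecCond L [r + 1, d + 1, l'] c := by
    obtain ⟨i, hi⟩ := hc.joint 1
    obtain ⟨i', hi'⟩ := hc'.joint 1
    have := hc.int
    refine ⟨⟨this.mono, this.zero, ?_⟩, fun k => ?_⟩
    · rw [this.last, hs]; simpa using h
    · rcases k with _ | _ | _ | k
      · exact ⟨0, this.zero⟩
      · exact ⟨i, by simpa using hi⟩
      · exact ⟨i', by rw [hi']; simp; omega⟩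
      · exact ⟨L.length, by
          rw [List.take_length, this.last, List.take_of_length_le (by simp), hs]; simpa using h⟩
  refine IsFront.common hS hz hz' (s := r) (T := [d + 1, l']) (f := fun i => i) (f' := fun i => i)
    (g := c) hz.lt ?_ rfl ?_ rfl (fun _ => rfl) hg hc hc' (fun _ _ => rfl) fun _ _ => rfl
  · exact necCond_pair (A := [r + 1]) (by rw [hs, h]; exact isIntMap_id _) rfl (by simp)
  · exact necCond_pair (A := [r + 1, d + 1]) (by rw [hs, h']; exact isIntMap_id _) rfl
      (by simp; omega)

/-- The chain hits r + 1 and misses `i`, so these differ and r + 1 is a vertex of the i-th face. The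
common refinement is this face cut at that vertex. -/
lemma isHornValue_pair_face (hS : SegalBelow X.X (n + 2)) {L : List ℕ} {c : ℕ → ℕ} {r l i : ℕ}
    (h : r + 1 + l = n + 2) (hi : 2 ≤ i) (hi' : i < n + 2)
    {z : 𝟙_ V ⟶ (beadTensor X.X [r + 1, l]).obj p q} (hz : IsFront w r [l] (fun i => i) z)
    {z' : 𝟙_ V ⟶ (beadTensor X.X [n + 1]).obj p q} (hz' : IsFront w n [] (skip i) z')
    (hc : NecCond L [r + 1, l] c) (hc' : NecCond L [n + 1] (fun t => unskip i (c t)))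
    (hm : ∀ t ≤ L.sum, c t ≠ i) :
    z ≫ (nmap X.X [r + 1, l] L c hc).app p q =
      z' ≫ (nmap X.X [n + 1] L (fun t => unskip i (c t)) hc').app p q := by
  obtain ⟨A, B, hL, hA⟩ := hc.exists_joint
  have hne : r + 1 ≠ i := hA ▸ hm _ (by rw [← hL, List.sum_append]; omega)
  have hlt := hz.lt
  -- The position s + 1 of the joint within the face is positive, as i ≥ 2.
  obtain ⟨s, hs⟩ : ∃ s, unskip i (r + 1) = s + 1 :=
    ⟨unskip i (r + 1) - 1, by simp only [unskip]; split_ifs <;> omega⟩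
  have hs' : skip i (s + 1) = r + 1 := by rw [← hs, skip_unskip hne]
  have hsn : s < n + 1 := by simp only [unskip] at hs; split_ifs at hs <;> omega
  obtain ⟨b, hb⟩ : ∃ b, s + 1 + b = n + 1 := ⟨n - s, by omega⟩
  have hsum : [s + 1, b].sum = n + 1 := by simpa using hb
  refine IsFront.common hS hz hz' (s := s) (T := [b]) (f := skip i) (f' := fun i => i)
    (g := fun t => unskip i (c t)) hsn ?_ (by simp only [skip]; split_ifs <;> omega) ?_ rfl
    (fun _ => rfl) ?_ hc hc' (fun t ht => skip_unskip (hm t ht)) fun _ _ => rfl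
  · exact necCond_pair (A := [s + 1])
      (by rw [hsum, h]; exact isIntMap_skip (by omega) (by omega)) rfl (by simpa using hs')
  · exact necCond_singleton (by rw [hsum]; exact isIntMap_id _)
  · refine necCond_pair (A := A) ?_ hL (by rw [hA, hs])
    rw [hb]
    simpa using hc'.int

/-- The common refinement is the face of codimension two that omits both vertices. -/
lemma isHornValue_face_face (hS : SegalBelow X.X (n + 2)) {L : List ℕ} {c : ℕ → ℕ} {i i' : ℕ}
    (hi : 2 ≤ i) (hii : i < i') (hi' : i' < n + 2)
    {z : 𝟙_ V ⟶ (beadTensor X.X [n + 1]).obj p q} (hz : IsFront w n [] (skip i) z)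
    {z' : 𝟙_ V ⟶ (beadTensor X.X [n + 1]).obj p q} (hz' : IsFront w n [] (skip i') z')
    (hc : NecCond L [n + 1] (fun t => unskip i (c t)))
    (hc' : NecCond L [n + 1] (fun t => unskip i' (c t)))
    (hm : ∀ t ≤ L.sum, c t ≠ i) (hm' : ∀ t ≤ L.sum, c t ≠ i') :
    z ≫ (nmap X.X [n + 1] L (fun t => unskip i (c t)) hc).app p q =
      z' ≫ (nmap X.X [n + 1] L (fun t => unskip i' (c t)) hc').app p q := by
  obtain ⟨s, rfl⟩ : ∃ s, n = s + 1 := ⟨n - 1, by omega⟩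
  obtain ⟨k, rfl⟩ : ∃ k, i' = k + 1 := ⟨i' - 1, by omega⟩
  -- With k = i' - 1 this is the cosimplicial identity: omitting `k` and then `i` is the same as
  -- omitting `i` and then k + 1.
  refine IsFront.common hS hz hz' (s := s) (T := []) (f := skip k) (f' := skip i)
    (g := fun t => unskip k (unskip i (c t))) (by omega) ?_ ?_ ?_ ?_ ?_ ?_ hc hc' ?_ ?_
  · exact necCond_singleton (isIntMap_skip (by omega) (by simp; omega))
  · simp only [skip]; split_ifs <;> omega
  · exact necCond_singleton (isIntMap_skip (by omega) (by simp; omega))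
  · simp only [skip]; split_ifs <;> omega
  · intro t
    simp only [skip]; split_ifs <;> omega
  · have := hc.int
    refine necCond_singleton ⟨fun a b h => unskip_mono k (this.mono h), ?_, ?_⟩
    · have := this.zero
      rw [this, unskip, if_pos (by omega)]
    · have := this.last
      simp only [List.sum_singleton] at this
      rw [this, unskip, if_neg (by omega)]
      omega
  · intro t ht
    have h1 := hm t ht
    have h2 := hm' t ht
    simp only [skip, unskip]; split_ifs <;> omega
  · intro t ht
    have h1 := hm t ht
    have h2 := hm' t ht
    simp only [skip, unskip]; split_ifs <;> omega

/-- The value does not depend on the generating chain through which the given chain is factored.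
Together with `IsHornValue.restrict` this yields naturality. -/
lemma IsHornValue.unique (hS : SegalBelow X.X (n + 2)) {L : List ℕ} {c : ℕ → ℕ}
    {y y' : 𝟙_ V ⟶ (beadTensor X.X L).obj p q} (hy : IsHornValue w L c y)
    (hy' : IsHornValue w L c y') : y = y' := by
  rcases hy with ⟨r, l, h, z, hz, hc⟩ | ⟨i, hi, hin, z, hz, hc, hm⟩ <;>
    rcases hy' with ⟨r', l', h', z', hz', hc'⟩ | ⟨i', hi', hin', z', hz', hc', hm'⟩
  · rcases lt_trichotomy r r' with hr | rfl | hr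
    · exact isHornValue_pair_pair hS hr h h' hz hz' hc hc'
    · obtain rfl : l = l' := by omega
      rw [hz.unique hS hz' fun _ => rfl]
    · exact (isHornValue_pair_pair hS hr h' h hz' hz hc' hc).symm
  · exact isHornValue_pair_face hS h hi' hin' hz hz' hc hc' hm'
  · exact (isHornValue_pair_face hS h' hi hin hz' hz hc' hc hm).symm
  · rcases lt_trichotomy i i' with hii | rfl | hii
    · exact isHornValue_face_face hS hi hii hin' hz hz' hc hc' hm hm'
    · rw [hz.unique hS hz' fun _ => rfl]
    · exact (isHornValue_face_face hS hi' hii hin hz' hz hc' hc hm' hm).symm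

lemma IsHornValue.restrict {L M : List ℕ} {c c' : ℕ → ℕ}
    {y : 𝟙_ V ⟶ (beadTensor X.X M).obj p q} (hy : IsHornValue w M c y) {f : ℕ → ℕ}
    (hf : NecCond L M f) (hc' : Monotone c') (e : ∀ t ≤ L.sum, c (f t) = c' t) :
    IsHornValue w L c' (y ≫ (nmap X.X M L f hf).app p q) := by
  rcases hy with ⟨r, l, h, z, hz, hc⟩ | ⟨i, hi, hin, z, hz, hc, hm⟩
  · rw [nmap_app_comp _ _ _ _ _ hf hc, nmap_congr_of_le X.X _ ((hf.comp hc).congr hc' e) e]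
    exact .pair r l h z hz _
  · have e' : ∀ t ≤ L.sum, unskip i (c (f t)) = unskip i (c' t) := fun t ht => by rw [e t ht]
    rw [nmap_app_comp _ _ _ _ _ hf hc, nmap_congr_of_le X.X _
      ((hf.comp hc).congr (fun a b h => unskip_mono i (hc' h)) e') e']
    exact .face i hi hin z hz _ fun t ht => e t ht ▸ hm _ (hf.int.le ht rfl)

lemma exists_isHornValue (hS : SegalBelow X.X (n + 2))
    (w : 𝟙_ V ⟶ (beadTensor X.X [1, n + 1]).obj p q) {L : List ℕ} {j : Fin (n + 3)}
    (hj : (j : ℕ) = 1)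
    (γ : Chain (SSet.horn.{v} (n + 2) j).toSSet L (hornVertex n j 0)
      (hornVertex n j (Fin.last (n + 2)))) :
    ∃ y, IsHornValue w L (chainMap (hornι n j) γ) y := by
  rcases horn_chain_factor γ with ⟨k, l, hk, hl, hkl, hc⟩ | ⟨i, hi, hi', hij, hc, hm⟩
  · obtain ⟨r, rfl⟩ : ∃ r, k = r + 1 := ⟨k - 1, by omega⟩
    obtain ⟨z, hz⟩ := exists_isFront hS w (r := r) (M := [l]) (φ := fun i => i) (by omega)
      (by rw [← hkl]; simpa using isIntMap_id (r + 1 + l)) rfl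
    exact ⟨_, .pair r l hkl z hz hc⟩
  · obtain ⟨z, hz⟩ := exists_isFront hS w (r := n) (M := []) (φ := skip i) (by omega)
      (by simpa using isIntMap_skip (m := n + 1) hi (by omega))
      (by simp only [skip]; split_ifs <;> omega)
    exact ⟨_, .face i (by omega) hi' z hz hc fun t ht => chainMap_of_le _ _ ht ▸ hm t ht⟩

/-- Below the dimension of the Segal condition, an element of shape `Δ^1 ∨ Δ^{n+1}` extends to a
morphism out of the horn `Λ^{n+2}_1`. -/
lemma exists_hornNec_hom (hS : SegalBelow X.X (n + 2))
    (w : 𝟙_ V ⟶ (beadTensor X.X [1, n + 1]).obj p q) {j : Fin (n + 3)} (hj : (j : ℕ) = 1)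
    (hpos : ∀ m ∈ [1, n + 1], 0 < m)
    (γ₀ : Chain (SSet.horn.{v} (n + 2) j).toSSet [1, n + 1] (hornVertex n j 0)
      (hornVertex n j (Fin.last (n + 2))))
    (hγ₀ : ∀ t ≤ n + 2, num (hornι n j) (γ₀.vert t) = t) :
    ∃ g : (freeTemplicial V (SSet.horn.{v} (n + 2) j).toSSet).nec (hornVertex n j 0)
      (hornVertex n j (Fin.last (n + 2))) ⟶ X.nec p q, necValue g hpos γ₀ = w := by
  -- The choices need no coherence, because the value at each chain is unique.
  choose y hy using fun (L : List ℕ)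
    (γ : Chain (SSet.horn.{v} (n + 2) j).toSSet L (hornVertex n j 0)
      (hornVertex n j (Fin.last (n + 2)))) => exists_isHornValue hS w hj γ
  have hint : ∀ (L : List ℕ) (γ : Chain (SSet.horn.{v} (n + 2) j).toSSet L (hornVertex n j 0)
      (hornVertex n j (Fin.last (n + 2)))), IsIntMap L.sum (n + 2) (chainMap (hornι n j) γ) :=
    fun L γ => isIntMap_chainMap (hornι n j) γ rfl rfl
  obtain ⟨g, hg⟩ := exists_freeNec_hom (V := V) (Y := X.nec p q)
    (K := (SSet.horn.{v} (n + 2) j).toSSet) (a := hornVertex n j 0)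
    (b := hornVertex n j (Fin.last (n + 2))) (fun T γ => y T.beads γ)
    (fun T T' u γ γ' hγ => by
      refine (hy _ _).unique hS ((hy T.beads γ).restrict u.necCond (hint _ γ').mono fun t ht => ?_)
      rw [chainMap_of_le _ _ ht, hγ t ht, chainMap_of_le]
      exact u.necCond.int.le ht rfl)
  refine ⟨g, (hg ⟨_, hpos⟩ γ₀).trans ((hy _ γ₀).unique hS ?_)⟩
  have hs : [1, n + 1].sum = n + 2 := by simp; omega
  have he : ∀ t ≤ [1, n + 1].sum, chainMap (hornι n j) γ₀ t = t := fun t ht => by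
    rw [chainMap_of_le _ _ ht, hγ₀ t (ht.trans_eq hs)]
  have hc : NecCond [1, n + 1] [0 + 1, n + 1] (chainMap (hornι n j) γ₀) :=
    necCond_pair (A := [1]) (by rw [show 0 + 1 + (n + 1) = n + 2 by omega]; exact hint _ γ₀) rfl
      (he 1 (by simp))
  -- For r = 0 the shape Δ^{r+1} ∨ Δ^{n+1} is that of `w` itself, so `w` is its own front element
  -- and is the value at `γ₀`.
  have hw : IsFront w 0 [n + 1] (fun i => i) w :=
    ⟨Nat.succ_pos n, necCond_cons_split 0 [n + 1], rfl⟩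
  have hv := IsHornValue.pair 0 (n + 1) (by omega) w hw hc
  have e : w ≫ (nmap X.X [0 + 1, n + 1] [1, n + 1] _ hc).app p q = w := by
    refine (congrArg (w ≫ ·) (congrArg (fun x : VQuiver.Hom _ _ => x.app p q)
      (nmap_id X.X [1, n + 1] _ hc he))).trans (Category.comp_id w)
  exact Eq.mp (congrArg (IsHornValue w [1, n + 1] _) e) hv

end Front

/-! ### Unique lifting implies the Segal condition when U is conservative. -/

section Converse

variable {V : Type u} [Category.{v} V] [MonoidalCategory V] [BraidedCategory V] [MonoidalClosed V]
  [HasColimits V] {X : TemplicialObject V}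

/-- Unique lifting of the horn `Λ^{n+2}_1` splits off the first edge, on underlying sets. -/
lemma bijective_comp_nmap {n : ℕ} (hS : SegalBelow X.X (n + 2)) {p q : X.S}
    (H : LiftsInnerHornsUniquely (X.nec p q)) (hn : 1 + (n + 1) = n + 2) :
    Function.Bijective fun x : 𝟙_ V ⟶ (beadTensor X.X [n + 2]).obj p q =>
      x ≫ (nmap X.X [n + 2] [1, n + 1] (fun i => i) (necCond_split hn)).app p q := by
  let j : Fin (n + 3) := ⟨1, by omega⟩
  have h0 : 0 < j := Nat.zero_lt_one
  have hl : j < Fin.last (n + 2) := Nat.succ_lt_succ (Nat.succ_pos n)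
  have hpos := pair_pos Nat.zero_lt_one (Nat.succ_pos n)
  obtain ⟨γ₀, hγ₀⟩ := exists_split_chain.{v} h0 hl 1 (n + 1) Nat.zero_lt_one (Nat.succ_pos n) hn
  have hv : ∀ t ≤ [1, n + 1].sum, num (hornι n j) (γ₀.vert t) = t := fun t ht =>
    hγ₀ t (ht.trans_eq (by simp; omega))
  refine ⟨fun x x' e => ?_, fun w => ?_⟩
  · obtain ⟨h, rfl⟩ := exists_simplexNec_hom_top (N := n + 2) (Nat.succ_pos (n + 1)) x
    obtain ⟨h', rfl⟩ := exists_simplexNec_hom_top (N := n + 2) (Nat.succ_pos (n + 1)) x'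
    -- Both morphisms have the same restriction to the horn, because they agree on Δ^1 ∨ Δ^{n+1};
    -- uniqueness of the lift identifies them.
    have key : hornInclusion V n j ≫ h = hornInclusion V n j ≫ h' := by
      refine hornNec_hom_ext hS h0 hl hn hpos γ₀ hγ₀ ?_
      refine (necValue_hornInclusion_comp h hpos γ₀ (necCond_split hn) hv).trans (e.trans ?_)
      exact (necValue_hornInclusion_comp h' hpos γ₀ (necCond_split hn) hv).symm
    rw [(H n j h0 hl _).unique key rfl]
  -- The given element is a value of some morphism out of the horn; the top value of a lift is a
  -- preimage.
  · obtain ⟨g, hg⟩ := exists_hornNec_hom hS w (j := j) rfl hpos γ₀ hγ₀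
    obtain ⟨h, hh, -⟩ := H n j h0 hl g
    refine ⟨necValue h (singleton_pos (Nat.succ_pos (n + 1))) (topChain (n + 2)), ?_⟩
    refine (necValue_hornInclusion_comp h hpos γ₀ (necCond_split hn) hv).symm.trans (Eq.trans ?_ hg)
    exact congrArg (fun x => necValue (K := (SSet.horn.{v} (n + 2) j).toSSet) x hpos γ₀) hh

/-- The action of the subdivision and the comultiplication differ only by iterated comultiplications
of one-bead lists, which are inverse unitors. -/
lemma isIso_cellδ_of_nmap {W : Type*} [Category W] [MonoidalCategory W] (X : FIntᵒᵖ ⥤ W)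
    [X.OplaxMonoidal] [IsIso (cellη X)] {a b k : ℕ} (hk : a + b = k)
    [IsIso (nmap X [k] [a, b] (fun i => i) (necCond_split hk))] : IsIso (cellδ X a b k hk) := by
  have hm : ∀ b : ℕ, IsIso (mup X [b] b (by simp)) := fun b => by
    have e : mup X [b] b (by simp) = (ρ_ (cell X b)).inv := by
      rw [mup_cons X b [] b 0 _ List.sum_nil (Nat.add_zero b), mup_nil, cellδ_right]
    exact e ▸ inferInstance
  have hs : [a, b].sum = k := by simpa using hk
  subst hk
  have e := mup_nmap X [a + b] [a, b] (a + b) (fun i => i) (necCond_split rfl) (by simp)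
    (by rw [hs]; exact isIntMap_id _)
  have e' : bmap X [a, b] (a + b) (fun i => i) (by rw [hs]; exact isIntMap_id _) =
      mup X [a, b] (a + b) hs :=
    (congrArg (· ≫ mup X [a, b] (a + b) hs)
      (cellMap_id X (m := a + b) (isIntMap_id _) fun _ _ => rfl)).trans (Category.id_comp _)
  have := hm (a + b)
  have := hm b
  rw [e', mup_cons X a [b] (a + b) b hs (by simp) rfl] at e
  exact IsIso.of_isIso_fac_right e.symm

/-- Unique lifting of inner horns implies the Segal condition if `V(I, -)` is conservative. -/
lemma isSegal_of_liftsInnerHornsUniquely [(coyoneda.obj (op (𝟙_ V))).ReflectsIsomorphisms]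
    (H : ∀ p q : X.S, LiftsInnerHornsUniquely (X.nec p q)) : IsSegal X.X := by
  have key : ∀ n, SegalBelow X.X n := fun n => by
    induction n with
    | zero => exact fun _ _ _ _ h => absurd h (Nat.not_lt_zero _)
    | succ m ih =>
      -- Only comultiplications splitting off an edge need to be treated; the new dimension is `m`.
      refine segalBelow_of_one X.X _ fun b k h hk => ?_
      rcases Nat.lt_or_ge k m with hkm | hkm
      · exact ih 1 b k h hkm
      obtain rfl : k = m := by omega
      -- In dimension 1 counitality suffices. From dimension 2 on there is an inner horn with j = 1.
      rcases b with _ | n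
      · subst h
        exact isIso_cellδ_zero_right X.X 1 rfl
      obtain rfl : k = n + 2 := by omega
      have : IsIso (nmap X.X [n + 2] [1, n + 1] (fun i => i) (necCond_split h)) :=
        VQuiver.isIso_of_app fun p q => by
          -- Unique lifting makes U of this component bijective, and conservativity of U makes the
          -- component invertible in `V`.
          have : IsIso ((coyoneda.obj (op (𝟙_ V))).map
              ((nmap X.X [n + 2] [1, n + 1] (fun i => i) (necCond_split h)).app p q)) :=
            (isIso_iff_bijective _).mpr (bijective_comp_nmap ih (H p q) h)
          exact isIso_of_reflects_iso _ (coyoneda.obj (op (𝟙_ V)))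
      exact isIso_cellδ_of_nmap X.X h
  exact fun a b m h => key (m + 1) a b m h (Nat.lt_succ_self m)

end Converse

theorem mainTheorem4 {V : Type u} [Category.{v} V] [MonoidalCategory V] [SymmetricCategory V]
    [MonoidalClosed V] [HasLimits V] [HasColimits V] (X : TemplicialObject V) :
    ((∃ C : SmallVCat V, Nonempty (X ≅ templicialNerve C)) →
      ∀ a b : X.S, LiftsInnerHornsUniquely (X.nec a b)) ∧
    ((coyoneda.obj (op (𝟙_ V))).ReflectsIsomorphisms →
      ((∃ C : SmallVCat V, Nonempty (X ≅ templicialNerve C)) ↔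
        ∀ a b : X.S, LiftsInnerHornsUniquely (X.nec a b))) := by
  have h : (∃ C : SmallVCat V, Nonempty (X ≅ templicialNerve C)) →
      ∀ a b : X.S, LiftsInnerHornsUniquely (X.nec a b) := by
    rintro ⟨C, ⟨φ⟩⟩
    exact liftsInnerHornsUniquely_of_isSegal
      (TemplicialObject.isSegal_of_iso φ (TemplicialObject.isSegal_templicialNerve C))
  exact ⟨h, fun _ => ⟨h, fun H =>
    TemplicialObject.exists_iso_templicialNerve X (isSegal_of_liftsInnerHornsUniquely H)⟩⟩
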